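/- Let $[a,b]$ denote the set of integers $x$ with $a\le x\le b$, and write $2A=A+A=\{a+a':a,a'\in A\}$ and $x\pm A=\{x\pm a: a\in A\}$. A Freiman isomorphism $\varphi:X\to Y$ between subsets of abelian groups is a bijection such that, for all $a,b,c,d\in X$, $a+b=c+d$ if and only if $\varphi(a)+\varphi(b)=\varphi(c)+\varphi(d)$. A finite set $A\subseteq\mathbb{Z}$ is a *bi-arithmetic progression* if there are integers $n_0,n_1\ge 0$ with $n_0+n_1+2=|A|$ such that $A$ is the image under a Freiman isomorphism of $\{(0,0),(0,1),\ldots,(0,n_0)\}\cup\{(1,0),(1,1),\ldots,(1,n_1)\}\subseteq\mathbb{Z}^2$. Let $B\subseteq[u,v]$. Call $B$ *half dense* in $[u,v]$ if $|B|=\frac12(v-u+1)$; *anti-symmetric* in $[u,v]$ if $B\cap(u+v-B)=\emptyset$ and $B\cup(u+v-B)=[u,v]$; *left dense* in $[u,v]$ if it is half dense and $|B\cap[u,x]|>\frac12(x-u+1)$ for all $x\in[u,v-1]$; *right dense* in $[u,v]$ if it is half dense and $|B\cap[x,v]|>\frac12(v-x+1)$ for all $x\in[u+1,v]$. A left dense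 anti-symmetric set $B$ in $[u,v]$ is *additively minimal* in $[u,v]$ if $$2(B\cup\{v+1\})=[2u,u+v-1]\cup\bigl(v+1+(B\cup\{v+1\})\bigr),$$ and a right dense anti-symmetric set $B$ in $[u,v]$ is *additively minimal* in $[u,v]$ if $$2(B\cup\{u-1\})=[u+v+1,2v]\cup\bigl(u-1+(B\cup\{u-1\})\bigr).$$ **Theorem.** Let $A$ be a finite set of integers with $\min A=0$, $\gcd(A)=1$ and $\max A=n$. If $|A|\ge 2$ and $|2A|=3|A|-3$, then at least one of the following holds. 1. $A$ is a bi-arithmetic progression. 2. $2A$ contains an interval of integers consisting of $2|A|-1$ elements. 3. $|A|=6$ and $A$ is the image under a Freiman isomorphism of $K_6=\{(0,0),(0,1),(0,2),(1,0),(1,1),(2,0)\}\subseteq\mathbb{Z}^2$. 4. $|A|=\frac12(n+2)$, and $A=T$ or $A=n-T$ or $A=S$ for some sets $T,S$ of the following forms: - $T=\{0,2,\ldots,2k\}\cup B\cup\{n\}$, where $k\in[0,\frac12 n-2]$ is an integer and $B$ is left dense, anti-symmetric and additively minimal in $[2k,n-1]$; - $S=\{0\}\cup C\cup D\cup\{n\}$,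 where $u\in[4,n-6]$ is an integer, $C$ is right dense, anti-symmetric and additively minimal in $[1,u]$, and $D$ is left dense, anti-symmetric and additively minimal in $[u+2,n-1]$. -/

import Mathlib

open scoped Pointwise

/-- The set `{(0,0),…,(0,n₀)} ∪ {(1,0),…,(1,n₁)}` in `ℤ × ℤ`. -/
def biAPModel (n₀ n₁ : ℕ) : Set (ℤ × ℤ) :=
  {p | (p.1 = 0 ∧ 0 ≤ p.2 ∧ p.2 ≤ (n₀ : ℤ)) ∨ (p.1 = 1 ∧ 0 ≤ p.2 ∧ p.2 ≤ (n₁ : ℤ))}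

/-- `A` is a bi-arithmetic progression: the image of some `biAPModel n₀ n₁` with
`n₀ + n₁ + 2 = |A|` under a Freiman isomorphism of order `2`. -/
def IsBiAP (A : Finset ℤ) : Prop :=
  ∃ n₀ n₁ : ℕ, n₀ + n₁ + 2 = A.card ∧
    ∃ φ : ℤ × ℤ → ℤ, IsAddFreimanIso 2 (biAPModel n₀ n₁) (A : Set ℤ) φ

/-- The six-point triangle in `ℤ × ℤ`. -/
def K6 : Set (ℤ × ℤ) := {(0, 0), (0, 1), (0, 2), (1, 0), (1, 1), (2, 0)}

/-- `B ⊆ [u, v]` has exactly `(v - u + 1) / 2` elements. -/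
def IsHalfDense (B : Finset ℤ) (u v : ℤ) : Prop :=
  B ⊆ Finset.Icc u v ∧ 2 * ((B ∩ Finset.Icc u v).card : ℤ) = v - u + 1

/-- `B` and its reflection `u + v - B` partition `[u, v]`. -/
def IsAntiSymmetric (B : Finset ℤ) (u v : ℤ) : Prop :=
  B ∩ B.image (fun b => u + v - b) = ∅ ∧ B ∪ B.image (fun b => u + v - b) = Finset.Icc u v

/-- `B` is half dense and `|B ∩ [u, x]| > (x - u + 1) / 2` for every `x ∈ [u, v - 1]`. -/
def IsLeftDense (B : Finset ℤ) (u v : ℤ) : Prop :=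
  IsHalfDense B u v ∧
    ∀ x ∈ Finset.Icc u (v - 1), x - u + 1 < 2 * ((B ∩ Finset.Icc u x).card : ℤ)

/-- `B` is half dense and `|B ∩ [x, v]| > (v - x + 1) / 2` for every `x ∈ [u + 1, v]`. -/
def IsRightDense (B : Finset ℤ) (u v : ℤ) : Prop :=
  IsHalfDense B u v ∧
    ∀ x ∈ Finset.Icc (u + 1) v, v - x + 1 < 2 * ((B ∩ Finset.Icc x v).card : ℤ)

/-- `B` is left dense, anti-symmetric and additively minimal in `[u, v]`; the last condition is
`2(B ∪ {v+1}) = [2u, u+v-1] ∪ ((v+1) + (B ∪ {v+1}))`. -/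
def IsLeftMinimal (B : Finset ℤ) (u v : ℤ) : Prop :=
  IsLeftDense B u v ∧ IsAntiSymmetric B u v ∧
    (B ∪ {v + 1}) + (B ∪ {v + 1}) =
      Finset.Icc (2 * u) (u + v - 1) ∪ (B ∪ {v + 1}).image (fun b => v + 1 + b)

/-- `B` is right dense, anti-symmetric and additively minimal in `[u, v]`; the last condition is
`2(B ∪ {u-1}) = [u+v+1, 2v] ∪ ((u-1) + (B ∪ {u-1}))`. -/
def IsRightMinimal (B : Finset ℤ) (u v : ℤ) : Prop :=
  IsRightDense B u v ∧ IsAntiSymmetric B u v ∧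
    (B ∪ {u - 1}) + (B ∪ {u - 1}) =
      Finset.Icc (u + v + 1) (2 * v) ∪ (B ∪ {u - 1}).image (fun b => u - 1 + b)

/-- `T = {0, 2, …, 2k} ∪ B ∪ {n}` with `0 ≤ k ≤ n / 2 - 2` and `B` left dense, anti-symmetric and
additively minimal in `[2k, n - 1]`. -/
def HasFormT (n : ℤ) (T : Finset ℤ) : Prop :=
  ∃ k : ℤ, 0 ≤ k ∧ 2 * k ≤ n - 4 ∧ ∃ B : Finset ℤ, IsLeftMinimal B (2 * k) (n - 1) ∧
    T = (Finset.Icc 0 k).image (fun i => 2 * i) ∪ B ∪ {n}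

/-- `S = {0} ∪ C ∪ D ∪ {n}` with `4 ≤ u ≤ n - 6`, `C` right dense, anti-symmetric and additively
minimal in `[1, u]`, and `D` left dense, anti-symmetric and additively minimal in
`[u + 2, n - 1]`. -/
def HasFormS (n : ℤ) (S : Finset ℤ) : Prop :=
  ∃ u : ℤ, 4 ≤ u ∧ u ≤ n - 6 ∧ ∃ C D : Finset ℤ,
    IsRightMinimal C 1 u ∧ IsLeftMinimal D (u + 2) (n - 1) ∧ S = {0} ∪ C ∪ D ∪ {n}

/-! Let A ⊆ [0, n] contain both end points, put 2|A| = n + 2 + e, and call the non-elements of A in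
(0, n) holes. Two counts drive the proof. If x ∉ 2A, then A and x - A are disjoint inside [0, x], so
the discrepancy 2|A ∩ [0, x]| - (x + 1) is at most 0, and if it is 0 then A is antisymmetric on [0,
x]. By reflection, x + n ∉ 2A forces discrepancy at least e + 1 at x - 1. Secondly, counting 2A by
residues modulo n (`IsNormal.card_add`) turns |2A| = 3|A| - 3 into |`bothSet`| - |`neitherSet`| = e
- 1.

Dense case e ≥ 1. `neitherSet` is empty. If every x ∉ 2A lies to the left of every z with z + n ∉
2A, the stretch between the last x and the first z + n lies in 2A, and it is long because the
discrepancy must rise by e + 1 between x and z - 1. Otherwise the discrepancy descends from e + 1 to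
0, and each level 1, ..., e - 1 on the way costs one point of `bothSet`. There are exactly e - 1
such points, so the descent is rigid: A is a union of two intervals or, possibly when e = 1, of the
classes 0 and 1 modulo 4.

Critical case e = 0. If `neitherSet` has a single element r, then `bothSet` is empty, A is
antisymmetric on [0, r] and on [r, n], and every other hole y has exactly one of y, y + n in 2A.
Unless A is two intervals, these rules make each side of r either a progression of difference 2 or
an additively minimal set (`IsCritical.classification`), which are the forms T, n - T and S. If
`neitherSet` has two elements, the reduction B of A modulo n is antisymmetric about two centres,
hence periodic.

Sparse case e < 0. Now |B + B| ≤ 2|B| - 1 and B + B misses at least two residues. The isoperimetric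
method (`exists_translation_or_subgroup`) shows that B gains at most one element under some
translation q, or is nearly a union of cosets. If q generates, B is a progression, and the emptiness
of `bothSet` lifts this to a bi-arithmetic progression A. In all other cases A is nearly full in
classes modulo a proper divisor d of n.

For the least such d, the sizes of the classes of A and of 2A are compared (`IsClassSizes`). The
hypothesis on |2A| turns every inequality used into an equality, leaving two classes (a
bi-arithmetic progression) or three classes of sizes 3, 2, 1 (the triangle K6). -/

/-! ### Freiman isomorphisms given by affine maps -/

theorem affine_isAddFreimanIso (M : Finset (ℤ × ℤ)) (A : Finset ℤ) (a s d : ℤ)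
    (hM : M.image (fun p : ℤ × ℤ => a + s * p.1 + d * p.2) = A) (hc : M.card ≤ A.card)
    (hs : (M + M).card ≤ (A + A).card) :
    IsAddFreimanIso 2 (M : Set (ℤ × ℤ)) (A : Set ℤ) (fun p => a + s * p.1 + d * p.2) := by
  set φ : ℤ × ℤ → ℤ := fun p => a + s * p.1 + d * p.2 with hφ
  set ψ : ℤ × ℤ → ℤ := fun p => 2 * a + s * p.1 + d * p.2 with hψ
  have hinj : Set.InjOn φ M := by
    apply Finset.card_image_iff.1
    rw [hM]
    exact le_antisymm (by rw [← hM]; exact Finset.card_image_le) hc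
  have hadd : ∀ p q, φ p + φ q = ψ (p + q) := by
    intro p q
    simp only [hφ, hψ, Prod.fst_add, Prod.snd_add]
    ring
  have himg : (M + M).image ψ = A + A := by
    ext x
    simp only [Finset.mem_image, Finset.mem_add, ← hM]
    constructor
    · rintro ⟨_, ⟨p, hp, q, hq, rfl⟩, rfl⟩
      exact ⟨φ p, ⟨p, hp, rfl⟩, φ q, ⟨q, hq, rfl⟩, hadd p q⟩
    · rintro ⟨_, ⟨p, hp, rfl⟩, _, ⟨q, hq, rfl⟩, rfl⟩
      exact ⟨p + q, ⟨p, hp, q, hq, rfl⟩, (hadd p q).symm⟩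
  -- `ψ` maps M + M onto A + A, which is at least as large, so it is injective there. This
  -- injectivity is the Freiman condition.
  have hinj2 : Set.InjOn ψ (M + M : Finset (ℤ × ℤ)) := by
    apply Finset.card_image_iff.1
    rw [himg]
    exact le_antisymm (by rw [← himg]; exact Finset.card_image_le) hs
  refine ⟨⟨?_, hinj, ?_⟩, ?_⟩
  · intro p hp
    rw [← hM]
    exact Finset.mem_coe.2 (Finset.mem_image_of_mem φ hp)
  · intro x hx
    rw [← hM] at hx
    obtain ⟨p, hp, rfl⟩ := Finset.mem_image.1 (Finset.mem_coe.1 hx)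
    exact ⟨p, hp, rfl⟩
  · intro S T hS hT hS2 hT2
    obtain ⟨p, q, rfl⟩ := Multiset.card_eq_two.1 hS2
    obtain ⟨p', q', rfl⟩ := Multiset.card_eq_two.1 hT2
    simp only [Multiset.insert_eq_cons, Multiset.map_cons, Multiset.map_singleton,
      Multiset.sum_cons, Multiset.sum_singleton]
    rw [hadd, hadd]
    have h1 : p ∈ M := hS (by simp)
    have h2 : q ∈ M := hS (by simp)
    have h3 : p' ∈ M := hT (by simp)
    have h4 : q' ∈ M := hT (by simp)
    exact ⟨fun h => hinj2 (Finset.add_mem_add h1 h2) (Finset.add_mem_add h3 h4) h,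
      fun h => by rw [h]⟩

/-- A set of integers that is covered by two progressions with a common difference and has the
doubling `3|A| - 3` is a bi-arithmetic progression. -/
theorem isBiAP_of_two_progressions (A : Finset ℤ) (a b d : ℤ) (n₀ n₁ : ℕ)
    (hA : ∀ x, x ∈ A ↔ (∃ i : ℤ, 0 ≤ i ∧ i ≤ n₀ ∧ x = a + d * i) ∨
      (∃ i : ℤ, 0 ≤ i ∧ i ≤ n₁ ∧ x = b + d * i))
    (hc : n₀ + n₁ + 2 = A.card) (hs : (A + A).card = 3 * A.card - 3) : IsBiAP A := by
  refine ⟨n₀, n₁, hc, fun p => a + (b - a) * p.1 + d * p.2, ?_⟩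
  set M : Finset (ℤ × ℤ) := ({0} : Finset ℤ) ×ˢ Finset.Icc (0 : ℤ) n₀ ∪
    ({1} : Finset ℤ) ×ˢ Finset.Icc (0 : ℤ) n₁ with hMdef
  have hMset : biAPModel n₀ n₁ = (M : Set (ℤ × ℤ)) := by
    ext ⟨p, q⟩
    simp only [biAPModel, Set.mem_ofPred_eq, hMdef, Finset.mem_coe, Finset.mem_union,
      Finset.mem_product, Finset.mem_singleton, Finset.mem_Icc]
  rw [hMset]
  apply affine_isAddFreimanIso
  · ext x
    rw [hA]
    simp only [hMdef, Finset.mem_image, Finset.mem_union, Finset.mem_product,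
      Finset.mem_singleton, Finset.mem_Icc, Prod.exists]
    constructor
    · rintro ⟨s, i, ⟨rfl, h1, h2⟩ | ⟨rfl, h1, h2⟩, rfl⟩
      · exact Or.inl ⟨i, h1, h2, by ring⟩
      · exact Or.inr ⟨i, h1, h2, by ring⟩
    · rintro (⟨i, h1, h2, rfl⟩ | ⟨i, h1, h2, rfl⟩)
      · exact ⟨0, i, Or.inl ⟨rfl, h1, h2⟩, by ring⟩
      · exact ⟨1, i, Or.inr ⟨rfl, h1, h2⟩, by ring⟩
  · calc M.card ≤ (({0} : Finset ℤ) ×ˢ Finset.Icc (0 : ℤ) n₀).card +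
        (({1} : Finset ℤ) ×ˢ Finset.Icc (0 : ℤ) n₁).card := Finset.card_union_le _ _
      _ ≤ A.card := by
        simp only [Finset.card_product, Finset.card_singleton, Int.card_Icc]
        omega
  -- Three rows with 2n₀ + 1, n₀ + n₁ + 1 and 2n₁ + 1 points: altogether 3|A| - 3, so the doubling
  -- of A is the largest possible.
  · have hsub : M + M ⊆ ({0} : Finset ℤ) ×ˢ Finset.Icc (0 : ℤ) (2 * n₀) ∪
        (({1} : Finset ℤ) ×ˢ Finset.Icc (0 : ℤ) (n₀ + n₁) ∪
        ({2} : Finset ℤ) ×ˢ Finset.Icc (0 : ℤ) (2 * n₁)) := by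
      intro x hx
      obtain ⟨p, hp, q, hq, rfl⟩ := Finset.mem_add.1 hx
      simp only [hMdef, Finset.mem_union, Finset.mem_product, Finset.mem_singleton,
        Finset.mem_Icc, Prod.fst_add, Prod.snd_add] at hp hq ⊢
      omega
    calc (M + M).card ≤ _ := Finset.card_le_card hsub
      _ ≤ _ := Finset.card_union_le _ _
      _ ≤ _ := Nat.add_le_add_left (Finset.card_union_le _ _) _
      _ ≤ (A + A).card := by
        simp only [Finset.card_product, Finset.card_singleton, Int.card_Icc]
        omega

/-- Two intervals. -/
theorem isBiAP_of_two_intervals (A : Finset ℤ) (l p n : ℤ) (hl : 0 ≤ l) (hlp : l < p)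
    (hp : p ≤ n) (hA : ∀ x, x ∈ A ↔ (0 ≤ x ∧ x ≤ l) ∨ (p ≤ x ∧ x ≤ n))
    (hs : (A + A).card = 3 * A.card - 3) : IsBiAP A := by
  apply isBiAP_of_two_progressions A 0 p 1 l.toNat (n - p).toNat _ _ hs
  · intro x
    rw [hA]
    constructor
    · rintro (h | h)
      · exact Or.inl ⟨x, by omega, by omega, by omega⟩
      · exact Or.inr ⟨x - p, by omega, by omega, by omega⟩
    · rintro (⟨i, h1, h2, rfl⟩ | ⟨i, h1, h2, rfl⟩)
      · left; omega
      · right; omega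
  · have : A = Finset.Icc 0 l ∪ Finset.Icc p n := by
      ext x
      simp [hA]
    rw [this, Finset.card_union_of_disjoint]
    · simp only [Int.card_Icc]
      omega
    · rw [Finset.disjoint_left]
      intro x hx hx'
      simp only [Finset.mem_Icc] at hx hx'
      omega

/-- The doubling of the triangle is a triangle of 15 = 3 · 6 - 3 points, so |2A| admits no
coincidences beyond those of K6. -/
theorem isAddFreimanIso_K6_of_eq (A : Finset ℤ) (x d : ℤ)
    (hA : A = {0, d, 2 * d, x, x + d, 2 * x}) (hc : A.card = 6)
    (hs : (A + A).card = 3 * A.card - 3) :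
    ∃ φ : ℤ × ℤ → ℤ, IsAddFreimanIso 2 K6 (A : Set ℤ) φ := by
  refine ⟨fun p => 0 + x * p.1 + d * p.2, ?_⟩
  set M : Finset (ℤ × ℤ) := {(0, 0), (0, 1), (0, 2), (1, 0), (1, 1), (2, 0)} with hM
  have hK : K6 = (M : Set (ℤ × ℤ)) := by
    ext p
    simp [K6, hM]
  rw [hK]
  apply affine_isAddFreimanIso
  · rw [hA, hM]
    simp only [Finset.image_insert, Finset.image_singleton]
    congr! 1 <;> [ring; skip]
    congr! 1 <;> [ring; skip]
    congr! 1 <;> [ring; skip]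
    congr! 1 <;> [ring; skip]
    congr! 1 <;> [ring; skip]
    congr! 1
    ring
  · rw [hc]
    decide
  · rw [hs, hc]
    decide

/-! ### Discrepancy and reflection -/

/-- `A ⊆ [0, n]` contains both end points `0 < n`. -/
structure IsNormal (A : Finset ℤ) (n : ℤ) : Prop where
  pos : 0 < n
  zero_mem : 0 ∈ A
  top_mem : n ∈ A
  nonneg : ∀ x ∈ A, 0 ≤ x
  le_top : ∀ x ∈ A, x ≤ n

/-- The discrepancy `2|A ∩ (-∞, x]| - (x + 1)`. -/
def disc (A : Finset ℤ) (x : ℤ) : ℤ := 2 * ((A.filter (· ≤ x)).card : ℤ) - (x + 1)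

/-- The reflection `n - A`. -/
def reflect (A : Finset ℤ) (n : ℤ) : Finset ℤ := A.image (fun a => n - a)

theorem mem_reflect {A : Finset ℤ} {n x : ℤ} : x ∈ reflect A n ↔ n - x ∈ A := by
  simp only [reflect, Finset.mem_image]
  constructor
  · rintro ⟨a, ha, rfl⟩
    simpa using ha
  · intro h
    exact ⟨n - x, h, by ring⟩

theorem reflect_reflect (A : Finset ℤ) (n : ℤ) : reflect (reflect A n) n = A := by
  ext x
  simp [mem_reflect]

theorem card_reflect (A : Finset ℤ) (n : ℤ) : (reflect A n).card = A.card :=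
  Finset.card_image_of_injective _ fun a b h => by simpa using h

theorem reflect_add_reflect (A : Finset ℤ) (n : ℤ) :
    reflect A n + reflect A n = reflect (A + A) (2 * n) := by
  ext x
  simp only [mem_reflect, Finset.mem_add]
  constructor
  · rintro ⟨a, ha, b, hb, rfl⟩
    exact ⟨_, ha, _, hb, by ring⟩
  · rintro ⟨a, ha, b, hb, h⟩
    exact ⟨n - a, by simpa using ha, n - b, by simpa using hb, by linarith⟩

theorem mem_reflect_add {A : Finset ℤ} {n x : ℤ} :
    x ∈ reflect A n + reflect A n ↔ 2 * n - x ∈ A + A := by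
  rw [reflect_add_reflect, mem_reflect]

theorem card_reflect_add (A : Finset ℤ) (n : ℤ) :
    (reflect A n + reflect A n).card = (A + A).card := by
  rw [reflect_add_reflect, card_reflect]

theorem IsNormal.reflect {A : Finset ℤ} {n : ℤ} (h : IsNormal A n) : IsNormal (reflect A n) n where
  pos := h.pos
  zero_mem := mem_reflect.2 (by simpa using h.top_mem)
  top_mem := mem_reflect.2 (by simpa using h.zero_mem)
  nonneg x hx := by linarith [h.le_top _ (mem_reflect.1 hx)]
  le_top x hx := by linarith [h.nonneg _ (mem_reflect.1 hx)]

theorem disc_of_mem {A : Finset ℤ} {x : ℤ} (h : x ∈ A) : disc A x = disc A (x - 1) + 1 := by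
  have : A.filter (· ≤ x) = insert x (A.filter (· ≤ x - 1)) := by
    ext y
    simp only [Finset.mem_filter, Finset.mem_insert]
    constructor
    · rintro ⟨h1, h2⟩
      rcases h2.lt_or_eq with h3 | h3
      · exact Or.inr ⟨h1, by omega⟩
      · exact Or.inl h3
    · rintro (rfl | ⟨h1, h2⟩)
      · exact ⟨h, le_refl _⟩
      · exact ⟨h1, by omega⟩
  rw [disc, disc, this, Finset.card_insert_of_notMem (by simp)]
  push_cast
  ring

theorem disc_of_notMem {A : Finset ℤ} {x : ℤ} (h : x ∉ A) : disc A x = disc A (x - 1) - 1 := by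
  have : A.filter (· ≤ x) = A.filter (· ≤ x - 1) := by
    ext y
    simp only [Finset.mem_filter]
    refine and_congr_right fun hy => ⟨fun h2 => ?_, fun h2 => by omega⟩
    have : y ≠ x := fun h3 => h (h3 ▸ hy)
    omega
  rw [disc, disc, this]
  ring

theorem IsNormal.disc_neg {A : Finset ℤ} {n : ℤ} (h : IsNormal A n) {x : ℤ} (hx : x < 0) :
    disc A x = -(x + 1) := by
  have : A.filter (· ≤ x) = ∅ := by
    ext y
    simp only [Finset.mem_filter, Finset.notMem_empty, iff_false, not_and, not_le]
    intro hy
    linarith [h.nonneg y hy]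
  simp [disc, this]

theorem IsNormal.disc_top {A : Finset ℤ} {n : ℤ} (h : IsNormal A n) :
    disc A n = 2 * A.card - (n + 1) := by
  rw [disc, Finset.filter_true_of_mem h.le_top]

theorem IsNormal.disc_zero {A : Finset ℤ} {n : ℤ} (h : IsNormal A n) : disc A 0 = 1 := by
  rw [disc_of_mem h.zero_mem, h.disc_neg (by norm_num)]
  norm_num

theorem IsNormal.disc_pred_top {A : Finset ℤ} {n : ℤ} (h : IsNormal A n) :
    disc A (n - 1) = 2 * A.card - n - 2 := by
  have := disc_of_mem h.top_mem
  rw [h.disc_top] at this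
  linarith

/-- The elements of n - A up to x correspond to the elements of A beyond n - x - 1. This transfers
each statement about sums near 0 to sums near 2n. -/
theorem disc_reflect {A : Finset ℤ} {n : ℤ} (x : ℤ) :
    disc (_root_.reflect A n) x = (2 * A.card - (n + 1)) - disc A (n - x - 1) := by
  have h1 : ((_root_.reflect A n).filter (· ≤ x)).card = (A.filter (fun a => ¬ a ≤ n - x - 1)).card := by
    apply Finset.card_bij (fun a _ => n - a)
    · intro a ha
      simp only [Finset.mem_filter, mem_reflect] at ha ⊢
      exact ⟨ha.1, by omega⟩
    · intro a _ b _ hab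
      linarith
    · intro b hb
      simp only [Finset.mem_filter] at hb
      exact ⟨n - b, by simp only [Finset.mem_filter, mem_reflect]; exact ⟨by simpa using hb.1, by omega⟩, by ring⟩
  have h2 := Finset.card_filter_add_card_filter_not (s := A) (fun a => a ≤ n - x - 1)
  rw [disc, disc, h1]
  have : (A.card : ℤ) = (A.filter (fun a => a ≤ n - x - 1)).card +
    (A.filter (fun a => ¬ a ≤ n - x - 1)).card := by exact_mod_cast h2.symm
  rw [this]
  ring

theorem disjoint_image_sub_of_notMem_add {A : Finset ℤ} {x : ℤ} (hx : x ∉ A + A) :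
    Disjoint (A.filter (· ≤ x)) ((A.filter (· ≤ x)).image (fun a => x - a)) := by
  rw [Finset.disjoint_left]
  intro a ha hb
  obtain ⟨b, hb', rfl⟩ := Finset.mem_image.1 hb
  apply hx
  simp only [Finset.mem_filter] at ha hb'
  exact Finset.mem_add.2 ⟨_, ha.1, _, hb'.1, by ring⟩

theorem IsNormal.union_subset_Icc {A : Finset ℤ} {n : ℤ} (h : IsNormal A n) (x : ℤ) :
    A.filter (· ≤ x) ∪ (A.filter (· ≤ x)).image (fun a => x - a) ⊆ Finset.Icc 0 x := by
  intro y hy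
  simp only [Finset.mem_union, Finset.mem_filter, Finset.mem_image, Finset.mem_Icc] at hy ⊢
  rcases hy with hy | ⟨b, ⟨hb, hb'⟩, rfl⟩
  · exact ⟨h.nonneg y hy.1, hy.2⟩
  · have := h.nonneg b hb
    omega

theorem card_union_image_sub {A : Finset ℤ} {x : ℤ} (hx : x ∉ A + A) :
    (A.filter (· ≤ x) ∪ (A.filter (· ≤ x)).image (fun a => x - a)).card =
      2 * (A.filter (· ≤ x)).card := by
  rw [Finset.card_union_of_disjoint (disjoint_image_sub_of_notMem_add hx),
    Finset.card_image_of_injective _ fun a b hab => by simpa using hab]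
  ring

/-- A ∩ [0, x] and its image under t ↦ x - t are disjoint subsets of [0, x] of equal size, so
together they have at most x + 1 elements. -/
theorem IsNormal.disc_nonpos {A : Finset ℤ} {n : ℤ} (h : IsNormal A n) {x : ℤ} (h0 : 0 ≤ x) (hx : x ∉ A + A) : disc A x ≤ 0 := by
  have h1 := Finset.card_le_card (h.union_subset_Icc x)
  rw [card_union_image_sub hx, Int.card_Icc] at h1
  rw [disc]
  omega

theorem IsNormal.mem_add_of_disc_pos {A : Finset ℤ} {n : ℤ} (h : IsNormal A n) {x : ℤ} (h0 : 0 ≤ x) (hx : 0 < disc A x) : x ∈ A + A := by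
  by_contra hc
  linarith [h.disc_nonpos h0 hc]

/-- The equality case of `disc_nonpos`: the two disjoint copies fill [0, x]. -/
theorem IsNormal.mem_iff_of_notMem_add {A : Finset ℤ} {n : ℤ} (h : IsNormal A n) {x : ℤ} (hx : x ∉ A + A) (hd : disc A x = 0) {t : ℤ}
    (ht : 0 ≤ t) (htx : t ≤ x) : t ∈ A ↔ x - t ∉ A := by
  have h1 : A.filter (· ≤ x) ∪ (A.filter (· ≤ x)).image (fun a => x - a) = Finset.Icc 0 x := by
    apply Finset.eq_of_subset_of_card_le (h.union_subset_Icc x)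
    rw [card_union_image_sub hx, Int.card_Icc]
    rw [disc] at hd
    omega
  constructor
  · intro h2 h3
    exact hx (Finset.mem_add.2 ⟨_, h2, _, h3, by ring⟩)
  · intro h2
    have : t ∈ Finset.Icc 0 x := Finset.mem_Icc.2 ⟨ht, htx⟩
    rw [← h1, Finset.mem_union, Finset.mem_image] at this
    rcases this with h3 | ⟨b, h3, rfl⟩
    · exact (Finset.mem_filter.1 h3).1
    · exact absurd (by simpa using (Finset.mem_filter.1 h3).1) h2

theorem IsNormal.add_top_mem {A : Finset ℤ} {n : ℤ} (h : IsNormal A n) {x : ℤ} (hx : x ≤ n) (hd : disc A (x - 1) ≤ 2 * A.card - 2 - n) :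
    x + n ∈ A + A := by
  have h1 : n - x ∈ _root_.reflect A n + _root_.reflect A n := by
    apply h.reflect.mem_add_of_disc_pos (by omega)
    rw [disc_reflect]
    have : n - (n - x) - 1 = x - 1 := by ring
    rw [this]
    linarith
  rw [mem_reflect_add] at h1
  convert h1 using 1
  ring

/-- The mirror image of `disc_nonpos`. When 2|A| = n + 2 + e, the bound is e + 1. -/
theorem IsNormal.lt_disc_of_add_top_notMem {A : Finset ℤ} {n : ℤ} (h : IsNormal A n) {x : ℤ} (hx : x ≤ n) (hc : x + n ∉ A + A) :
    2 * A.card - 1 - n ≤ disc A (x - 1) := by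
  by_contra hd
  exact hc (h.add_top_mem hx (by omega))

theorem IsNormal.mem_iff_of_add_top_notMem {A : Finset ℤ} {n : ℤ} (h : IsNormal A n) {x : ℤ} (hc : x + n ∉ A + A)
    (hd : disc A (x - 1) = 2 * A.card - 1 - n) {t : ℤ} (ht : x ≤ t) (htx : t ≤ n) :
    t ∈ A ↔ x + n - t ∉ A := by
  have h1 : n - x ∉ _root_.reflect A n + _root_.reflect A n := by
    rw [mem_reflect_add]
    convert hc using 2
    ring
  have h2 := h.reflect.mem_iff_of_notMem_add h1 (by
    rw [disc_reflect]
    have : n - (n - x) - 1 = x - 1 := by ring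
    rw [this]
    linarith) (t := n - t) (by omega) (by omega)
  rw [mem_reflect, mem_reflect] at h2
  have e1 : n - (n - t) = t := by ring
  have e2 : n - (n - x - (n - t)) = x + n - t := by ring
  rwa [e1, e2] at h2

theorem IsNormal.add_mem_bounds {A : Finset ℤ} {n : ℤ} (h : IsNormal A n) {x : ℤ} (hx : x ∈ A + A) : 0 ≤ x ∧ x ≤ 2 * n := by
  obtain ⟨a, ha, b, hb, rfl⟩ := Finset.mem_add.1 hx
  have := h.nonneg a ha
  have := h.nonneg b hb
  have := h.le_top a ha
  have := h.le_top b hb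
  omega

theorem IsNormal.mem_add_of_mem {A : Finset ℤ} {n : ℤ} (h : IsNormal A n) {x : ℤ} (hx : x ∈ A) : x ∈ A + A :=
  Finset.mem_add.2 ⟨0, h.zero_mem, x, hx, by ring⟩

theorem IsNormal.mem_add_top_of_mem {A : Finset ℤ} {n : ℤ} (h : IsNormal A n) {x : ℤ} (hx : x ∈ A) : x + n ∈ A + A :=
  Finset.add_mem_add hx h.top_mem

/-- Between a point of discrepancy above `j` and a later point of discrepancy at most `j` there is
a non-element of discrepancy exactly `j`. -/
theorem exists_disc_eq {A : Finset ℤ} {p q j : ℤ} (hpq : p ≤ q) (hp : j < disc A p)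
    (hq : disc A q ≤ j) : ∃ y, p < y ∧ y ≤ q ∧ y ∉ A ∧ disc A y = j := by
  induction q, hpq using Int.leInduction with
  | base => omega
  | succ m hm ih =>
    by_cases h1 : disc A m ≤ j
    · obtain ⟨y, h2, h3, h4⟩ := ih h1
      exact ⟨y, h2, by omega, h4⟩
    · have h3 : m + 1 ∉ A := by
        intro h3
        have := disc_of_mem h3
        rw [add_sub_cancel_right] at this
        omega
      have := disc_of_notMem h3
      rw [add_sub_cancel_right] at this
      exact ⟨m + 1, by omega, le_refl _, h3, by omega⟩

/-! ### Counting the sumset by residues modulo n -/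

/-- The non-elements `x` of `A` in `(0, n)` for which neither `x` nor `x + n` is in `2A`. -/
noncomputable def neitherSet (A : Finset ℤ) (n : ℤ) : Finset ℤ :=
  (Finset.Ioo 0 n).filter fun x => x ∉ A + A ∧ x + n ∉ A + A

/-- The non-elements `x` of `A` in `(0, n)` for which both `x` and `x + n` are in `2A`. -/
noncomputable def bothSet (A : Finset ℤ) (n : ℤ) : Finset ℤ :=
  (Finset.Ioo 0 n).filter fun x => x ∉ A ∧ x ∈ A + A ∧ x + n ∈ A + A

/-- Apart from the point 2n, the sumset is a part `S` in [0, n) and a translate by n of such a part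
`T`. The union of `S` and `T` misses exactly `neitherSet`, while their intersection is A without n
together with `bothSet`. -/
theorem IsNormal.card_add {A : Finset ℤ} {n : ℤ} (h : IsNormal A n) :
    ((A + A).card : ℤ) + (neitherSet A n).card = n + A.card + (bothSet A n).card := by
  set S := (Finset.Ico 0 n).filter fun x => x ∈ A + A with hS
  set T := (Finset.Ico 0 n).filter fun x => x + n ∈ A + A with hT
  have hpos := h.pos
  have h1 : A + A = (S ∪ T.image (· + n)) ∪ {2 * n} := by
    ext x
    simp only [Finset.mem_union, hS, hT, Finset.mem_filter, Finset.mem_Ico, Finset.mem_image,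
      Finset.mem_singleton]
    constructor
    · intro hx
      have hb := h.add_mem_bounds hx
      by_cases hxn : x < n
      · exact Or.inl (Or.inl ⟨⟨hb.1, hxn⟩, hx⟩)
      · by_cases hx2 : x = 2 * n
        · exact Or.inr hx2
        · exact Or.inl (Or.inr ⟨x - n, ⟨⟨by omega, by omega⟩, by simpa using hx⟩, by ring⟩)
    · rintro ((hx | ⟨y, hy, rfl⟩) | rfl)
      · exact hx.2
      · exact hy.2
      · rw [two_mul]
        exact Finset.add_mem_add h.top_mem h.top_mem
  have h2 : (A + A).card = S.card + T.card + 1 := by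
    rw [h1, Finset.card_union_of_disjoint, Finset.card_union_of_disjoint, Finset.card_singleton,
      Finset.card_image_of_injective _ (add_left_injective n)]
    · rw [Finset.disjoint_left]
      intro x hx hx'
      simp only [hS, hT, Finset.mem_filter, Finset.mem_Ico, Finset.mem_image] at hx hx'
      obtain ⟨y, hy, rfl⟩ := hx'
      omega
    · rw [Finset.disjoint_singleton_right]
      simp only [hS, hT, Finset.mem_union, Finset.mem_filter, Finset.mem_Ico, Finset.mem_image]
      rintro (hx | ⟨y, hy, hy'⟩)
      · omega
      · omega
  have h3 := Finset.card_union_add_card_inter S T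
  have h4 : (S ∪ T).card + (neitherSet A n).card = n.toNat := by
    rw [← Finset.card_union_of_disjoint]
    · have : S ∪ T ∪ neitherSet A n = Finset.Ico 0 n := by
        ext x
        simp only [hS, hT, neitherSet, Finset.mem_union, Finset.mem_filter, Finset.mem_Ico,
          Finset.mem_Ioo]
        constructor
        · rintro ((hx | hx) | hx)
          · exact hx.1
          · exact hx.1
          · exact ⟨hx.1.1.le, hx.1.2⟩
        · intro hx
          by_cases hx1 : x ∈ A + A
          · exact Or.inl (Or.inl ⟨hx, hx1⟩)
          by_cases hx2 : x + n ∈ A + A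
          · exact Or.inl (Or.inr ⟨hx, hx2⟩)
          · refine Or.inr ⟨⟨?_, hx.2⟩, hx1, hx2⟩
            rcases hx.1.lt_or_eq with h5 | h5
            · exact h5
            · exact absurd (h.mem_add_of_mem (h5 ▸ h.zero_mem)) hx1
      rw [this, Int.card_Ico, sub_zero]
    · rw [Finset.disjoint_left]
      intro x hx hx'
      simp only [hS, hT, neitherSet, Finset.mem_union, Finset.mem_filter] at hx hx'
      tauto
  have h5 : S ∩ T = A.erase n ∪ bothSet A n := by
    ext x
    simp only [hS, hT, bothSet, Finset.mem_union, Finset.mem_filter, Finset.mem_inter,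
      Finset.mem_erase, Finset.mem_Ico, Finset.mem_Ioo]
    constructor
    · rintro ⟨⟨hx, hx1⟩, -, hx2⟩
      by_cases hxA : x ∈ A
      · exact Or.inl ⟨by omega, hxA⟩
      · refine Or.inr ⟨⟨?_, hx.2⟩, hxA, hx1, hx2⟩
        rcases hx.1.lt_or_eq with h5 | h5
        · exact h5
        · exact absurd (h5 ▸ h.zero_mem) hxA
    · rintro (⟨hx, hxA⟩ | ⟨hx, -, hx1, hx2⟩)
      · have h6 := h.nonneg x hxA
        have h7 := h.le_top x hxA
        exact ⟨⟨⟨h6, by omega⟩, h.mem_add_of_mem hxA⟩, ⟨h6, by omega⟩, h.mem_add_top_of_mem hxA⟩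
      · exact ⟨⟨⟨hx.1.le, hx.2⟩, hx1⟩, ⟨hx.1.le, hx.2⟩, hx2⟩
  have h6 : (S ∩ T).card + 1 = A.card + (bothSet A n).card := by
    rw [h5, Finset.card_union_of_disjoint, ← Finset.card_erase_add_one h.top_mem]
    · ring
    · rw [Finset.disjoint_left]
      intro x hx hx'
      simp only [bothSet, Finset.mem_filter, Finset.mem_erase] at hx hx'
      exact hx'.2.1 hx.2
  omega

theorem disc_le_pred_add_one (A : Finset ℤ) (x : ℤ) : disc A x ≤ disc A (x - 1) + 1 := by
  by_cases hx : x ∈ A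
  · exact (disc_of_mem hx).le
  · linarith [disc_of_notMem hx]

theorem pred_sub_one_le_disc (A : Finset ℤ) (x : ℤ) : disc A (x - 1) - 1 ≤ disc A x := by
  by_cases hx : x ∈ A
  · linarith [disc_of_mem hx]
  · exact (disc_of_notMem hx).ge

theorem disc_sub_le (A : Finset ℤ) {p q : ℤ} (h : p ≤ q) : disc A q - disc A p ≤ q - p := by
  induction q, h using Int.leInduction with
  | base => simp
  | succ m hm ih =>
    have := disc_le_pred_add_one A (m + 1)
    rw [add_sub_cancel_right] at this
    linarith

theorem disc_gap {A : Finset ℤ} {p q : ℤ} (h : p ≤ q) (hg : ∀ y, p < y → y ≤ q → y ∉ A) :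
    disc A q = disc A p - (q - p) := by
  induction q, h using Int.leInduction with
  | base => simp
  | succ m hm ih =>
    have h1 := disc_of_notMem (hg (m + 1) (by omega) le_rfl)
    rw [add_sub_cancel_right, ih fun y h2 h3 => hg y h2 (by omega)] at h1
    linarith

theorem disc_run {A : Finset ℤ} {p q : ℤ} (h : p ≤ q) (hg : ∀ y, p < y → y ≤ q → y ∈ A) :
    disc A q = disc A p + (q - p) := by
  induction q, h using Int.leInduction with
  | base => simp
  | succ m hm ih =>
    have h1 := disc_of_mem (hg (m + 1) (by omega) le_rfl)
    rw [add_sub_cancel_right, ih fun y h2 h3 => hg y h2 (by omega)] at h1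
    linarith

theorem exists_prev_mem {A : Finset ℤ} {x a : ℤ} (ha : a ∈ A) (hax : a < x) :
    ∃ p ∈ A, a ≤ p ∧ p < x ∧ ∀ y, p < y → y < x → y ∉ A := by
  have hne : (A.filter (· < x)).Nonempty := ⟨a, Finset.mem_filter.2 ⟨ha, hax⟩⟩
  have hm := Finset.mem_filter.1 (Finset.max'_mem _ hne)
  refine ⟨_, hm.1, Finset.le_max' _ _ (Finset.mem_filter.2 ⟨ha, hax⟩), hm.2, ?_⟩
  intro y hy hyx hyA
  have := Finset.le_max' (A.filter (· < x)) y (Finset.mem_filter.2 ⟨hyA, hyx⟩)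
  omega

theorem exists_next_mem {A : Finset ℤ} {x a : ℤ} (ha : a ∈ A) (hax : x < a) :
    ∃ p ∈ A, p ≤ a ∧ x < p ∧ ∀ y, x < y → y < p → y ∉ A := by
  have hne : (A.filter (x < ·)).Nonempty := ⟨a, Finset.mem_filter.2 ⟨ha, hax⟩⟩
  have hm := Finset.mem_filter.1 (Finset.min'_mem _ hne)
  refine ⟨_, hm.1, Finset.min'_le _ _ (Finset.mem_filter.2 ⟨ha, hax⟩), hm.2, ?_⟩
  intro y hy hyx hyA
  have := Finset.min'_le (A.filter (x < ·)) y (Finset.mem_filter.2 ⟨hyA, hy⟩)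
  omega

/-! ### The dense case: long interval or descent of the discrepancy -/

section Dense

variable {A : Finset ℤ} {n e : ℤ}

/-- A point of `neitherSet` would need discrepancy at least e + 1 ≥ 2 just before it and at most 0
at it, but the discrepancy changes by one per step. -/
theorem IsNormal.card_bothSet_of_dense (h : IsNormal A n) (he : 2 * (A.card : ℤ) = n + 2 + e)
    (h1 : 1 ≤ e) (hs : ((A + A).card : ℤ) = 3 * A.card - 3) :
    ((bothSet A n).card : ℤ) = e - 1 := by
  have h2 : neitherSet A n = ∅ := by
    rw [neitherSet, Finset.filter_eq_empty_iff]
    rintro x hx ⟨h3, h4⟩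
    rw [Finset.mem_Ioo] at hx
    have h5 := h.disc_nonpos hx.1.le h3
    have h6 := h.lt_disc_of_add_top_notMem hx.2.le h4
    have h7 := pred_sub_one_le_disc A x
    omega
  have h3 := h.card_add
  rw [h2, Finset.card_empty] at h3
  push_cast at h3
  linarith

/-- Between the last x ∉ 2A and the first z + n ∉ 2A nothing is missing, and the discrepancy has to
rise by e + 1 between x and z - 1 at speed at most one. -/
theorem IsNormal.exists_Icc_subset (h : IsNormal A n) (he : 2 * (A.card : ℤ) = n + 2 + e)
    (hsep : ∀ x z, 0 ≤ x → x ≤ n → x ∉ A + A → 0 ≤ z → z ≤ n → z + n ∉ A + A → x < z) :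
    ∃ x : ℤ, Finset.Icc x (x + (2 * (A.card : ℤ) - 1) - 1) ⊆ A + A := by
  have hn := h.pos
  -- The sentinels -1 and n + 1 make the extrema exist. They obey the same bounds as genuine gaps of
  -- 2A: the discrepancy is 0 at -1 and e + 1 at n.
  set U := insert (-1) ((Finset.Icc 0 n).filter fun x => x ∉ A + A) with hU
  set V := insert (n + 1) ((Finset.Icc 0 n).filter fun x => x + n ∉ A + A) with hV
  have hUn : U.Nonempty := ⟨-1, Finset.mem_insert_self _ _⟩
  have hVn : V.Nonempty := ⟨n + 1, Finset.mem_insert_self _ _⟩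
  obtain ⟨X, hX, hXmax⟩ := U.exists_max_image id hUn
  obtain ⟨Z, hZ, hZmin⟩ := V.exists_min_image id hVn
  simp only [id] at hXmax hZmin
  have hX1 := hXmax (-1) (Finset.mem_insert_self _ _)
  have hZ1 := hZmin (n + 1) (Finset.mem_insert_self _ _)
  have hXd : disc A X ≤ 0 := by
    rcases Finset.mem_insert.1 hX with rfl | h1
    · rw [h.disc_neg (by norm_num)]
      norm_num
    · rw [Finset.mem_filter, Finset.mem_Icc] at h1
      exact h.disc_nonpos h1.1.1 h1.2
  have hZd : e + 1 ≤ disc A (Z - 1) := by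
    rcases Finset.mem_insert.1 hZ with rfl | h1
    · rw [add_sub_cancel_right, h.disc_top]
      linarith
    · rw [Finset.mem_filter, Finset.mem_Icc] at h1
      have := h.lt_disc_of_add_top_notMem h1.1.2 h1.2
      linarith
  have hXZ : X ≤ Z - 1 := by
    rcases Finset.mem_insert.1 hX with rfl | h1
    · rcases Finset.mem_insert.1 hZ with rfl | h2
      · omega
      · rw [Finset.mem_filter, Finset.mem_Icc] at h2
        omega
    · rw [Finset.mem_filter, Finset.mem_Icc] at h1
      rcases Finset.mem_insert.1 hZ with rfl | h2
      · omega
      · rw [Finset.mem_filter, Finset.mem_Icc] at h2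
        have := hsep X Z h1.1.1 h1.1.2 h1.2 h2.1.1 h2.1.2 h2.2
        omega
  -- The interval from X + 1 to Z - 1 + n has n + (Z - 1 - X) ≥ n + e + 1 = 2|A| - 1 elements.
  have hlen := disc_sub_le A hXZ
  refine ⟨X + 1, fun y hy => ?_⟩
  rw [Finset.mem_Icc] at hy
  by_contra hyA
  by_cases hyn : y ≤ n
  · have := hXmax y (Finset.mem_insert_of_mem (Finset.mem_filter.2
      ⟨Finset.mem_Icc.2 ⟨by omega, hyn⟩, hyA⟩))
    omega
  · by_cases hyZ : y ≤ Z - 1 + n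
    · have := hZmin (y - n) (Finset.mem_insert_of_mem (Finset.mem_filter.2
        ⟨Finset.mem_Icc.2 ⟨by omega, by omega⟩, by simpa using hyA⟩))
      omega
    · omega

/-- If some `x ∉ 2A` lies to the right of some `z` with `z + n ∉ 2A`, then the levels
`0, …, e` of the discrepancy are attained at consecutive non-elements, the levels `1, …, e - 1`
are attained at no other non-elements, and these are the only non-elements in `bothSet`. -/
theorem IsNormal.exists_descent (h : IsNormal A n) (he : 2 * (A.card : ℤ) = n + 2 + e)
    (h1 : 1 ≤ e) (hc : ((bothSet A n).card : ℤ) = e - 1) {x z : ℤ} (hxn : x ≤ n) (hx : x ∉ A + A)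
    (hz0 : 0 ≤ z) (hz : z + n ∉ A + A) (hzx : z ≤ x) :
    ∃ y₀, y₀ < n ∧ 0 < y₀ - e ∧ (∀ i, 0 ≤ i → i ≤ e → y₀ - i ∉ A ∧ disc A (y₀ - i) = i) ∧
      (∀ y, 0 < y → y < n → y ∉ A → 1 ≤ disc A y → disc A y ≤ e - 1 → y = y₀ - disc A y) ∧
      ∀ y, 0 < y → y < n → y ∉ A → y ∈ A + A → y + n ∈ A + A →
        1 ≤ disc A y ∧ disc A y ≤ e - 1 := by
  have hxd := h.disc_nonpos (hz0.trans hzx) hx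
  have hzd := h.lt_disc_of_add_top_notMem (hzx.trans hxn) hz
  have hz1 : 1 ≤ z := by
    by_contra hz1
    have : z = 0 := by omega
    subst this
    rw [h.disc_neg (by norm_num)] at hzd
    omega
  have hxn' : x < n := by
    rcases hxn.lt_or_eq with h2 | h2
    · exact h2
    · exact absurd (h2 ▸ h.mem_add_of_mem h.top_mem) hx
  set S := (Finset.Ioo 0 n).filter fun y => y ∉ A ∧ 1 ≤ disc A y ∧ disc A y ≤ e - 1 with hS
  have hmemS : ∀ y, 0 < y → y < n → y ∉ A → 1 ≤ disc A y → disc A y ≤ e - 1 → y ∈ (S : Set ℤ) :=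
    fun y h2 h3 h4 h5 h6 => by
      rw [hS, Finset.mem_coe, Finset.mem_filter, Finset.mem_Ioo]
      exact ⟨⟨h2, h3⟩, h4, h5, h6⟩
  have hSsub : S ⊆ bothSet A n := by
    intro y hy
    simp only [hS, bothSet, Finset.mem_filter, Finset.mem_Ioo] at hy ⊢
    obtain ⟨⟨hy0, hyn⟩, hyA, hy1, hy2⟩ := hy
    have := disc_of_notMem hyA
    exact ⟨⟨hy0, hyn⟩, hyA, h.mem_add_of_disc_pos hy0.le (by omega),
      h.add_top_mem hyn.le (by omega)⟩
  -- On the way down from z - 1 to x every level 1, ..., e - 1 is attained at a hole, and each such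
  -- hole belongs to `bothSet`. As |`bothSet`| = e - 1, every level is attained exactly once.
  have hsurj : Set.SurjOn (disc A) S (Finset.Icc 1 (e - 1) : Finset ℤ) := by
    intro j hj
    rw [Finset.mem_coe, Finset.mem_Icc] at hj
    obtain ⟨y, hy1, hy2, hy3, hy4⟩ := exists_disc_eq (A := A) (p := z - 1) (q := x) (j := j)
      (by omega) (by omega) (by omega)
    exact ⟨y, hmemS y (by omega) (by omega) hy3 (by omega) (by omega), hy4⟩
  have hcS : S.card ≤ (Finset.Icc 1 (e - 1)).card := by
    rw [Int.card_Icc]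
    have := Finset.card_le_card hSsub
    omega
  have hinj : Set.InjOn (disc A) S :=
    Finset.injOn_of_surjOn_of_card_le (disc A) (fun y hy => by
      simp only [hS, Finset.coe_filter, Set.mem_ofPred_eq] at hy
      exact Finset.mem_coe.2 (Finset.mem_Icc.2 hy.2.2)) hsurj hcS
  have hSeq : S = bothSet A n := by
    apply Finset.eq_of_subset_of_card_le hSsub
    have := Finset.card_le_card_of_surjOn _ hsurj
    rw [Int.card_Icc] at this
    omega
  obtain ⟨y₀, hy₀, hmin⟩ := ((Finset.Icc z x).filter fun y => disc A y ≤ 0).exists_min_image id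
    ⟨x, by simp [hzx, hxd]⟩
  simp only [Finset.mem_filter, Finset.mem_Icc, id] at hy₀ hmin
  have hpos : ∀ y, z - 1 ≤ y → y < y₀ → 1 ≤ disc A y := by
    intro y hy1 hy2
    by_contra hy3
    rcases hy1.lt_or_eq with h4 | h4
    · have := hmin y ⟨⟨by omega, by omega⟩, by omega⟩
      omega
    · rw [← h4] at hy3
      omega
  have hpred := hpos (y₀ - 1) (by omega) (by omega)
  -- Walking back from the first point y₀ of discrepancy at most 0: an element at y₀ - i - 1 would
  -- put y₀ - i - 2 at level i. For i = 0 this contradicts the choice of y₀. For i ≥ 1, level i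
  -- would be attained at a second hole.
  have hlevel : ∀ i : ℕ, (i : ℤ) ≤ e → z ≤ y₀ - i ∧ y₀ - i ∉ A ∧ disc A (y₀ - i) = i := by
    intro i
    induction i with
    | zero =>
      intro _
      rw [Nat.cast_zero, sub_zero]
      have h2 : y₀ ∉ A := fun h3 => by
        have := disc_of_mem h3
        omega
      have := disc_of_notMem h2
      exact ⟨hy₀.1.1, h2, by omega⟩
    | succ i ih =>
      intro hi
      push_cast at hi ⊢
      obtain ⟨h2, h3, h4⟩ := ih (by omega)
      have h5 := disc_of_notMem h3
      have e1 : y₀ - (i + 1) = y₀ - i - 1 := by ring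
      rw [e1]
      have h6 : z ≤ y₀ - i - 1 := by
        by_contra h6
        have : y₀ - i - 1 = z - 1 := by omega
        rw [this] at h5
        omega
      refine ⟨h6, fun h7 => ?_, by omega⟩
      have h8 := disc_of_mem h7
      rcases Nat.eq_zero_or_pos i with rfl | hi0
      · have := hpos (y₀ - 1 - 1) (by omega) (by omega)
        simp only [Nat.cast_zero, sub_zero] at *
        omega
      · obtain ⟨y, hy1, hy2, hy3, hy4⟩ := exists_disc_eq (A := A) (p := z - 1)
          (q := y₀ - i - 1 - 1) (j := i) (by omega) (by omega) (by omega)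
        have : y = y₀ - i := by
          exact hinj (hmemS y (by omega) (by omega) hy3 (by omega) (by omega))
            (hmemS _ (by omega) (by omega) h3 (by omega) (by omega)) (by rw [hy4, h4])
        omega
  refine ⟨y₀, by omega, ?_, ?_, ?_, ?_⟩
  · have := (hlevel e.toNat (by omega)).1
    omega
  · intro i hi0 hie
    have := hlevel i.toNat (by omega)
    rw [Int.toNat_of_nonneg hi0] at this
    exact this.2
  · intro y hy0 hyn hyA hy1 hy2
    have h2 := hlevel (disc A y).toNat (by omega)
    rw [Int.toNat_of_nonneg (by omega)] at h2
    exact hinj (hmemS y hy0 hyn hyA hy1 hy2)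
      (hmemS _ (by omega) (by omega) h2.2.1 (by omega) (by omega)) h2.2.2.symm
  · intro y hy0 hyn hyA hy1 hy2
    have : y ∈ S := by
      rw [hSeq, bothSet, Finset.mem_filter, Finset.mem_Ioo]
      exact ⟨⟨hy0, hyn⟩, hyA, hy1, hy2⟩
    simp only [hS, Finset.mem_filter] at this
    exact this.2.2

theorem IsNormal.isBiAP_of_single_gap (h : IsNormal A n) {y₀ : ℤ} (h0 : 0 < y₀) (hn : y₀ < n)
    (hy₀ : y₀ ∉ A)
    (hg : ∀ x, 0 < x → x < n → x ∉ A → ∀ y, (x ≤ y ∧ y ≤ y₀ ∨ y₀ ≤ y ∧ y ≤ x) → y ∉ A)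
    (hs : (A + A).card = 3 * A.card - 3) : IsBiAP A := by
  obtain ⟨l, hl, hl0, hly, hl1⟩ := exists_prev_mem h.zero_mem h0
  obtain ⟨p, hp, hpn, hyp, hp1⟩ := exists_next_mem h.top_mem hn
  refine isBiAP_of_two_intervals A l p n hl0 (hly.trans hyp) hpn (fun x => ?_) hs
  constructor
  · intro hx
    have h1 := h.nonneg x hx
    have h2 := h.le_top x hx
    by_contra hc
    rcases lt_trichotomy x y₀ with h3 | h3 | h3
    · exact hl1 x (by omega) h3 hx
    · exact hy₀ (h3 ▸ hx)
    · exact hp1 x h3 (by omega) hx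
  · rintro (⟨h1, h2⟩ | ⟨h1, h2⟩)
    · by_contra hx
      have : x ≠ 0 := fun h3 => hx (h3 ▸ h.zero_mem)
      exact hg x (by omega) (by omega) hx l (by omega) hl
    · by_contra hx
      have : x ≠ n := fun h3 => hx (h3 ▸ h.top_mem)
      exact hg x (by omega) (by omega) hx p (by omega) hp

end Dense

theorem IsNormal.exists_gap {A : Finset ℤ} {n : ℤ} (h : IsNormal A n) {x : ℤ} (h0 : 0 < x)
    (hn : x < n) (hx : x ∉ A) :
    ∃ a ∈ A, ∃ b ∈ A, 0 ≤ a ∧ b ≤ n ∧ a < x ∧ x < b ∧ ∀ y, a < y → y < b → y ∉ A := by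
  obtain ⟨a, ha, ha0, hax, ha1⟩ := exists_prev_mem h.zero_mem h0
  obtain ⟨b, hb, hbn, hxb, hb1⟩ := exists_next_mem h.top_mem hn
  refine ⟨a, ha, b, hb, ha0, hbn, hax, hxb, fun y h1 h2 => ?_⟩
  rcases lt_trichotomy y x with h3 | h3 | h3
  · exact ha1 y h1 h3
  · exact h3 ▸ hx
  · exact hb1 y h3 h2

/-- The conclusion of `IsNormal.exists_descent`, with its consequences for the ends of gaps. -/
structure IsDescent (A : Finset ℤ) (n e y₀ : ℤ) : Prop where
  lt_top : y₀ < n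
  pos : 0 < y₀ - e
  level : ∀ i, 0 ≤ i → i ≤ e → y₀ - i ∉ A ∧ disc A (y₀ - i) = i
  unique : ∀ y, 0 < y → y < n → y ∉ A → 1 ≤ disc A y → disc A y ≤ e - 1 → y = y₀ - disc A y
  both : ∀ y, 0 < y → y < n → y ∉ A → y ∈ A + A → y + n ∈ A + A →
    1 ≤ disc A y ∧ disc A y ≤ e - 1

section

variable {A : Finset ℤ} {n e y₀ : ℤ}

/-- At y₀ the discrepancy is 0, so y₀ is not in `bothSet`; hence y₀ ∉ 2A and A is antisymmetric on
[0, y₀]. The hole y₀ - 1 is the partner of 1. -/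
theorem IsDescent.one_mem (d : IsDescent A n e y₀) (h : IsNormal A n)
    (he : 2 * (A.card : ℤ) = n + 2 + e) (h1 : 1 ≤ e) : 1 ∈ A := by
  have l0 := d.level 0 le_rfl (by omega)
  have l1 := d.level 1 (by norm_num) h1
  rw [sub_zero] at l0
  have hp := d.pos
  have hy : y₀ ∉ A + A := fun hy => by
    have := d.both y₀ (by omega) d.lt_top l0.1 hy (h.add_top_mem d.lt_top.le (by omega))
    omega
  exact (h.mem_iff_of_notMem_add hy l0.2 (by norm_num) (by omega)).2 l1.1

theorem IsDescent.pred_top_mem (d : IsDescent A n e y₀) (h : IsNormal A n)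
    (he : 2 * (A.card : ℤ) = n + 2 + e) (h1 : 1 ≤ e) : n - 1 ∈ A := by
  have l0 := d.level e (by omega) le_rfl
  have l1 := d.level (e - 1) (by omega) (by omega)
  have hp := d.pos
  have hl := d.lt_top
  have hs := disc_of_notMem l0.1
  have hy : y₀ - e + n ∉ A + A := fun hy => by
    have := d.both (y₀ - e) hp (by omega) l0.1 (h.mem_add_of_disc_pos hp.le (by omega)) hy
    omega
  refine (h.mem_iff_of_add_top_notMem hy (by omega) (by omega) (by omega)).2 ?_
  convert l1.1 using 2
  ring

/-- Since 1 ∈ A, the first point a + 1 of a gap is in 2A. If its discrepancy were not positive, a +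
1 + n would be in 2A as well, and points of `bothSet` have positive discrepancy. -/
theorem IsDescent.one_le_disc (d : IsDescent A n e y₀) (h : IsNormal A n)
    (he : 2 * (A.card : ℤ) = n + 2 + e) (h1 : 1 ≤ e) {a : ℤ} (ha : a ∈ A) (ha1 : a + 1 ∉ A)
    (han : a + 1 < n) : 1 ≤ disc A (a + 1) := by
  by_contra hc
  have h2 := h.nonneg a ha
  have h3 := disc_of_notMem ha1
  have := d.both (a + 1) (by omega) han ha1 (Finset.add_mem_add ha (d.one_mem h he h1))
    (h.add_top_mem han.le (by omega))
  omega

theorem IsDescent.disc_le (d : IsDescent A n e y₀) (h : IsNormal A n)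
    (he : 2 * (A.card : ℤ) = n + 2 + e) (h1 : 1 ≤ e) {b : ℤ} (hb : b ∈ A) (hb1 : b - 1 ∉ A)
    (hb0 : 0 < b - 1) : disc A (b - 1) ≤ e - 1 := by
  by_contra hc
  have h2 := h.le_top b hb
  have := d.both (b - 1) hb0 (by omega) hb1 (h.mem_add_of_disc_pos hb0.le (by omega)) (by
    convert Finset.add_mem_add hb (d.pred_top_mem h he h1) using 1
    ring)
  omega

/-- Inside a gap the discrepancy falls by one per step, from a value at least 1 to a value at most e
- 1. So every gap contains a point of level between 1 and e - 1, and all those points lie in the one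
run ending at y₀: there is only one gap. -/
theorem IsDescent.isBiAP_of_two_le (d : IsDescent A n e y₀) (h : IsNormal A n)
    (he : 2 * (A.card : ℤ) = n + 2 + e) (h1 : 2 ≤ e) (hs : (A + A).card = 3 * A.card - 3) :
    IsBiAP A := by
  have hp := d.pos
  have l0 := d.level 0 le_rfl (by omega)
  rw [sub_zero] at l0
  refine h.isBiAP_of_single_gap (y₀ := y₀) (by omega) d.lt_top l0.1 ?_ hs
  intro x hx0 hxn hx
  obtain ⟨a, ha, b, hb, ha0, hbn, hax, hxb, hab⟩ := h.exists_gap hx0 hxn hx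
  have h2 := d.one_le_disc h he (by omega) ha (hab _ (by omega) (by omega)) (by omega)
  have h3 := d.disc_le h he (by omega) hb (hab _ (by omega) (by omega)) (by omega)
  have h4 := disc_gap (A := A) (p := a + 1) (q := b - 1) (by omega)
    fun y hy hy' => hab y (by omega) (by omega)
  obtain ⟨w, hw1, hw2, hw3, hw4⟩ : ∃ w, a < w ∧ w < b ∧ 1 ≤ disc A w ∧ disc A w ≤ e - 1 := by
    rcases le_total (disc A (a + 1)) (e - 1) with h5 | h5
    · exact ⟨a + 1, by omega, by omega, h2, h5⟩
    · refine ⟨a + 1 + (disc A (a + 1) - (e - 1)), by omega, by omega, ?_⟩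
      rw [disc_gap (A := A) (p := a + 1) (q := a + 1 + (disc A (a + 1) - (e - 1))) (by omega)
        fun y hy hy' => hab y (by omega) (by omega)]
      omega
  have h5 := d.unique w (by omega) (by omega) (hab w hw1 hw2) hw3 hw4
  rintro y hy
  by_cases h6 : y < b
  · by_cases h7 : a < y
    · exact hab y h7 h6
    · omega
  · have := (d.level (y₀ - y) (by omega) (by omega)).1
    rwa [sub_sub_cancel] at this

/-! ### The dense case with e = 1 -/

/-- The situation of `IsDescent` with `e = 1`. -/
theorem IsDescent.gap_of_eq_one (d : IsDescent A n 1 y₀) (h : IsNormal A n)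
    (he : 2 * (A.card : ℤ) = n + 2 + 1) {x : ℤ} (hx0 : 0 < x) (hxn : x < n) (hx : x ∉ A) :
    ∃ a ∈ A, ∃ b ∈ A, ∃ z, 0 ≤ a ∧ b ≤ n ∧ a < x ∧ x < b ∧ (∀ y, a < y → y < b → y ∉ A) ∧
      a + 2 ≤ z ∧ z < b ∧ (∀ y, a ≤ y → y < b → disc A y = z - y) ∧
      (∀ t, 0 ≤ t → t ≤ z → (t ∈ A ↔ z - t ∉ A)) ∧
      ∀ t, z - 1 ≤ t → t ≤ n → (t ∈ A ↔ z - 1 + n - t ∉ A) := by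
  obtain ⟨a, ha, b, hb, ha0, hbn, hax, hxb, hab⟩ := h.exists_gap hx0 hxn hx
  have h2 := d.one_le_disc h he (by omega) ha (hab _ (by omega) (by omega)) (by omega)
  have h3 := d.disc_le h he (by omega) hb (hab _ (by omega) (by omega)) (by omega)
  have h4 : ∀ y, a ≤ y → y < b → disc A y = disc A a - (y - a) := fun y hy hy' =>
    disc_gap hy fun w hw hw' => hab w hw (by omega)
  have h5 := h4 (a + 1) (by omega) (by omega)
  have h6 := h4 (b - 1) (by omega) (by omega)
  -- z is the point of the gap where the discrepancy vanishes. For e = 1 no hole is in `bothSet`, so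
  -- z ∉ 2A and z - 1 + n ∉ 2A, both with extremal discrepancy. This gives an antisymmetry on each
  -- side.
  obtain ⟨z, hz⟩ : ∃ z, z = a + disc A a := ⟨_, rfl⟩
  have h7 : ∀ y, a ≤ y → y < b → disc A y = z - y := fun y hy hy' => by
    rw [h4 y hy hy']
    omega
  have hz1 := h7 (z - 1) (by omega) (by omega)
  have hz0 := h7 z (by omega) (by omega)
  have hz2 := h7 (z - 2) (by omega) (by omega)
  have hzA := hab z (by omega) (by omega)
  have hz1A := hab (z - 1) (by omega) (by omega)
  have hzs : z ∉ A + A := fun hzs => by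
    have := d.both z (by omega) (by omega) hzA hzs (h.add_top_mem (by omega) (by omega))
    omega
  have hzs' : z - 1 + n ∉ A + A := fun hzs => by
    have := d.both (z - 1) (by omega) (by omega) hz1A
      (h.mem_add_of_disc_pos (by omega) (by omega)) hzs
    omega
  refine ⟨a, ha, b, hb, z, ha0, hbn, hax, hxb, hab, by omega, by omega, h7, ?_, ?_⟩
  · exact fun t ht ht' => h.mem_iff_of_notMem_add hzs (by omega) ht ht'
  · refine fun t ht ht' => h.mem_iff_of_add_top_notMem hzs' ?_ ht ht'
    have e1 : z - 1 - 1 = z - 2 := by ring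
    rw [e1]
    omega

/-- With two gaps, `n - 2` is not an element. -/
theorem IsDescent.isBiAP_or_notMem (d : IsDescent A n 1 y₀) (h : IsNormal A n)
    (he : 2 * (A.card : ℤ) = n + 2 + 1) (hs : (A + A).card = 3 * A.card - 3) :
    IsBiAP A ∨ n - 2 ∉ A := by
  by_contra! hc
  obtain ⟨hc, hn2⟩ := hc
  have hp := d.pos
  have l0 := d.level 0 le_rfl (by omega)
  rw [sub_zero] at l0
  obtain ⟨x₀, hx₀, hmin⟩ := ((Finset.Ioo 0 n).filter fun y => y ∉ A).exists_min_image id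
    ⟨y₀, by simp only [Finset.mem_filter, Finset.mem_Ioo]; exact ⟨⟨by omega, d.lt_top⟩, l0.1⟩⟩
  simp only [Finset.mem_filter, Finset.mem_Ioo, id] at hx₀ hmin
  obtain ⟨a, ha, b, hb, z, ha0, hbn, hax, hxb, hab, haz, hzb, hz, hz', hz''⟩ :=
    d.gap_of_eq_one h he hx₀.1.1 hx₀.1.2 hx₀.2
  have hfirst : ∀ y, 0 ≤ y → y ≤ a → y ∈ A := by
    intro y hy hya
    by_contra hyA
    have : y ≠ 0 := fun h3 => hyA (h3 ▸ h.zero_mem)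
    have := hmin y ⟨⟨by omega, by omega⟩, hyA⟩
    omega
  by_cases hx : ∃ x, b < x ∧ x < n ∧ x ∉ A
  · obtain ⟨x, hbx, hxn, hx⟩ := hx
    have hne : ((Finset.Ioo b n).filter fun y => y ∉ A ∧ disc A y = 0).Nonempty := by
      obtain ⟨a', ha', b', hb', w, ha0', hbn', hax', hxb', hab', haw, hwb, hw, -⟩ :=
        d.gap_of_eq_one h he (x := x) (by omega) hxn hx
      refine ⟨w, ?_⟩
      rw [Finset.mem_filter, Finset.mem_Ioo]
      have : ¬ a' < b := fun h3 => hab' b h3 (by omega) hb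
      exact ⟨⟨by omega, by omega⟩, hab' w (by omega) hwb, by rw [hw w (by omega) hwb]; ring⟩
    obtain ⟨w, hw, hwmin⟩ := Finset.exists_min_image _ id hne
    simp only [Finset.mem_filter, Finset.mem_Ioo, id] at hw hwmin
    obtain ⟨a', ha', b', hb', w', ha0', hbn', hax', hxb', hab', haw, hwb, hwd, hw1, hw2⟩ :=
      d.gap_of_eq_one h he (x := w) (by omega) hw.1.2 hw.2.1
    have hww : w' = w := by
      have := hwd w hax'.le hxb'
      omega
    subst hww
    have hba' : b ≤ a' := by
      by_contra h3
      exact hab' b (by omega) (by omega) hb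
    have hmid : ∀ y, b ≤ y → y ≤ a' → y ∈ A := by
      intro y hy hya
      by_contra hyA
      obtain ⟨a₂, ha₂, b₂, hb₂, w₂, ha0₂, hbn₂, hax₂, hxb₂, hab₂, haw₂, hwb₂, hwd₂, -⟩ :=
        d.gap_of_eq_one h he (x := y) (by omega) (by omega) hyA
      have h4 : ¬ a₂ < b := fun h3 => hab₂ b h3 (by
        rcases hy.lt_or_eq with h4 | h4
        · omega
        · exact absurd (h4 ▸ hb) hyA) hb
      have h5 : ¬ a' < b₂ := fun h3 => hab₂ a' (by
        rcases hya.lt_or_eq with h4 | h4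
        · omega
        · exact absurd (h4 ▸ ha') hyA) h3 ha'
      have := hwmin w₂ ⟨⟨by omega, by omega⟩, hab₂ w₂ (by omega) hwb₂, by
        rw [hwd₂ w₂ (by omega) hwb₂]; ring⟩
      omega
    -- The first gap is (a, b), and w' is the zero of the next one, with [0, a] and [b, a'] inside
    -- A. The partner w' - b of b must fall into (a, b), while w' - (b - 1) is an element. This
    -- forces w' + 1 = 2b.
    have h6 : w' - b ∉ A := (hw1 b (by omega) (by omega)).1 hb
    have h7 : w' - (b - 1) ∈ A := by
      by_contra h8
      exact hab (b - 1) (by omega) (by omega) ((hw1 (b - 1) (by omega) (by omega)).2 h8)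
    have h8 : w' - (a + 1) ∈ A := by
      by_contra h8
      exact hab (a + 1) (by omega) (by omega) ((hw1 (a + 1) (by omega) (by omega)).2 h8)
    have h9 : w' - (a + 1) ≤ a' := by
      by_contra h9
      exact hab' _ (by omega) (by omega) h8
    have h10 : w' - b < b := by
      by_contra h10
      exact h6 (hmid _ (by omega) (by omega))
    have h11 : a < w' - b := by
      by_contra h11
      exact h6 (hfirst _ (by omega) (by omega))
    have h12 : b ≤ w' - (b - 1) := by
      by_contra h12
      exact hab _ (by omega) (by omega) h7
    -- If n - 2 ∈ A, its partner w' + 1 is a hole of negative discrepancy. Being 2b it lies in 2A,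
    -- and so does w' + 1 + n: it would be in the empty `bothSet`.
    have h13 : w' + 1 ∉ A := by
      have := (hw2 (n - 2) (by omega) (by omega)).1 hn2
      convert this using 2
      ring
    have h14 : w' + 1 ≠ n := fun h3 => h13 (h3 ▸ h.top_mem)
    have h15 := disc_of_notMem h13
    rw [add_sub_cancel_right] at h15
    have h16 := d.both (w' + 1) (by omega) (by omega) h13
      (by
        have : w' + 1 = b + b := by omega
        rw [this]
        exact Finset.add_mem_add hb hb)
      (h.add_top_mem (by omega) (by rw [add_sub_cancel_right]; omega))
    omega
  · push Not at hx
    refine hc (isBiAP_of_two_intervals A a b n ha0 (by omega) hbn (fun y => ?_) hs)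
    constructor
    · intro hy
      have h1 := h.nonneg y hy
      have h2 := h.le_top y hy
      by_contra h3
      exact hab y (by omega) (by omega) hy
    · rintro (⟨h1, h2⟩ | ⟨h1, h2⟩)
      · exact hfirst y h1 h2
      · by_contra h3
        have : y ≠ n := fun h4 => h3 (h4 ▸ h.top_mem)
        have : y ≠ b := fun h4 => h3 (h4 ▸ hb)
        exact h3 (hx y (by omega) (by omega))

/-- Reflection exchanges the holes of level 0 and level 1, so the new base point is the reflection
of y₀ - 1. -/
theorem IsDescent.reflect (d : IsDescent A n 1 y₀) (he : 2 * (A.card : ℤ) = n + 2 + 1) :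
    IsDescent (reflect A n) n 1 (n - y₀ + 1) := by
  have l0 := d.level 0 le_rfl (by omega)
  have l1 := d.level 1 (by norm_num) (by omega)
  have hp := d.pos
  have hl := d.lt_top
  have h1 := disc_of_notMem l0.1
  have h2 := disc_of_notMem l1.1
  simp only [sub_zero] at l0 h1
  refine ⟨by omega, by omega, ?_, ?_, ?_⟩
  · intro i hi hi1
    rw [mem_reflect, disc_reflect]
    obtain rfl | rfl : i = 0 ∨ i = 1 := by omega
    · have e1 : n - (n - y₀ + 1 - 0) = y₀ - 1 := by ring
      rw [e1]
      exact ⟨l1.1, by omega⟩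
    · have e1 : n - (n - y₀ + 1 - 1) = y₀ := by ring
      rw [e1]
      exact ⟨l0.1, by omega⟩
  · intro y _ _ _ h3 h4
    omega
  · intro y hy0 hyn hy hy1 hy2
    exfalso
    rw [mem_reflect] at hy
    rw [mem_reflect_add] at hy1 hy2
    have := d.both (n - y) (by omega) (by omega) hy (by convert hy2 using 1; ring)
      (by convert hy1 using 1; ring)
    omega

theorem isAddFreimanIso_reflect {α : Type*} [AddCommMonoid α] {M : Set α} {φ : α → ℤ}
    (hφ : IsAddFreimanIso 2 M (A : Set ℤ) φ) :
    IsAddFreimanIso 2 M (reflect A n : Set ℤ) (fun p => n - φ p) := by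
  refine ⟨⟨?_, ?_, ?_⟩, ?_⟩
  · intro p hp
    have : φ p ∈ A := hφ.bijOn.mapsTo hp
    simpa [mem_reflect] using this
  · intro p hp q hq hpq
    exact hφ.bijOn.injOn hp hq (by simpa using hpq)
  · intro x hx
    have hx' : n - x ∈ A := by simpa [mem_reflect] using hx
    obtain ⟨p, hp, hpx⟩ := hφ.bijOn.surjOn (Finset.mem_coe.2 hx')
    exact ⟨p, hp, by simp [hpx]⟩
  · intro S T hS hT hS2 hT2
    rw [← hφ.map_sum_eq_map_sum hS hT hS2 hT2]
    simp only [Multiset.sum_map_sub, Multiset.map_const', Multiset.sum_replicate, hS2, hT2]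
    omega

theorem IsBiAP.reflect (hA : IsBiAP A) : IsBiAP (reflect A n) := by
  obtain ⟨n₀, n₁, hc, φ, hφ⟩ := hA
  exact ⟨n₀, n₁, by rw [card_reflect, hc], _, isAddFreimanIso_reflect hφ⟩

theorem IsDescent.isBiAP_of_eq_one (d : IsDescent A n 1 y₀) (h : IsNormal A n)
    (he : 2 * (A.card : ℤ) = n + 2 + 1) (hs : (A + A).card = 3 * A.card - 3) : IsBiAP A := by
  by_cases hbi : IsBiAP A
  · exact hbi
  have hn2 : n - 2 ∉ A := (d.isBiAP_or_notMem h he hs).resolve_left hbi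
  have h2 : 2 ∉ A := by
    rcases (d.reflect he).isBiAP_or_notMem h.reflect (by rw [card_reflect]; exact he)
      (by rw [card_reflect_add, card_reflect]; exact hs) with h3 | h3
    · refine absurd ?_ hbi
      rw [← reflect_reflect A n]
      exact h3.reflect
    · rw [mem_reflect] at h3
      convert h3 using 2
      ring
  have h1 := d.one_mem h he le_rfl
  have hdn := h.disc_top
  have hn := h.pos
  have hole : ∀ x, 0 < x → x < n → x ∉ A → ∃ z, z - 2 ∈ A ∧ z - 1 ∉ A ∧ z ∉ A ∧ z + 1 ∈ A ∧
      (x = z ∨ x = z - 1) ∧ disc A x = z - x := by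
    intro x hx0 hxn hx
    obtain ⟨a, ha, b, hb, z, ha0, hbn, hax, hxb, hab, haz, hzb, hz, hz', hz''⟩ :=
      d.gap_of_eq_one h he hx0 hxn hx
    have h3 : z - 2 ∈ A := by
      by_contra h4
      exact h2 ((hz' 2 (by norm_num) (by omega)).2 h4)
    have h4 : z + 1 ∈ A := by
      by_contra h4
      refine hn2 ((hz'' (n - 2) (by omega) (by omega)).2 ?_)
      convert h4 using 2
      ring
    have h5 : ¬ a < z - 2 := fun h5 => hab _ h5 (by omega) h3
    have h6 : ¬ z + 1 < b := fun h6 => hab _ (by omega) h6 h4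
    exact ⟨z, h3, hab _ (by omega) (by omega), hab _ (by omega) (by omega), h4, by omega,
      hz x hax.le hxb⟩
  -- As 2, n - 2 ∉ A, every gap is a pair z - 1, z with discrepancies 1, 0. The pair (membership,
  -- discrepancy) is then forced step by step, with period 4.
  have key : ∀ x, 0 ≤ x → x ≤ n → (x % 4 = 0 ∧ x ∈ A ∧ disc A x = 1) ∨
      (x % 4 = 1 ∧ x ∈ A ∧ disc A x = 2) ∨ (x % 4 = 2 ∧ x ∉ A ∧ disc A x = 1) ∨
      (x % 4 = 3 ∧ x ∉ A ∧ disc A x = 0) := by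
    intro x hx
    induction x, hx using Int.leInduction with
    | base => exact fun _ => Or.inl ⟨rfl, h.zero_mem, h.disc_zero⟩
    | succ x hx ih =>
      intro hxn
      have e1 : x + 1 - 1 = x := by ring
      by_cases hxA : x + 1 ∈ A
      · have hd := disc_of_mem hxA
        rw [e1] at hd
        rcases ih (by omega) with ⟨h3, h4, h5⟩ | ⟨h3, h4, h5⟩ | ⟨h3, h4, h5⟩ | ⟨h3, h4, h5⟩
        · exact Or.inr (Or.inl ⟨by omega, hxA, by omega⟩)
        -- A third consecutive element would lift the discrepancy to 3. Its return to the value 2 at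
        -- n would pass a hole of level 2, but holes have level 0 or 1.
        · obtain ⟨y, hy1, hy2, hy3, hy4⟩ :=
            exists_disc_eq (A := A) (p := x + 1) (q := n) (j := 2) hxn (by omega) (by omega)
          have : y ≠ n := fun h6 => hy3 (h6 ▸ h.top_mem)
          obtain ⟨z, -, -, -, -, h6, h7⟩ := hole y (by omega) (by omega) hy3
          omega
        · obtain ⟨z, h6, h7, h8, h9, h10, h11⟩ := hole x (by omega) (by omega) h4
          rcases h10 with h10 | h10
          · omega
          · refine absurd hxA ?_
            have : x + 1 = z := by omega
            rwa [this]
        · exact Or.inl ⟨by omega, hxA, by omega⟩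
      · have hd := disc_of_notMem hxA
        rw [e1] at hd
        have : x + 1 ≠ n := fun h6 => hxA (h6 ▸ h.top_mem)
        obtain ⟨z, h6, h7, h8, h9, h10, h11⟩ := hole (x + 1) (by omega) (by omega) hxA
        rcases ih (by omega) with ⟨h3, h4, h5⟩ | ⟨h3, h4, h5⟩ | ⟨h3, h4, h5⟩ | ⟨h3, h4, h5⟩
        · refine absurd h4 ?_
          have : x = z - 1 := by omega
          rwa [this]
        · exact Or.inr (Or.inr (Or.inl ⟨by omega, hxA, by omega⟩))
        · exact Or.inr (Or.inr (Or.inr ⟨by omega, hxA, by omega⟩))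
        · omega
  have hn4 : n % 4 = 1 := by
    rcases key n hn.le le_rfl with h3 | h3 | h3 | h3 <;> omega
  have hmem : ∀ x, 0 ≤ x → x ≤ n → (x ∈ A ↔ x % 4 ≤ 1) := by
    intro x hx hx'
    rcases key x hx hx' with ⟨h3, h4, h5⟩ | ⟨h3, h4, h5⟩ | ⟨h3, h4, h5⟩ | ⟨h3, h4, h5⟩
    · exact iff_of_true h4 (by omega)
    · exact iff_of_true h4 (by omega)
    · exact iff_of_false h4 (by omega)
    · exact iff_of_false h4 (by omega)
  refine isBiAP_of_two_progressions A 0 1 4 (n / 4).toNat (n / 4).toNat (fun x => ?_) (by omega) hs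
  constructor
  · intro hx
    have h3 := h.nonneg x hx
    have h4 := h.le_top x hx
    have h5 := (hmem x h3 h4).1 hx
    rcases (show x % 4 = 0 ∨ x % 4 = 1 by omega) with h6 | h6
    · exact Or.inl ⟨x / 4, by omega, by omega, by omega⟩
    · exact Or.inr ⟨x / 4, by omega, by omega, by omega⟩
  · rintro (⟨i, h3, h4, rfl⟩ | ⟨i, h3, h4, rfl⟩)
    · exact (hmem _ (by omega) (by omega)).2 (by omega)
    · exact (hmem _ (by omega) (by omega)).2 (by omega)

end

/-- If `2|A| ≥ n + 3`, then `A` is a bi-arithmetic progression or `2A` has a long interval. -/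
theorem IsNormal.isBiAP_or_exists_Icc {A : Finset ℤ} {n e : ℤ} (h : IsNormal A n)
    (he : 2 * (A.card : ℤ) = n + 2 + e) (h1 : 1 ≤ e) (hs : (A + A).card = 3 * A.card - 3) :
    IsBiAP A ∨ ∃ x : ℤ, Finset.Icc x (x + (2 * (A.card : ℤ) - 1) - 1) ⊆ A + A := by
  by_cases hsep : ∀ x z, 0 ≤ x → x ≤ n → x ∉ A + A → 0 ≤ z → z ≤ n → z + n ∉ A + A → x < z
  · exact Or.inr (h.exists_Icc_subset he hsep)
  push Not at hsep
  obtain ⟨x, z, hx0, hxn, hx, hz0, hzn, hz, hzx⟩ := hsep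
  have hn := h.pos
  obtain ⟨y₀, d1, d2, d3, d4, d5⟩ :=
    h.exists_descent he h1 (h.card_bothSet_of_dense he h1 (by omega)) hxn hx hz0 hz hzx
  have d : IsDescent A n e y₀ := ⟨d1, d2, d3, d4, d5⟩
  rcases h1.lt_or_eq with h2 | h2
  · exact Or.inl (d.isBiAP_of_two_le h he h2 hs)
  · subst h2
    exact Or.inl (d.isBiAP_of_eq_one h he hs)

/-! ### Antisymmetric sets, closed sets and additive minimality -/

theorem disc_sub_eq_card {A : Finset ℤ} {p q : ℤ} (h : p ≤ q) :
    disc A q - disc A p = 2 * ((A.filter fun x => p < x ∧ x ≤ q).card : ℤ) - (q - p) := by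
  have h1 : (A.filter fun x => p < x ∧ x ≤ q) = A.filter (· ≤ q) \ A.filter (· ≤ p) := by
    ext x
    simp only [Finset.mem_filter, Finset.mem_sdiff, not_and, not_le]
    exact ⟨fun hx => ⟨⟨hx.1, hx.2.2⟩, fun _ => hx.2.1⟩, fun hx => ⟨hx.1.1, hx.2 hx.1.1, hx.1.2⟩⟩
  have h2 : A.filter (· ≤ p) ⊆ A.filter (· ≤ q) := by
    intro x hx
    simp only [Finset.mem_filter] at hx ⊢
    exact ⟨hx.1, by omega⟩
  have h3 := Finset.card_le_card h2
  rw [h1, Finset.card_sdiff_of_subset h2, disc, disc]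
  omega

/-- The discrepancy of an antisymmetric set is symmetric. -/
theorem disc_symm {A : Finset ℤ} {f x : ℤ} (h0 : disc A (-1) = 0) (hf : disc A f = 0)
    (has : ∀ t, 0 ≤ t → t ≤ f → (t ∈ A ↔ f - t ∉ A)) (hx : -1 ≤ x) (hxf : x ≤ f) :
    disc A (f - 1 - x) = disc A x := by
  induction x, hx using Int.leInduction with
  | base => rw [h0, ← hf]; congr 1; ring
  | succ x hx ih =>
    have h1 := ih (by omega)
    have h2 := has (x + 1) (by omega) hxf
    rw [show f - (x + 1) = f - 1 - x by ring] at h2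
    by_cases h3 : x + 1 ∈ A
    · have h4 := disc_of_mem h3
      have h5 := disc_of_notMem (h2.1 h3)
      rw [show x + 1 - 1 = x by ring] at h4
      rw [show f - 1 - x - 1 = f - 1 - (x + 1) by ring] at h5
      omega
    · have h4 := disc_of_notMem h3
      have h5 := disc_of_mem (not_not.1 (mt h2.2 h3))
      rw [show x + 1 - 1 = x by ring] at h4
      rw [show f - 1 - x - 1 = f - 1 - (x + 1) by ring] at h5
      omega

/-- Each element of (p, q] is translated to an element of (p + m, q + m], so the second window is at
least as dense. -/
theorem disc_shift {A : Finset ℤ} {f m p q : ℤ} (hcl : ∀ t ∈ A, t + m ≤ f → t + m ∈ A)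
    (hpq : p ≤ q) (hq : q + m ≤ f) : disc A q - disc A p ≤ disc A (q + m) - disc A (p + m) := by
  induction q, hpq using Int.leInduction with
  | base => simp
  | succ q hpq ih =>
    have h1 := ih (by omega)
    have e1 : q + 1 - 1 = q := by ring
    have e2 : q + 1 + m - 1 = q + m := by ring
    by_cases h2 : q + 1 ∈ A
    · have h3 := disc_of_mem h2
      have h4 := disc_of_mem (hcl _ h2 hq)
      rw [e1] at h3
      rw [e2] at h4
      omega
    · have h3 := disc_of_notMem h2
      have h4 := pred_sub_one_le_disc A (q + 1 + m)
      rw [e1] at h3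
      rw [e2] at h4
      omega

/-- An antisymmetric subset of `[0, f]` closed under adding its least positive element `m ≥ 3`
has no positive discrepancy on `[1, f - 2]`. -/
theorem disc_nonpos_of_closed {A : Finset ℤ} {f m : ℤ} (h0 : disc A (-1) = 0) (hf : disc A f = 0)
    (hzero : 0 ∈ A) (has : ∀ t, 0 ≤ t → t ≤ f → (t ∈ A ↔ f - t ∉ A)) (hm : 3 ≤ m)
    (hmin : ∀ t, 0 < t → t < m → t ∉ A) (hcl : ∀ t ∈ A, t + m ≤ f → t + m ∈ A) {x : ℤ}
    (hx1 : 1 ≤ x) (hxf : x ≤ f - 2) : disc A x ≤ 0 := by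
  have hd0 : disc A 0 = 1 := by rw [disc_of_mem hzero, zero_sub, h0, zero_add]
  have hsmall : ∀ y, 1 ≤ y → y < m → disc A y ≤ 0 := by
    intro y hy hym
    rw [disc_gap (A := A) (p := 0) (q := y) (by omega) fun w hw hwy => hmin w hw (by omega)]
    omega
  by_contra! hpos
  obtain ⟨x₀, hx₀, hx₀min⟩ := ((Finset.Icc 1 (f - 2)).filter fun y => 0 < disc A y).exists_min_image
    id ⟨x, Finset.mem_filter.2 ⟨Finset.mem_Icc.2 ⟨hx1, hxf⟩, hpos⟩⟩
  simp only [Finset.mem_filter, Finset.mem_Icc, id] at hx₀ hx₀min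
  have hx₀m : m ≤ x₀ := by
    by_contra h1
    have := hsmall x₀ hx₀.1.1 (by omega)
    omega
  have hstep : disc A (x₀ - m) < disc A x₀ := by
    rcases hx₀m.lt_or_eq with h1 | h1
    · by_contra h2
      have := hx₀min (x₀ - m) ⟨⟨by omega, by omega⟩, by omega⟩
      omega
    · have h2 := hsmall (m - 1) (by omega) (by omega)
      have h3 := disc_le_pred_add_one A m
      have h4 := disc_gap (A := A) (p := 0) (q := m - 1) (by omega) fun w hw hwy => hmin w hw (by omega)
      rw [← h1] at hx₀
      omega
  -- By `disc_shift` a strict rise from y - m to y is followed by one from y to y + m, so the last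
  -- such y exceeds f - m. By symmetry its value occurs at f - 1 - y < m - 1, where positive
  -- discrepancy is possible only at 0, with value 1. The clause `y = x₀ ∨ 2 ≤ disc A y` excludes
  -- that case, as x₀ ≤ f - 2.
  obtain ⟨y, hy, hymax⟩ := ((Finset.Icc x₀ f).filter fun y =>
    1 ≤ disc A y ∧ (y = x₀ ∨ 2 ≤ disc A y) ∧ disc A (y - m) < disc A y).exists_max_image id
    ⟨x₀, Finset.mem_filter.2 ⟨Finset.mem_Icc.2 ⟨le_rfl, by omega⟩, by omega, Or.inl rfl, hstep⟩⟩
  simp only [Finset.mem_filter, Finset.mem_Icc, id] at hy hymax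
  have hyf : f < y + m := by
    by_contra h1
    have h2 := disc_shift hcl (p := y - m) (q := y) (by omega) (by omega)
    rw [sub_add_cancel] at h2
    have := hymax (y + m) ⟨⟨by omega, by omega⟩, by omega, by omega, by
      rw [add_sub_cancel_right]; omega⟩
    omega
  have h1 := disc_symm h0 hf has (x := y) (by omega) hy.1.2
  rcases lt_trichotomy (f - 1 - y) 0 with h2 | h2 | h2
  · rw [show f - 1 - y = -1 by omega, h0] at h1
    omega
  · rw [h2, hd0] at h1
    omega
  · have := hsmall (f - 1 - y) (by omega) (by omega)
    omega

/-- The part of `A` in `(r, n)` is additively minimal. -/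
theorem IsNormal.isLeftMinimal {A : Finset ℤ} {n r : ℤ} (h : IsNormal A n)
    (hc : 2 * (A.card : ℤ) = n + 2) (hrn : r < n) (hdr : disc A r = 0)
    (hpos : ∀ x, r < x → x ≤ n - 2 → 0 < disc A x)
    (has : ∀ t, r < t → t < n → (t ∈ A ↔ n + r - t ∉ A))
    (hhole : ∀ y, r < y → y < n → y ∉ A → y + n ∉ A + A) :
    IsLeftMinimal (A.filter fun x => r < x ∧ x < n) (r + 1) (n - 1) := by
  set B := A.filter fun x => r < x ∧ x < n with hB
  have hmem : ∀ x, x ∈ B ↔ x ∈ A ∧ r < x ∧ x < n := fun x => by rw [hB, Finset.mem_filter]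
  have hcard : ∀ x, r ≤ x → x < n →
      2 * ((B ∩ Finset.Icc (r + 1) x).card : ℤ) = disc A x + (x - r) := by
    intro x hx hxn
    have h1 := disc_sub_eq_card (A := A) hx
    have h2 : B ∩ Finset.Icc (r + 1) x = A.filter fun y => r < y ∧ y ≤ x := by
      ext y
      simp only [Finset.mem_inter, hmem, Finset.mem_Icc, Finset.mem_filter]
      constructor
      · rintro ⟨⟨h3, h4⟩, h5⟩
        exact ⟨h3, by omega⟩
      · rintro ⟨h3, h4⟩
        exact ⟨⟨h3, by omega⟩, by omega⟩
    rw [h2]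
    omega
  refine ⟨⟨⟨?_, ?_⟩, ?_⟩, ⟨?_, ?_⟩, ?_⟩
  · intro x hx
    rw [hmem] at hx
    rw [Finset.mem_Icc]
    omega
  · have h1 := h.disc_pred_top
    have h2 := hcard (n - 1) (by omega) (by omega)
    omega
  · intro x hx
    rw [Finset.mem_Icc] at hx
    have h1 := hpos x (by omega) (by omega)
    have h2 := hcard x (by omega) (by omega)
    omega
  · rw [Finset.eq_empty_iff_forall_notMem]
    intro x hx
    simp only [Finset.mem_inter, Finset.mem_image, hmem] at hx
    obtain ⟨⟨h1, h2, h3⟩, y, ⟨h4, h5, h6⟩, h7⟩ := hx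
    refine (has x h2 h3).1 h1 ?_
    convert h4 using 1
    omega
  · ext x
    simp only [Finset.mem_union, Finset.mem_image, hmem, Finset.mem_Icc]
    constructor
    · rintro (h1 | ⟨y, h1, h2⟩)
      · omega
      · omega
    · intro hx
      by_cases hxA : x ∈ A
      · exact Or.inl ⟨hxA, by omega⟩
      · refine Or.inr ⟨n + r - x, ⟨?_, by omega⟩, by ring⟩
        by_contra h1
        exact hxA ((has x (by omega) (by omega)).2 h1)
  · rw [sub_add_cancel]
    ext m
    simp only [Finset.mem_union, Finset.mem_image, Finset.mem_Icc, Finset.mem_singleton]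
    constructor
    · intro hm
      obtain ⟨b, hb, b', hb', rfl⟩ := Finset.mem_add.1 hm
      simp only [Finset.mem_union, Finset.mem_singleton, hmem] at hb hb'
      rcases hb with ⟨hb, h1, h2⟩ | rfl
      · rcases hb' with ⟨hb', h3, h4⟩ | rfl
        · by_cases h5 : b + b' ≤ n + r - 1
          · exact Or.inl ⟨by omega, by omega⟩
          · have h6 : b + b' ≠ n + r := by
              intro h6
              refine (has b h1 h2).1 hb ?_
              convert hb' using 1
              omega
            refine Or.inr ⟨b + b' - n, Or.inl ?_, by ring⟩
            rw [hmem]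
            refine ⟨?_, by omega, by omega⟩
            -- Otherwise b + b' - n is a hole whose translate by n is a sum, against `hhole`.
            by_contra h7
            refine hhole _ (by omega) (by omega) h7 ?_
            rw [sub_add_cancel]
            exact Finset.add_mem_add hb hb'
        · exact Or.inr ⟨b, Or.inl ((hmem b).2 ⟨hb, h1, h2⟩), by ring⟩
      · rcases hb' with hb' | rfl
        · exact Or.inr ⟨b', Or.inl ((hmem b').2 hb'), rfl⟩
        · exact Or.inr ⟨_, Or.inr rfl, rfl⟩
    · rintro (hm | ⟨b, hb, rfl⟩)
      -- Pigeonhole: more than half of [r + 1, m - (r + 1)] belongs to B, so B meets its image under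
      -- t ↦ m - t there.
      · have h1 := hpos (m - (r + 1)) (by omega) (by omega)
        have h2 := hcard (m - (r + 1)) (by omega) (by omega)
        set C := B ∩ Finset.Icc (r + 1) (m - (r + 1)) with hC
        have h3 : ¬ Disjoint C (C.image fun b => m - b) := by
          intro hd
          have h4 : C ∪ C.image (fun b => m - b) ⊆ Finset.Icc (r + 1) (m - (r + 1)) := by
            intro y hy
            simp only [hC, Finset.mem_union, Finset.mem_image, Finset.mem_inter,
              Finset.mem_Icc] at hy ⊢
            rcases hy with hy | ⟨b, hb, rfl⟩ <;> omega
          have h5 := Finset.card_le_card h4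
          rw [Finset.card_union_of_disjoint hd,
            Finset.card_image_of_injective _ (fun a b hab => by simpa using hab),
            Int.card_Icc] at h5
          omega
        rw [Finset.not_disjoint_iff] at h3
        obtain ⟨b, hb, hb'⟩ := h3
        obtain ⟨b', hb₂, rfl⟩ := Finset.mem_image.1 hb'
        refine Finset.mem_add.2 ⟨m - b', ?_, b', ?_, by ring⟩
        · exact Finset.mem_union_left _ (Finset.mem_inter.1 hb).1
        · exact Finset.mem_union_left _ (Finset.mem_inter.1 hb₂).1
      · exact Finset.add_mem_add (Finset.mem_union_right _ (Finset.mem_singleton_self n))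
          (by rcases hb with hb | rfl
              · exact Finset.mem_union_left _ hb
              · exact Finset.mem_union_right _ (Finset.mem_singleton_self _))

/-! ### The critical case: antisymmetry on both sides of r -/

/-- `2|A| = n + 2` and exactly one non-element `r` of `A` in `(0, n)` has `r, r + n ∉ 2A`, while
for every other one exactly one of `y`, `y + n` is in `2A`. -/
structure IsCritical (A : Finset ℤ) (n r : ℤ) : Prop where
  normal : IsNormal A n
  card : 2 * (A.card : ℤ) = n + 2
  pos : 0 < r
  lt : r < n
  notMem : r ∉ A
  notMem_add : r ∉ A + A
  add_top_notMem : r + n ∉ A + A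
  add_mem_iff : ∀ y, 0 < y → y < n → y ∉ A → y ≠ r → (y ∈ A + A ↔ y + n ∉ A + A)

namespace IsCritical

variable {A : Finset ℤ} {n r : ℤ}

theorem reflect (h : IsCritical A n r) : IsCritical (_root_.reflect A n) n (n - r) where
  normal := h.normal.reflect
  card := by rw [card_reflect]; exact h.card
  pos := by linarith [h.lt]
  lt := by linarith [h.pos]
  notMem := by
    rw [mem_reflect, sub_sub_cancel]
    exact h.notMem
  notMem_add := by
    rw [mem_reflect_add]
    convert h.add_top_notMem using 2
    ring
  add_top_notMem := by
    rw [mem_reflect_add]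
    convert h.notMem_add using 2
    ring
  add_mem_iff y hy0 hyn hy hyr := by
    rw [mem_reflect] at hy
    rw [mem_reflect_add, mem_reflect_add, show 2 * n - y = n - y + n by ring,
      show 2 * n - (y + n) = n - y by ring, h.add_mem_iff (n - y) (by omega) (by omega) hy
      (by omega), not_not]

/-- The two bounds at r, at least 1 before it and at most 0 at it, leave room for a single step.
Both equality cases apply, whence the antisymmetries on [0, r] and [r, n]. -/
theorem disc_pred (h : IsCritical A n r) : disc A (r - 1) = 1 := by
  have h1 := h.normal.disc_nonpos h.pos.le h.notMem_add
  have h2 := h.normal.lt_disc_of_add_top_notMem h.lt.le h.add_top_notMem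
  have h3 := disc_of_notMem h.notMem
  have := h.card
  omega

theorem disc_self (h : IsCritical A n r) : disc A r = 0 := by
  rw [disc_of_notMem h.notMem, h.disc_pred, sub_self]

theorem mem_iff_left (h : IsCritical A n r) {t : ℤ} (h0 : 0 ≤ t) (ht : t ≤ r) :
    t ∈ A ↔ r - t ∉ A :=
  h.normal.mem_iff_of_notMem_add h.notMem_add h.disc_self h0 ht

theorem mem_iff_right (h : IsCritical A n r) {t : ℤ} (h0 : r ≤ t) (ht : t ≤ n) :
    t ∈ A ↔ r + n - t ∉ A :=
  h.normal.mem_iff_of_add_top_notMem h.add_top_notMem (by rw [h.disc_pred]; linarith [h.card]) h0 ht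

theorem even_top (h : IsCritical A n r) : n % 2 = 0 := by
  have := h.card
  omega

theorem odd (h : IsCritical A n r) : r % 2 = 1 := by
  have := h.disc_self
  rw [disc] at this
  omega

theorem mem_add_of_disc_pos (h : IsCritical A n r) {x : ℤ} (h0 : 0 ≤ x) (hx : 0 < disc A x) :
    x ∈ A + A :=
  h.normal.mem_add_of_disc_pos h0 hx

theorem add_top_mem (h : IsCritical A n r) {x : ℤ} (h0 : x ≤ n) (hx : disc A (x - 1) ≤ 0) :
    x + n ∈ A + A :=
  h.normal.add_top_mem h0 (by linarith [h.card])

/-- A sum of two interior elements lies in `A` modulo `n` or is completed by a third element to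
`r` modulo `n`. -/
theorem add_mem_or (h : IsCritical A n r) {a b : ℤ} (ha : a ∈ A) (ha0 : 0 < a) (han : a < n)
    (hb : b ∈ A) (hb0 : 0 < b) (hbn : b < n) :
    a + b ∈ A ∨ a + b - n ∈ A ∨ ∃ c ∈ A, 0 < c ∧ c < n ∧ (a + b + c = r ∨ a + b + c = r + n ∨
      a + b + c = r + 2 * n) := by
  by_contra! hcon
  obtain ⟨h1, h2, h3⟩ := hcon
  have hab : a + b ∈ A + A := Finset.add_mem_add ha hb
  have hr := h.pos
  have hrn := h.lt
  have h4 : a + b ≠ n := fun h5 => h1 (h5 ▸ h.normal.top_mem)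
  have h5 : a + b ≠ r := fun h6 => h.notMem_add (h6 ▸ hab)
  have h6 : a + b ≠ r + n := fun h6 => h.add_top_notMem (h6 ▸ hab)
  rcases lt_or_gt_of_ne h4 with h7 | h7
  · rcases lt_or_gt_of_ne h5 with h8 | h8
    · have h9 : r - (a + b) ∈ A := by
        by_contra h9
        exact h1 ((h.mem_iff_left (by omega) (by omega)).2 h9)
      exact (h3 _ h9 (by omega) (by omega)).1 (by ring)
    · have h9 : r + n - (a + b) ∈ A := by
        by_contra h9
        exact h1 ((h.mem_iff_right (by omega) (by omega)).2 h9)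
      exact (h3 _ h9 (by omega) (by omega)).2.1 (by ring)
  · rcases lt_or_gt_of_ne h6 with h8 | h8
    · have h9 : r - (a + b - n) ∈ A := by
        by_contra h9
        exact h2 ((h.mem_iff_left (by omega) (by omega)).2 h9)
      exact (h3 _ h9 (by omega) (by omega)).2.1 (by ring)
    · have h9 : r + n - (a + b - n) ∈ A := by
        by_contra h9
        exact h2 ((h.mem_iff_right (by omega) (by omega)).2 h9)
      exact (h3 _ h9 (by omega) (by omega)).2.2 (by ring)

/-- `r - c` and `r - c + n` are not both in `2A`. -/
theorem left_not_both (h : IsCritical A n r) {c : ℤ} (hc : c ∈ A) (hc0 : 0 < c) (hcr : c < r) :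
    r - c ∈ A + A ↔ r + n - c ∉ A + A := by
  rw [h.add_mem_iff (r - c) (by omega) (by linarith [h.lt])
    ((h.mem_iff_left hc0.le hcr.le).1 hc) (by omega), show r - c + n = r + n - c by ring]

theorem ne_of_mem (h : IsCritical A n r) {c : ℤ} (hc : c ∈ A) : c ≠ r := fun h1 =>
  h.notMem (h1 ▸ hc)

/-- The element `c` is completed to `r` by a sum of two elements only if it is to the left. -/
theorem lt_of_mem_add (h : IsCritical A n r) {c : ℤ} (hc : c ∈ A) (h0 : r - c ∈ A + A) : c < r := by
  have h1 := h.ne_of_mem hc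
  have := (h.normal.add_mem_bounds h0).1
  omega

/-- The source of most contradictions below: r - c is a hole different from r, so it may not be in
2A together with its translate by n. -/
theorem false_of_mem_add (h : IsCritical A n r) {c : ℤ} (hc : c ∈ A) (hc0 : 0 < c)
    (h0 : r - c ∈ A + A) (h1 : r + n - c ∈ A + A) : False :=
  (h.left_not_both hc hc0 (h.lt_of_mem_add hc h0)).1 h0 h1

theorem pred_mem_add (h : IsCritical A n r) : r - 1 ∈ A + A :=
  h.mem_add_of_disc_pos (by linarith [h.pos]) (by rw [h.disc_pred]; norm_num)

/-- If `1 ∈ A`, then `A ∩ (r, n]` is closed upwards. -/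
theorem succ_mem (h : IsCritical A n r) (h1 : 1 ∈ A) {b : ℤ} (hb : b ∈ A) (hrb : r < b)
    (hbn : b < n) : b + 1 ∈ A := by
  have hr := h.pos
  have hg := h.pred_mem_add
  rcases h.add_mem_or hb (by omega) hbn h1 (by norm_num) (by omega) with h2 | h2 | ⟨c, hc, hc0, hcn, h2⟩
  · exact h2
  · have := h.normal.nonneg _ h2
    have h3 : b + 1 = n := by omega
    rw [h3]
    exact h.normal.top_mem
  · exfalso
    rcases h2 with h2 | h2 | h2
    · omega
    · refine h.false_of_mem_add h1 (by norm_num) hg ?_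
      convert Finset.add_mem_add hb hc using 1
      omega
    · omega

/-- If `1 ∈ A`, the elements of `A ∩ (r, n)` form an interval ending at `n`, or there are none. -/
theorem Icc_mem_of_one_mem (h : IsCritical A n r) (h1 : 1 ∈ A) {b x : ℤ} (hb : b ∈ A) (hrb : r < b)
    (hx : b ≤ x) (hxn : x ≤ n) : x ∈ A := by
  induction x, hx using Int.leInduction with
  | base => exact hb
  | succ x hx ih => exact h.succ_mem h1 (ih (by omega)) (by omega) (by omega)

/-- 1 ∈ A makes the part right of r closed upwards, and n - 1 ∈ A makes the part left of r closed
downwards. All holes then form one gap around r. -/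
theorem isBiAP_of_one_mem_of_pred_top_mem (h : IsCritical A n r) (h1 : 1 ∈ A) (h2 : n - 1 ∈ A)
    (hs : (A + A).card = 3 * A.card - 3) : IsBiAP A := by
  refine h.normal.isBiAP_of_single_gap h.pos h.lt h.notMem ?_ hs
  rintro x hx0 hxn hx y (⟨h3, h4⟩ | ⟨h3, h4⟩) hy
  · have h5 : n - x ∈ _root_.reflect A n := by
      refine h.reflect.Icc_mem_of_one_mem (b := n - y) ?_ ?_ ?_ ?_ ?_
      · rw [mem_reflect]; exact h2
      · rw [mem_reflect, sub_sub_cancel]; exact hy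
      · have := h.ne_of_mem hy
        omega
      · omega
      · omega
    rw [mem_reflect, sub_sub_cancel] at h5
    exact hx h5
  · have := h.ne_of_mem hy
    exact hx (h.Icc_mem_of_one_mem h1 hy (by omega) h4 hxn.le)

/-- The case `1 ∈ A`, `n - 1 ∉ A`: the set has the form `T` with an empty progression. -/
theorem hasFormT_of_one_mem (h : IsCritical A n r) (h1 : 1 ∈ A) (h2 : n - 1 ∉ A) :
    HasFormT n A := by
  have hr0 := h.pos
  have hrn := h.lt
  have hnone : ∀ t, r < t → t < n → t ∉ A := fun t h3 h4 h5 =>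
    h2 (h.Icc_mem_of_one_mem h1 h5 h3 (by omega) (by omega))
  -- An element between r and n would propagate up to n - 1, so there are none. Yet antisymmetry on
  -- [r, n] requires one of r + 1, n - 1 unless r = n - 1.
  obtain rfl : r = n - 1 := by
    by_contra h3
    refine hnone (n - 1) (by omega) (by omega) ?_
    rw [h.mem_iff_right (by omega) (by omega)]
    exact hnone _ (by omega) (by omega)
  obtain ⟨m, hm, hm1, hmn, hmax⟩ := exists_prev_mem (x := n) h1 (by
    have := h.ne_of_mem h1
    omega)
  have hmr : m < n - 1 := by
    have := h.ne_of_mem hm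
    omega
  have hlow : ∀ t, 0 ≤ t → t < n - 1 - m → t ∈ A := by
    intro t h3 h4
    rw [h.mem_iff_left h3 (by omega)]
    exact hmax _ (by omega) (by omega)
  have hm3 : m ≤ n - 3 := by
    by_contra h3
    refine (h.mem_iff_left (t := m) (by omega) (by omega)).1 hm ?_
    convert h1 using 1
    omega
  have hGm : n - 1 - m ∈ A + A := by
    have h3 := hlow (n - 2 - m) (by omega) (by omega)
    convert Finset.add_mem_add h3 h1 using 1
    ring
  -- With m the largest element below n, this says that n - A is closed under adding its least
  -- positive element n - m. A failure yields c with b + c = r + n - m, while r - m = n - 1 - m is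
  -- already a sum by `hGm`.
  have hclosed : ∀ b ∈ A, n ≤ b + m → b + m - n ∈ A := by
    intro b hb hbm
    have hb1 := h.normal.le_top b hb
    rcases hb1.lt_or_eq with hb2 | hb2
    · rcases h.add_mem_or hb (by omega) hb2 hm (by omega) (by omega) with h3 | h3 | ⟨c, hc, hc0, hcn, h3⟩
      · have := h.normal.le_top _ h3
        have h4 : b + m - n = 0 := by omega
        rw [h4]
        exact h.normal.zero_mem
      · exact h3
      · exfalso
        rcases h3 with h3 | h3 | h3
        · omega
        · refine h.false_of_mem_add hm (by omega) hGm ?_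
          convert Finset.add_mem_add hb hc using 1
          omega
        · have := h.ne_of_mem hc
          have := hmax c
          by_cases h5 : m < c
          · exact hmax c h5 hcn hc
          · omega
    · rw [hb2, add_sub_cancel_left]
      exact hm
  have hrefl := h.reflect.normal
  have hdisc : ∀ x, 0 ≤ x → x ≤ n - 2 → 0 < disc A x := by
    intro x hx hxn
    have h3 : disc (_root_.reflect A n) (n - 1 - x) ≤ 0 := by
      -- The antisymmetry t ↔ n - 1 - t of A becomes t ↔ n + 1 - t for n - A. The extra pair is 0 ∈
      -- n - A and n + 1 ∉ n - A.
      refine disc_nonpos_of_closed (f := n + 1) (m := n - m) ?_ ?_ hrefl.zero_mem ?_ (by omega)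
        ?_ ?_ (by omega) (by omega)
      · rw [hrefl.disc_neg (by norm_num)]; norm_num
      · have h4 := hrefl.disc_top
        have h5 : n + 1 ∉ _root_.reflect A n := fun h5 => by
          have := hrefl.le_top _ h5
          omega
        rw [disc_of_notMem h5, add_sub_cancel_right, h4, card_reflect]
        have := h.card
        omega
      · intro t ht htn
        rcases ht.lt_or_eq with h4 | h4
        · rcases htn.lt_or_eq with h5 | h5
          · have := h.mem_iff_left (t := n - t) (by omega) (by omega)
            rw [mem_reflect, mem_reflect, this, show n - 1 - (n - t) = n - (n + 1 - t) by ring]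
          · refine iff_of_false (fun h6 => ?_) (fun h6 => h6 ?_)
            · have := hrefl.le_top _ h6
              omega
            · rw [h5, sub_self]; exact hrefl.zero_mem
        · refine iff_of_true (by rw [← h4]; exact hrefl.zero_mem) (fun h6 => ?_)
          have := hrefl.le_top _ h6
          omega
      · intro t ht htm
        rw [mem_reflect]
        exact hmax _ (by omega) (by omega)
      · intro t ht htm
        rw [mem_reflect] at ht ⊢
        have h4 : t + (n - m) ≠ n + 1 := by
          intro h5
          have h6 : n - t = n - 1 - (n - 1 - (n - t)) := by ring
          have h7 := (h.mem_iff_left (t := n - t) (by omega) (by omega)).1 ht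
          refine h7 ?_
          convert hm using 1
          omega
        have h5 := hclosed _ ht (by omega)
        convert h5 using 1
        ring
    have h4 := disc_reflect (A := A) (n := n) (n - 1 - x)
    rw [show n - (n - 1 - x) - 1 = x by ring] at h4
    have := h.card
    omega
  refine ⟨0, le_rfl, by omega, A.filter fun x => -1 < x ∧ x < n, ?_, ?_⟩
  · have h3 := h.normal.isLeftMinimal (r := -1) h.card (by omega)
      (by rw [h.normal.disc_neg (by norm_num)]; norm_num)
      (fun x hx hx' => hdisc x (by omega) hx')
      (fun t h3 h4 => by
        rw [h.mem_iff_left (by omega) (by omega), show n + -1 - t = n - 1 - t by ring])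
      (fun y hy hyn hyA => by
        rcases eq_or_ne y (n - 1) with h3 | h3
        · rw [h3]; exact h.add_top_notMem
        · have : y ≠ 0 := fun h4 => hyA (h4 ▸ h.normal.zero_mem)
          exact (h.add_mem_iff y (by omega) hyn hyA h3).1
            (h.mem_add_of_disc_pos (by omega) (hdisc y (by omega) (by omega))))
    exact h3
  · ext x
    simp only [Finset.mem_union, Finset.mem_image, Finset.mem_Icc, Finset.mem_filter,
      Finset.mem_singleton]
    constructor
    · intro hx
      have h3 := h.normal.nonneg x hx
      have h4 := h.normal.le_top x hx
      rcases h4.lt_or_eq with h5 | h5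
      · exact Or.inl (Or.inr ⟨hx, by omega, h5⟩)
      · exact Or.inr h5
    · rintro ((⟨i, hi, rfl⟩ | hx) | rfl)
      · have : 2 * i = 0 := by omega
        rw [this]
        exact h.normal.zero_mem
      · exact hx.1
      · exact h.normal.top_mem

end IsCritical

/-! ### The critical case with neither 1 nor n - 1 in A -/

theorem mem_image_sub {B : Finset ℤ} {w x : ℤ} : x ∈ B.image (fun b => w - b) ↔ w - x ∈ B :=
  mem_reflect

theorem reflect_inter_Icc (B : Finset ℤ) (n u v : ℤ) :
    reflect B n ∩ Finset.Icc (n - v) (n - u) = reflect (B ∩ Finset.Icc u v) n := by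
  ext x
  simp only [Finset.mem_inter, mem_reflect, Finset.mem_Icc]
  exact and_congr_right fun _ => ⟨fun h => by omega, fun h => by omega⟩

theorem IsLeftMinimal.reflect {B : Finset ℤ} {u v : ℤ} (h : IsLeftMinimal B u v) (n : ℤ) :
    IsRightMinimal (_root_.reflect B n) (n - v) (n - u) := by
  obtain ⟨⟨⟨h1, h2⟩, h3⟩, ⟨h4, h5⟩, h6⟩ := h
  refine ⟨⟨⟨?_, ?_⟩, ?_⟩, ⟨?_, ?_⟩, ?_⟩
  · intro x hx
    have := Finset.mem_Icc.1 (h1 (mem_reflect.1 hx))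
    rw [Finset.mem_Icc]
    omega
  · rw [reflect_inter_Icc, card_reflect, h2]
    ring
  · intro x hx
    rw [Finset.mem_Icc] at hx
    have h7 := h3 (n - x) (Finset.mem_Icc.2 ⟨by omega, by omega⟩)
    have h8 := reflect_inter_Icc B n u (n - x)
    rw [sub_sub_cancel] at h8
    rw [h8, card_reflect]
    omega
  · rw [Finset.eq_empty_iff_forall_notMem] at h4 ⊢
    intro x hx
    rw [Finset.mem_inter, mem_image_sub, mem_reflect, mem_reflect] at hx
    refine h4 (n - x) (Finset.mem_inter.2 ⟨hx.1, ?_⟩)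
    rw [mem_image_sub]
    convert hx.2 using 1
    ring
  · ext x
    have h7 := Finset.ext_iff.1 h5 (n - x)
    rw [Finset.mem_union, mem_image_sub, Finset.mem_Icc] at h7
    rw [Finset.mem_union, mem_image_sub, mem_reflect, mem_reflect, Finset.mem_Icc,
      show n - (n - v + (n - u) - x) = u + v - (n - x) by ring, h7]
    omega
  · have h7 : _root_.reflect B n ∪ {n - v - 1} = _root_.reflect (B ∪ {v + 1}) n := by
      ext x
      simp only [Finset.mem_union, mem_reflect, Finset.mem_singleton]
      exact or_congr_right ⟨fun h => by omega, fun h => by omega⟩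
    rw [h7, reflect_add_reflect, h6]
    ext x
    simp only [mem_reflect, Finset.mem_union, Finset.mem_Icc, Finset.mem_image,
      Finset.mem_singleton]
    refine or_congr ⟨fun h => by omega, fun h => by omega⟩ ⟨?_, ?_⟩
    · rintro ⟨b, hb, hbx⟩
      exact ⟨n - b, by rwa [sub_sub_cancel], by omega⟩
    · rintro ⟨b, hb, hbx⟩
      exact ⟨n - b, hb, by omega⟩

namespace IsCritical

variable {A : Finset ℤ} {n r : ℤ}

/-- If t + m ∉ A, antisymmetry gives c with t + m + c = r, so r - m = t + c is a sum; by `hG` so is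
its translate by n. -/
theorem closed_left (h : IsCritical A n r) {m t : ℤ} (hm : m ∈ A) (hm0 : 0 < m) (hmr : m < r)
    (hG : r + n - m ∈ A + A) (ht : t ∈ A) (htm : t + m ≤ r) : t + m ∈ A := by
  have hrn := h.lt
  have ht0 := h.normal.nonneg t ht
  rcases ht0.lt_or_eq with ht1 | ht1
  · rcases h.add_mem_or ht ht1 (by omega) hm hm0 (by omega) with h1 | h1 | ⟨c, hc, hc0, hcn, h1⟩
    · exact h1
    · have := h.normal.nonneg _ h1
      omega
    · exfalso
      rcases h1 with h1 | h1 | h1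
      · refine h.false_of_mem_add hm hm0 ?_ hG
        convert Finset.add_mem_add ht hc using 1
        omega
      · omega
      · omega
  · rwa [← ht1, zero_add]

theorem pred_mem (h : IsCritical A n r) (h1 : 1 ∉ A) : r - 1 ∈ A := by
  have hr := h.pos
  rw [h.mem_iff_left (by omega) (by omega), sub_sub_cancel]
  exact h1

theorem five_le (h : IsCritical A n r) (h1 : 1 ∉ A) (h2 : 2 ∉ A) (hr : r ≠ 1) : 5 ≤ r := by
  have h3 := h.odd
  have h4 := h.pos
  by_contra h5
  refine h2 ?_
  convert h.pred_mem h1 using 1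
  omega

/-- Let m ≥ 3 be the least positive element. The gap below m is mirrored by a run of elements from r
- m + 1 to r - 1, so the discrepancy just before r - m is 3 - m ≤ 0. Hence r + n - m ∈ 2A, the left
part is closed under adding m, and `disc_nonpos_of_closed` applies. -/
theorem disc_nonpos_left (h : IsCritical A n r) (h1 : 1 ∉ A) (h2 : 2 ∉ A) {x : ℤ} (hx1 : 1 ≤ x)
    (hx : x ≤ r - 2) : disc A x ≤ 0 := by
  have h5 := h.five_le h1 h2 (by omega)
  have hrn := h.lt
  obtain ⟨m, hm, hmr, hm0, hmin⟩ := exists_next_mem (x := 0) (h.pred_mem h1) (by omega)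
  have hm3 : 3 ≤ m := by
    by_contra h3
    obtain rfl | rfl : m = 1 ∨ m = 2 := by omega
    · exact h1 hm
    · exact h2 hm
  refine disc_nonpos_of_closed (f := r) (m := m) ?_ h.disc_self h.normal.zero_mem
    (fun t => h.mem_iff_left) hm3 hmin ?_ hx1 hx
  · rw [h.normal.disc_neg (by norm_num)]; norm_num
  · refine fun t => h.closed_left hm hm0 (by omega) ?_
    rw [show r + n - m = r - m + n by ring]
    refine h.add_top_mem (by omega) ?_
    have h6 := disc_run (A := A) (p := r - m) (q := r - 1) (by omega) fun y hy hyr => by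
      rw [h.mem_iff_left (by omega) (by omega)]
      exact hmin _ (by omega) (by omega)
    have h7 := disc_of_notMem ((h.mem_iff_left hm0.le (by omega)).1 hm)
    have h8 := h.disc_pred
    omega

/-- Closure under adding 2 puts all even numbers up to r in A. As r is odd, antisymmetry excludes
the odd ones. -/
theorem mem_iff_even_left (h : IsCritical A n r) (h2 : 2 ∈ A) (hr : 2 < r)
    (hG : r + n - 2 ∈ A + A) {t : ℤ} (ht : 0 ≤ t) (htr : t ≤ r) : t ∈ A ↔ t % 2 = 0 := by
  have hev : ∀ k : ℤ, 0 ≤ k → 2 * k ≤ r → 2 * k ∈ A := by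
    intro k hk
    induction k, hk using Int.leInduction with
    | base => exact fun _ => h.normal.zero_mem
    | succ k hk ih =>
      intro hkr
      rw [mul_add]
      exact h.closed_left h2 (by norm_num) hr hG (ih (by omega)) (by omega)
  have hodd := h.odd
  rcases Int.emod_two_eq_zero_or_one t with h3 | h3
  · refine iff_of_true ?_ h3
    have := hev (t / 2) (by omega) (by omega)
    rwa [show 2 * (t / 2) = t by omega] at this
  · refine iff_of_false ?_ (by omega)
    rw [h.mem_iff_left ht htr, not_not]
    have := hev ((r - t) / 2) (by omega) (by omega)
    rwa [show 2 * ((r - t) / 2) = r - t by omega] at this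

/-- A second antisymmetry, on [r - 2, n], combines with the one on [r, n] to give period 2, so all
elements from r - 1 on are even. The least odd element o then lies left of r - 1, and the sum o + (r
- 1) can neither be in A modulo n nor be completed to r + n. -/
theorem false_of_two_mem (h : IsCritical A n r) (h1 : 1 ∉ A) (hn1 : n - 1 ∉ A) (h2 : 2 ∈ A)
    (hr : 2 < r) (hG : r + n - 2 ∉ A + A) (hodd : ∃ o ∈ A, o % 2 = 1) : False := by
  have hrn := h.lt
  have hne := h.even_top
  have hro := h.odd
  have hr2 : r - 2 ∉ A := (h.mem_iff_left (by norm_num) hr.le).1 h2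
  have hr1 := h.pred_mem h1
  have hsym : ∀ t, r - 2 ≤ t → t ≤ n → (t ∈ A ↔ r - 2 + n - t ∉ A) := by
    intro t ht htn
    refine h.normal.mem_iff_of_add_top_notMem ?_ ?_ ht htn
    · rwa [show r - 2 + n = r + n - 2 by ring]
    · have h3 := disc_of_mem hr1
      have h4 := disc_of_notMem hr2
      have h5 := h.disc_pred
      have h6 := h.card
      rw [show r - 1 - 1 = r - 2 by ring] at h3
      omega
  have hstep : ∀ s, r ≤ s → s ≤ n → (s - 2 ∈ A ↔ s ∈ A) := by
    intro s hs hsn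
    rw [hsym (s - 2) (by omega) (by omega), h.mem_iff_right hs hsn,
      show r - 2 + n - (s - 2) = r + n - s by ring]
  have hpair : ∀ k : ℤ, 0 ≤ k → r - 2 ≤ n - 1 - 2 * k → n - 2 * k ∈ A ∧ n - 1 - 2 * k ∉ A := by
    intro k hk
    induction k, hk using Int.leInduction with
    | base => exact fun _ => ⟨by simpa using h.normal.top_mem, by simpa using hn1⟩
    | succ k hk ih =>
      intro hkr
      obtain ⟨h3, h4⟩ := ih (by omega)
      rw [show n - 2 * (k + 1) = n - 2 * k - 2 by ring,
        show n - 1 - 2 * (k + 1) = n - 1 - 2 * k - 2 by ring, hstep _ (by omega) (by omega),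
        hstep _ (by omega) (by omega)]
      exact ⟨h3, h4⟩
  have hev : ∀ x ∈ A, r - 1 ≤ x → x % 2 = 0 := by
    intro x hx hxr
    have hxn := h.normal.le_top x hx
    by_contra h3
    refine (hpair ((n - 1 - x) / 2) (by omega) (by omega)).2 ?_
    rwa [show n - 1 - 2 * ((n - 1 - x) / 2) = x by omega]
  obtain ⟨o, ho, homin⟩ := (A.filter fun x => x % 2 = 1).exists_min_image id (by
    obtain ⟨o, ho, ho'⟩ := hodd
    exact ⟨o, Finset.mem_filter.2 ⟨ho, ho'⟩⟩)
  simp only [Finset.mem_filter, id] at ho homin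
  have ho0 := h.normal.nonneg o ho.1
  have hor : o < r - 1 := by
    by_contra h3
    have := hev o ho.1 (by omega)
    omega
  -- Below o the elements are even, so the discrepancy is 0 at each odd point. A missing even number
  -- 2k + 2 would be the sum of 2k and 2 and also be reached modulo n from above.
  have hlow : ∀ k : ℤ, 0 ≤ k → 2 * k < o → 2 * k ∈ A ∧ disc A (2 * k) = 1 := by
    intro k hk
    induction k, hk using Int.leInduction with
    | base => exact fun _ => ⟨h.normal.zero_mem, h.normal.disc_zero⟩
    | succ k hk ih =>
      intro hko
      obtain ⟨h3, h4⟩ := ih (by omega)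
      have h5 : 2 * k + 1 ∉ A := fun h5 => by
        have := homin _ ⟨h5, by omega⟩
        omega
      have h6 := disc_of_notMem h5
      rw [add_sub_cancel_right] at h6
      have h7 : 2 * (k + 1) ∈ A := by
        by_contra h7
        refine (h.add_mem_iff (2 * (k + 1)) (by omega) (by omega) h7 (by omega)).1
          (by rw [mul_add]; exact Finset.add_mem_add h3 h2) (h.add_top_mem (by omega) ?_)
        rw [show 2 * (k + 1) - 1 = 2 * k + 1 by ring]
        omega
      have h8 := disc_of_mem h7
      rw [show 2 * (k + 1) - 1 = 2 * k + 1 by ring] at h8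
      exact ⟨h7, by omega⟩
  have hdo : disc A o = 2 := by
    rw [disc_of_mem ho.1]
    have := (hlow ((o - 1) / 2) (by omega) (by omega)).2
    rw [show 2 * ((o - 1) / 2) = o - 1 by omega] at this
    omega
  have hG' : r - o ∈ A + A := by
    refine h.mem_add_of_disc_pos (by omega) ?_
    have h3 := disc_symm (by rw [h.normal.disc_neg (by norm_num)]; norm_num) h.disc_self
      (fun t => h.mem_iff_left) (x := o) (by omega) (by omega)
    have h4 := disc_of_notMem ((h.mem_iff_left ho0 (by omega)).1 ho.1)
    rw [show r - o - 1 = r - 1 - o by ring] at h4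
    omega
  -- o + (r - 1) is odd and exceeds r - 1; reduced by n it is odd and less than o. Neither is in A,
  -- so some c completes it, and r + n - o = (r - 1) + c is a sum besides r - o.
  rcases h.add_mem_or ho.1 (by omega) (by omega) hr1 (by omega) (by omega) with
    h3 | h3 | ⟨c, hc, hc0, hcn, h3⟩
  · have := hev _ h3 (by omega)
    omega
  · have := homin _ ⟨h3, by omega⟩
    omega
  · rcases h3 with h3 | h3 | h3
    · omega
    · refine h.false_of_mem_add ho.1 (by omega) hG' ?_
      convert Finset.add_mem_add hr1 hc using 1
      omega
    · omega

/-- No element of `(0, r)` is completed to `r` by a sum of two elements. -/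
theorem sub_notMem_add (h : IsCritical A n r) (h1 : 1 ∉ A) (hn1 : n - 1 ∉ A)
    (hodd : ∃ o ∈ A, o % 2 = 1) {c : ℤ} (hc : c ∈ A) (hc0 : 0 < c) (hcr : c < r) :
    r - c ∉ A + A := by
  have hro := h.odd
  have hrn := h.lt
  by_cases h2 : 2 ∈ A
  · by_cases hG : r + n - 2 ∈ A + A
    · have hev := fun t => h.mem_iff_even_left (t := t) h2 (by omega) hG
      intro h3
      obtain ⟨a, ha, b, hb, hab⟩ := Finset.mem_add.1 h3
      have ha0 := h.normal.nonneg a ha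
      have hb0 := h.normal.nonneg b hb
      have h4 := (hev a ha0 (by omega)).1 ha
      have h5 := (hev b hb0 (by omega)).1 hb
      have h6 := (hev c hc0.le (by omega)).1 hc
      omega
    · exact (h.false_of_two_mem h1 hn1 h2 (by omega) hG hodd).elim
  · intro h3
    rcases eq_or_ne c (r - 1) with h4 | h4
    · rw [h4, sub_sub_cancel] at h3
      obtain ⟨a, ha, b, hb, hab⟩ := Finset.mem_add.1 h3
      have ha0 := h.normal.nonneg a ha
      have hb0 := h.normal.nonneg b hb
      refine h1 ?_
      obtain h5 | h5 : a = 1 ∨ b = 1 := by omega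
      · exact h5 ▸ ha
      · exact h5 ▸ hb
    · refine h.false_of_mem_add hc hc0 h3 ?_
      rw [show r + n - c = r - c + n by ring]
      refine h.add_top_mem (by omega) ?_
      by_cases h5 : c = 1
      · exact absurd hc (h5 ▸ h1)
      · exact h.disc_nonpos_left h1 h2 (by omega) (by omega)

/-- The part of `A` to the left of `r` is a progression or reflects to a minimal set. -/
theorem even_or_isLeftMinimal (h : IsCritical A n r) (h1 : 1 ∉ A) (hn1 : n - 1 ∉ A)
    (hodd : ∃ o ∈ A, o % 2 = 1) :
    (∀ t, 0 ≤ t → t ≤ r → (t ∈ A ↔ t % 2 = 0)) ∨ 5 ≤ r ∧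
      IsLeftMinimal ((_root_.reflect A n).filter fun x => n - r < x ∧ x < n) (n - r + 1)
        (n - 1) := by
  have hro := h.odd
  have hr0 := h.pos
  have hrn := h.lt
  have hno := fun c => h.sub_notMem_add h1 hn1 hodd (c := c)
  by_cases hr1 : r = 1
  · left
    intro t ht htr
    obtain rfl | rfl : t = 0 ∨ t = 1 := by omega
    · exact iff_of_true h.normal.zero_mem rfl
    · exact iff_of_false h1 (by norm_num)
  by_cases h2 : 2 ∈ A
  · left
    intro t
    refine h.mem_iff_even_left h2 (by omega) ?_
    have h3 := h.left_not_both h2 (by norm_num) (by omega)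
    by_contra h4
    exact hno 2 h2 (by norm_num) (by omega) (h3.2 h4)
  · right
    refine ⟨h.five_le h1 h2 hr1, ?_⟩
    have hrefl := h.reflect
    refine hrefl.normal.isLeftMinimal hrefl.card (by omega) hrefl.disc_self ?_ ?_ ?_
    · intro x hx hxn
      have h3 := h.disc_nonpos_left h1 h2 (x := n - x - 1) (by omega) (by omega)
      have h4 := h.card
      rw [disc_reflect]
      omega
    · intro t ht htn
      rw [hrefl.mem_iff_right ht.le htn.le, add_comm n]
    · intro y hy hyn hyA
      rw [mem_reflect] at hyA
      rw [mem_reflect_add, show 2 * n - (y + n) = n - y by ring]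
      have h3 : r - (n - y) ∈ A := by
        by_contra h3
        exact hyA ((h.mem_iff_left (by omega) (by omega)).2 h3)
      have h4 := hno _ h3 (by omega) (by omega)
      rwa [sub_sub_cancel] at h4

theorem hasFormT_of_even_left (h : IsCritical A n r) (hn1 : n - 1 ∉ A) (h5 : 5 ≤ n - r)
    (hev : ∀ t, 0 ≤ t → t ≤ r → (t ∈ A ↔ t % 2 = 0))
    (hmin : IsLeftMinimal (A.filter fun x => r < x ∧ x < n) (r + 1) (n - 1)) : HasFormT n A := by
  have hro := h.odd
  have hr0 := h.pos
  have hrn := h.lt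
  -- With 2k = r + 1, the last term of the progression is also the first element of B: r + 1 ∈ A
  -- because its partner n - 1 is not.
  have hr2 : 2 * ((r + 1) / 2) = r + 1 := by omega
  refine ⟨(r + 1) / 2, by omega, by omega, _, by rw [hr2]; exact hmin, ?_⟩
  ext x
  simp only [Finset.mem_union, Finset.mem_image, Finset.mem_Icc, Finset.mem_filter,
    Finset.mem_singleton]
  constructor
  · intro hx
    have h3 := h.normal.nonneg x hx
    have h4 := h.normal.le_top x hx
    rcases h4.lt_or_eq with h6 | h6
    · by_cases h7 : x ≤ r
      · have := (hev x h3 h7).1 hx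
        exact Or.inl (Or.inl ⟨x / 2, by omega, by omega⟩)
      · exact Or.inl (Or.inr ⟨hx, by omega, h6⟩)
    · exact Or.inr h6
  · rintro ((⟨i, hi, rfl⟩ | hx) | rfl)
    · by_cases h6 : 2 * i ≤ r
      · exact (hev _ (by omega) h6).2 (by omega)
      · rw [h.mem_iff_right (by omega) (by omega)]
        convert hn1 using 2
        omega
    · exact hx.1
    · exact h.normal.top_mem

/-- The classification in the critical case. -/
theorem classification (h : IsCritical A n r) (hodd : ∃ o ∈ A, o % 2 = 1)
    (hs : (A + A).card = 3 * A.card - 3) :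
    IsBiAP A ∨ HasFormT n A ∨ (∃ T : Finset ℤ, HasFormT n T ∧ A = T.image (fun t => n - t)) ∨
      HasFormS n A := by
  have hrefl : A = (_root_.reflect A n).image fun t => n - t := (reflect_reflect A n).symm
  have hodd' : ∃ o ∈ _root_.reflect A n, o % 2 = 1 := by
    obtain ⟨o, ho, ho'⟩ := hodd
    have := h.even_top
    exact ⟨n - o, by rwa [mem_reflect, sub_sub_cancel], by omega⟩
  have h1iff : 1 ∈ _root_.reflect A n ↔ n - 1 ∈ A := mem_reflect
  have h2iff : n - 1 ∈ _root_.reflect A n ↔ 1 ∈ A := by rw [mem_reflect, sub_sub_cancel]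
  by_cases h1 : 1 ∈ A
  · by_cases h2 : n - 1 ∈ A
    · exact Or.inl (h.isBiAP_of_one_mem_of_pred_top_mem h1 h2 hs)
    · exact Or.inr (Or.inl (h.hasFormT_of_one_mem h1 h2))
  by_cases h2 : n - 1 ∈ A
  · exact Or.inr (Or.inr (Or.inl ⟨_, h.reflect.hasFormT_of_one_mem (h1iff.2 h2) (mt h2iff.1 h1),
      hrefl⟩))
  have hl := h.even_or_isLeftMinimal h1 h2 hodd
  have hr := h.reflect.even_or_isLeftMinimal (mt h1iff.1 h2) (mt h2iff.1 h1) hodd'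
  rw [reflect_reflect, sub_sub_cancel] at hr
  rcases hl with hl | ⟨h5, hl⟩
  · rcases hr with hr | ⟨h6, hr⟩
    · exfalso
      obtain ⟨o, ho, ho'⟩ := hodd
      have h3 := h.normal.nonneg o ho
      have h4 := h.normal.le_top o ho
      rcases le_total o r with h5 | h5
      · have := (hl o h3 h5).1 ho
        omega
      · have := (hr (n - o) (by omega) (by omega)).1 (by rwa [mem_reflect, sub_sub_cancel])
        have := h.even_top
        omega
    · exact Or.inr (Or.inl (h.hasFormT_of_even_left h2 h6 hl hr))
  · rcases hr with hr | ⟨h6, hr⟩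
    · exact Or.inr (Or.inr (Or.inl ⟨_, h.reflect.hasFormT_of_even_left (mt h2iff.1 h1)
        (by omega) hr hl, hrefl⟩))
    · have hC := hl.reflect n
      rw [show n - (n - 1) = 1 by ring, show n - (n - r + 1) = r - 1 by ring] at hC
      have hD := hr
      rw [show r + 1 = r - 1 + 2 by ring] at hD
      -- u = r - 1: the hole r separates C ⊆ [1, r - 1] from D ⊆ [r + 1, n - 1].
      refine Or.inr (Or.inr (Or.inr ⟨r - 1, by omega, by omega, _, _, hC, hD, ?_⟩))
      ext x
      simp only [Finset.mem_union, mem_reflect, Finset.mem_filter, Finset.mem_singleton,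
        sub_sub_cancel]
      constructor
      · intro hx
        have h7 := h.normal.nonneg x hx
        have h8 := h.normal.le_top x hx
        have h9 := h.ne_of_mem hx
        by_cases h10 : x = 0
        · exact Or.inl (Or.inl (Or.inl h10))
        by_cases h11 : x = n
        · exact Or.inr h11
        rcases lt_or_gt_of_ne h9 with h12 | h12
        · exact Or.inl (Or.inl (Or.inr ⟨hx, by omega, by omega⟩))
        · exact Or.inl (Or.inr ⟨hx, by omega, by omega⟩)
      · rintro (((rfl | hx) | hx) | rfl)
        · exact h.normal.zero_mem
        · exact hx.1
        · exact hx.1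
        · exact h.normal.top_mem

end IsCritical

/-! ### The isoperimetric method in finite abelian groups -/

/-- The elements of a subgroup of a finite group. -/
noncomputable def subgroupFinset {G : Type*} [AddCommGroup G] [Finite G] (H : AddSubgroup G) :
    Finset G :=
  (H : Set G).toFinite.toFinset

theorem mem_subgroupFinset {G : Type*} [AddCommGroup G] [Finite G] {H : AddSubgroup G} {x : G} :
    x ∈ subgroupFinset H ↔ x ∈ H := by
  simp [subgroupFinset]

section Isoperimetric

variable {G : Type*} [AddCommGroup G] [Finite G] [DecidableEq G]

theorem subgroupFinset_add_self (H : AddSubgroup G) :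
    subgroupFinset H + subgroupFinset H = subgroupFinset H := by
  ext x
  simp only [Finset.mem_add, mem_subgroupFinset]
  exact ⟨fun ⟨a, ha, b, hb, h⟩ => h ▸ H.add_mem ha hb, fun h => ⟨x, h, 0, H.zero_mem, add_zero x⟩⟩

theorem subgroupFinset_nonempty (H : AddSubgroup G) : (subgroupFinset H).Nonempty :=
  ⟨0, mem_subgroupFinset.2 H.zero_mem⟩

/-- Atoms of the isoperimetric problem with threshold `j` in a subgroup: they minimise
`|X + B| - |X|`, and a translate of an atom `Q` is equal to `Q` or meets it in fewer than `j`
points. -/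
theorem exists_atom (L : AddSubgroup G) {B X₀ : Finset G} {j : ℕ} (hj : 1 ≤ j)
    (hB : B ⊆ subgroupFinset L) (hX₀ : X₀ ⊆ subgroupFinset L) (hX₀j : j ≤ X₀.card)
    (hX₀B : (X₀ + B).card + j ≤ (subgroupFinset L).card) :
    ∃ Q : Finset G, 0 ∈ Q ∧ Q ⊆ subgroupFinset L ∧ j ≤ Q.card ∧
      (Q + B).card + j ≤ (subgroupFinset L).card ∧
      (Q + B).card + X₀.card ≤ (X₀ + B).card + Q.card ∧
      ∀ g, j ≤ (Q ∩ ({g} + Q)).card → {g} + Q = Q := by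
  set S := (subgroupFinset L).powerset.filter
    (fun X => j ≤ X.card ∧ (X + B).card + j ≤ (subgroupFinset L).card) with hS
  have hmem : ∀ X, X ∈ S ↔ X ⊆ subgroupFinset L ∧ j ≤ X.card ∧
      (X + B).card + j ≤ (subgroupFinset L).card := fun X => by
    rw [hS, Finset.mem_filter, Finset.mem_powerset]
  obtain ⟨Q₁, hQ₁, hmin₁⟩ := S.exists_min_image (fun X => ((X + B).card : ℤ) - X.card)
    ⟨X₀, (hmem X₀).2 ⟨hX₀, hX₀j, hX₀B⟩⟩
  obtain ⟨Q, hQ, hmin⟩ := (S.filter fun X => ((X + B).card : ℤ) - X.card =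
    (Q₁ + B).card - Q₁.card).exists_min_image Finset.card ⟨Q₁, Finset.mem_filter.2 ⟨hQ₁, rfl⟩⟩
  obtain ⟨hQS, hQκ⟩ := Finset.mem_filter.1 hQ
  have hle : ∀ X ∈ S, ((Q + B).card : ℤ) - Q.card ≤ (X + B).card - X.card := fun X hX =>
    hQκ ▸ hmin₁ X hX
  have hsize : ∀ X ∈ S, ((X + B).card : ℤ) - X.card ≤ (Q + B).card - Q.card → Q.card ≤ X.card :=
    fun X hX h => hmin X (Finset.mem_filter.2 ⟨hX, le_antisymm (h.trans hQκ.le) (hmin₁ X hX)⟩)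
  obtain ⟨hQL, hQj, hQB⟩ := (hmem Q).1 hQS
  have hQBL : Q + B ⊆ subgroupFinset L := by
    rw [← subgroupFinset_add_self]
    exact Finset.add_subset_add hQL hB
  -- Duality: Z + B avoids -Q, so Z is admissible and its value |Z + B| - |Z| is no larger than that
  -- of Q. Minimality of |Q| gives |Q| ≤ |Z|.
  have hdual : Q.card + (Q + B).card ≤ (subgroupFinset L).card := by
    set Z := -(subgroupFinset L \ (Q + B)) with hZ
    have hZc : Z.card + (Q + B).card = (subgroupFinset L).card := by
      rw [hZ, Finset.card_neg, Finset.card_sdiff_add_card_eq_card hQBL]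
    have hZL : Z ⊆ subgroupFinset L := by
      intro z hz
      have := (Finset.mem_sdiff.1 (Finset.mem_neg'.1 hz)).1
      rw [mem_subgroupFinset] at this ⊢
      simpa using this
    have hZB : (Z + B).card + Q.card ≤ (subgroupFinset L).card := by
      rw [← Finset.card_neg (s := Q), ← Finset.card_union_of_disjoint]
      · apply Finset.card_le_card
        apply Finset.union_subset
        · rw [← subgroupFinset_add_self]
          exact Finset.add_subset_add hZL hB
        · intro z hz
          have := hQL (Finset.mem_neg'.1 hz)
          rw [mem_subgroupFinset] at this ⊢
          simpa using this
      · rw [Finset.disjoint_left]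
        intro x hx hxQ
        obtain ⟨z, hz, b, hb, rfl⟩ := Finset.mem_add.1 hx
        refine (Finset.mem_sdiff.1 (Finset.mem_neg'.1 hz)).2 ?_
        exact Finset.mem_add.2 ⟨_, Finset.mem_neg'.1 hxQ, b, hb, by abel⟩
    have hZS : Z ∈ S := (hmem Z).2 ⟨hZL, by omega, by omega⟩
    have := hsize Z hZS (by omega)
    omega
  have hatom : ∀ g, j ≤ (Q ∩ ({g} + Q)).card → {g} + Q = Q := by
    intro g hg
    set Q' := {g} + Q with hQ'
    have hc' : Q'.card = Q.card := Finset.card_singleton_add _ _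
    have hcB' : (Q' + B).card = (Q + B).card := by
      rw [hQ', add_assoc]
      exact Finset.card_singleton_add _ _
    have hgL : g ∈ L := by
      obtain ⟨x, hx⟩ := Finset.card_pos.1 (hj.trans hg)
      obtain ⟨hx1, hx2⟩ := Finset.mem_inter.1 hx
      rw [hQ', Finset.singleton_add, Finset.mem_vadd_finset] at hx2
      obtain ⟨y, hy, rfl⟩ := hx2
      have h1 := mem_subgroupFinset.1 (hQL hx1)
      have h2 := mem_subgroupFinset.1 (hQL hy)
      have h3 := L.sub_mem h1 h2
      simpa using h3
    have hQ'L : Q' ⊆ subgroupFinset L := by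
      rw [← subgroupFinset_add_self]
      exact Finset.add_subset_add (Finset.singleton_subset_iff.2 (mem_subgroupFinset.2 hgL)) hQL
    by_contra hne
    -- The value |X + B| - |X| is submodular. The intersection is admissible and smaller than Q, so
    -- its value is strictly larger. The union then has a strictly smaller value, and `hdual` keeps
    -- it admissible: a contradiction.
    have hI : Q ∩ Q' ∈ S := by
      refine (hmem _).2 ⟨Finset.inter_subset_left.trans hQL, hg, ?_⟩
      have := Finset.card_le_card (Finset.add_subset_add_right (t := B)
        (Finset.inter_subset_left : Q ∩ Q' ⊆ Q))
      omega
    have h1 : (Q ∩ Q').card < Q.card := by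
      refine Finset.card_lt_card (Finset.ssubset_iff_subset_ne.2
        ⟨Finset.inter_subset_left, fun h => hne ?_⟩)
      exact (Finset.eq_of_subset_of_card_le (Finset.inter_eq_left.1 h) hc'.le).symm
    have h2 : ((Q + B).card : ℤ) - Q.card < ((Q ∩ Q') + B).card - (Q ∩ Q').card := by
      by_contra h3
      have := hsize _ hI (not_lt.1 h3)
      omega
    have h3 := Finset.card_union_add_card_inter Q Q'
    have h4 := Finset.card_union_add_card_inter (Q + B) (Q' + B)
    have h5 := Finset.card_le_card (Finset.inter_add_subset (s₁ := Q) (s₂ := Q') (t := B))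
    rw [← Finset.union_add] at h4
    have hU : Q ∪ Q' ∈ S := by
      refine (hmem _).2 ⟨Finset.union_subset hQL hQ'L, ?_, by omega⟩
      exact hQj.trans (Finset.card_le_card Finset.subset_union_left)
    have := hle _ hU
    omega
  obtain ⟨q, hq⟩ := Finset.card_pos.1 (hj.trans hQj)
  have hqL := mem_subgroupFinset.1 (hQL hq)
  have hcard : ∀ Y : Finset G, ({-q} + Y).card = Y.card := fun Y => Finset.card_singleton_add _ _
  refine ⟨{-q} + Q, ?_, ?_, ?_, ?_, ?_, ?_⟩
  · exact Finset.mem_add.2 ⟨-q, Finset.mem_singleton_self _, q, hq, neg_add_cancel q⟩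
  · rw [← subgroupFinset_add_self]
    exact Finset.add_subset_add (Finset.singleton_subset_iff.2
      (mem_subgroupFinset.2 (L.neg_mem hqL))) hQL
  · rwa [hcard]
  · rwa [add_assoc, hcard]
  · rw [add_assoc, hcard, hcard]
    have := hle X₀ ((hmem X₀).2 ⟨hX₀, hX₀j, hX₀B⟩)
    omega
  · intro g hg
    have h1 : {g} + ({-q} + Q) = {-q} + ({g} + Q) := by
      rw [← add_assoc, ← add_assoc, add_comm ({g} : Finset G)]
    rw [h1] at hg ⊢
    rw [hatom g]
    rwa [Finset.singleton_add, Finset.singleton_add, ← Finset.vadd_finset_inter,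
      Finset.card_vadd_finset] at hg

/-- A set that contains `0` and equals each of its translates by its own elements is a subgroup. -/
theorem exists_subgroup_of_translates {Q : Finset G} (h0 : 0 ∈ Q) (h : ∀ g ∈ Q, {g} + Q = Q) :
    ∃ K : AddSubgroup G, subgroupFinset K = Q := by
  have hadd : ∀ a ∈ Q, ∀ b ∈ Q, a + b ∈ Q := fun a ha b hb => by
    rw [← h a ha]
    exact Finset.add_mem_add (Finset.mem_singleton_self a) hb
  have hneg : ∀ a ∈ Q, -a ∈ Q := fun a ha => by
    have h1 : (0 : G) ∈ {a} + Q := by rw [h a ha]; exact h0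
    rw [Finset.singleton_add, Finset.mem_vadd_finset] at h1
    obtain ⟨y, hy, hy'⟩ := h1
    rw [vadd_eq_add, add_comm] at hy'
    rw [← eq_neg_of_add_eq_zero_left hy']
    exact hy
  refine ⟨⟨⟨⟨Q, fun {a b} ha hb => hadd a ha b hb⟩, h0⟩, fun {a} ha => hneg a ha⟩, ?_⟩
  ext x
  rw [mem_subgroupFinset]
  rfl

theorem card_subgroupFinset_bot : (subgroupFinset (⊥ : AddSubgroup G)).card = 1 := by
  rw [Finset.card_eq_one]
  exact ⟨0, by ext x; rw [mem_subgroupFinset]; simp⟩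

/-- A weak form of Mann's theorem. -/
theorem exists_subgroup_of_card_add_lt (L : AddSubgroup G) {B X : Finset G}
    (hB : B ⊆ subgroupFinset L) (hX : X ⊆ subgroupFinset L) (hX0 : X.Nonempty) (hB0 : B.Nonempty)
    (h1 : (X + B).card < (subgroupFinset L).card) (h2 : (X + B).card + 2 ≤ X.card + B.card) :
    ∃ K : AddSubgroup G, K ≠ ⊥ ∧ K ≤ L ∧ K ≠ L ∧
      (subgroupFinset K + B).card + 2 ≤ (subgroupFinset K).card + B.card := by
  -- With threshold 1, a translate of the atom by one of its elements meets it, since 0 ∈ Q. So the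
  -- atom is a subgroup.
  obtain ⟨Q, hQ0, hQL, -, hQB, hQX, hQ⟩ := exists_atom L le_rfl hB hX hX0.card_pos h1
  obtain ⟨K, rfl⟩ := exists_subgroup_of_translates hQ0 fun g hg => hQ g (by
    refine Finset.card_pos.2 ⟨g, Finset.mem_inter.2 ⟨hg, ?_⟩⟩
    exact Finset.mem_add.2 ⟨g, Finset.mem_singleton_self g, 0, hQ0, add_zero g⟩)
  have h3 := hX0.card_pos
  refine ⟨K, ?_, ?_, ?_, by omega⟩
  · rintro rfl
    have h4 : subgroupFinset (⊥ : AddSubgroup G) = {0} := by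
      ext x; rw [mem_subgroupFinset]; simp
    rw [h4, Finset.card_singleton_add, Finset.card_singleton] at hQX
    omega
  · intro x hx
    exact mem_subgroupFinset.1 (hQL (mem_subgroupFinset.2 hx))
  · rintro rfl
    have h4 := Finset.card_le_card_add_right (s := subgroupFinset K) hB0
    omega

end Isoperimetric

/-- If the translates of `Q` by non-zero elements meet `Q` in at most one point, then `Q` has
large sumsets. -/
theorem card_add_card_le_of_translates {G : Type*} [AddCommGroup G] [DecidableEq G]
    {P Q : Finset G} (hP : 2 ≤ P.card) (hPQ : P.card ≤ Q.card)
    (hQ3 : 3 ≤ Q.card) (hQ : ∀ g, g ≠ 0 → (Q ∩ ({g} + Q)).card ≤ 1) :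
    P.card + Q.card ≤ (P + Q).card := by
  have hinter : ∀ x y, x ≠ y → (({x} + Q) ∩ ({y} + Q)).card ≤ 1 := by
    intro x y hxy
    have h1 := hQ (y - x) (sub_ne_zero.2 hxy.symm)
    have h2 : ({x} + Q) ∩ ({y} + Q) = {x} + (Q ∩ ({y - x} + Q)) := by
      rw [Finset.singleton_add, Finset.singleton_add, Finset.singleton_add, Finset.singleton_add,
        Finset.vadd_finset_inter, vadd_vadd, add_sub_cancel]
    rwa [h2, Finset.card_singleton_add]
  have hone : ∀ (P : Finset G) (x : G), x ∉ P → (({x} + Q) ∩ (P + Q)).card ≤ P.card := by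
    intro P
    induction P using Finset.induction_on with
    | empty => simp
    | insert y P hy ih =>
      intro x hx
      rw [Finset.mem_insert, not_or] at hx
      rw [Finset.card_insert_of_notMem hy, Finset.insert_eq, Finset.union_add,
        Finset.inter_union_distrib_left]
      refine (Finset.card_union_le _ _).trans ?_
      have := ih x hx.2
      have := hinter x y hx.1
      omega
  induction P using Finset.induction_on with
  | empty => simp at hP
  | insert x P hx ih =>
    rw [Finset.card_insert_of_notMem hx] at hP hPQ ⊢
    have h1 := Finset.card_union_add_card_inter ({x} + Q) (P + Q)
    rw [← Finset.union_add, ← Finset.insert_eq, Finset.card_singleton_add] at h1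
    -- The new translate adds at least |Q| - |P| ≥ 1 points. The induction starts with two
    -- translates: 2|Q| - 1 ≥ |Q| + 2.
    have h2 := hone P x hx
    by_cases h3 : P.card = 1
    · obtain ⟨y, rfl⟩ := Finset.card_eq_one.1 h3
      rw [Finset.card_singleton_add] at h1
      omega
    · have := ih (by omega) (by omega)
      omega

/-- If `B` is closed under adding the elements of `Q`, it is closed under adding those of the
subgroup generated by `Q`. -/
theorem add_mem_of_mem_closure {G : Type*} [AddCommGroup G] [DecidableEq G]
    {B Q : Finset G} (h : B + Q ⊆ B) {b x : G} (hb : b ∈ B)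
    (hx : x ∈ AddSubgroup.closure (Q : Set G)) : b + x ∈ B := by
  have h1 : AddSubgroup.closure (Q : Set G) ≤ AddAction.stabilizer G B := by
    rw [AddSubgroup.closure_le]
    intro q hq
    rw [SetLike.mem_coe, AddAction.mem_stabilizer_iff]
    refine Finset.eq_of_subset_of_card_le ?_ (Finset.card_vadd_finset _ _).ge
    rw [← Finset.singleton_add, add_comm]
    exact (Finset.add_subset_add_left (Finset.singleton_subset_iff.2 hq)).trans h
  have h2 := AddAction.mem_stabilizer_iff.1 (h1 hx)
  rw [← h2, add_comm]
  exact Finset.vadd_mem_vadd_finset hb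

section Isoperimetric

variable {G : Type*} [AddCommGroup G] [Finite G] [DecidableEq G]

/-- An atom with threshold `2` is a subgroup or has small intersections with its translates. -/
theorem exists_subgroup_or_translates {Q : Finset G} (h0 : 0 ∈ Q)
    (h : ∀ g, 2 ≤ (Q ∩ ({g} + Q)).card → {g} + Q = Q) :
    (∃ K : AddSubgroup G, subgroupFinset K = Q) ∨
      ∀ g, g ≠ 0 → (Q ∩ ({g} + Q)).card ≤ 1 := by
  by_cases hs : ∃ t, t ≠ 0 ∧ {t} + Q = Q
  · obtain ⟨t, ht0, ht⟩ := hs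
    -- A non-zero period t puts both g and t + g into the intersection of Q with g + Q, for each g ∈
    -- Q.
    refine Or.inl (exists_subgroup_of_translates h0 fun g hg => h g ?_)
    have h1 : ({g, t + g} : Finset G) ⊆ Q ∩ ({g} + Q) := by
      intro x hx
      have htQ : t ∈ Q := by
        rw [← ht]
        exact Finset.mem_add.2 ⟨t, Finset.mem_singleton_self t, 0, h0, add_zero t⟩
      rw [Finset.mem_insert, Finset.mem_singleton] at hx
      rw [Finset.mem_inter]
      rcases hx with rfl | rfl
      · exact ⟨hg, Finset.mem_add.2 ⟨_, Finset.mem_singleton_self _, 0, h0, add_zero _⟩⟩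
      · refine ⟨?_, Finset.mem_add.2 ⟨_, Finset.mem_singleton_self _, t, htQ, add_comm _ _⟩⟩
        rw [← ht]
        exact Finset.add_mem_add (Finset.mem_singleton_self t) hg
    refine le_trans ?_ (Finset.card_le_card h1)
    rw [Finset.card_pair]
    simpa using ht0
  · push Not at hs
    refine Or.inr fun g hg => ?_
    by_contra h1
    exact hs g hg (h g (by omega))

theorem le_card_subgroupFinset_add (K : AddSubgroup G) {B : Finset G} {b : G} (h0 : 0 ∈ B)
    (hb : b ∈ B) (hbK : b ∉ K) :
    2 * (subgroupFinset K).card ≤ (subgroupFinset K + B).card := by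
  have h1 : Disjoint (subgroupFinset K) ({b} + subgroupFinset K) := by
    rw [Finset.disjoint_left]
    intro x hx hx'
    rw [Finset.singleton_add, Finset.mem_vadd_finset] at hx'
    obtain ⟨y, hy, rfl⟩ := hx'
    rw [mem_subgroupFinset] at hx hy
    exact hbK (by simpa using K.sub_mem hx hy)
  have h2 : subgroupFinset K ∪ ({b} + subgroupFinset K) ⊆ subgroupFinset K + B := by
    apply Finset.union_subset
    · intro x hx
      exact Finset.mem_add.2 ⟨x, hx, 0, h0, add_zero x⟩
    · rw [add_comm]
      exact Finset.add_subset_add_left (Finset.singleton_subset_iff.2 hb)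
  have h3 := Finset.card_le_card h2
  rw [Finset.card_union_of_disjoint h1, Finset.card_singleton_add] at h3
  omega

/-- In the subgroup generated by a set with small intersections of translates, sumsets with that set
are large. -/
theorem card_add_le_or_eq_of_translates {X Q : Finset G} {L : AddSubgroup G}
    (hL : L = AddSubgroup.closure (Q : Set G)) (h0 : 0 ∈ Q) (hQ3 : 3 ≤ Q.card)
    (hQ : ∀ g, g ≠ 0 → (Q ∩ ({g} + Q)).card ≤ 1) (hX : X ⊆ subgroupFinset L) (hX0 : X.Nonempty) :
    X + Q = subgroupFinset L ∨ X.card + Q.card ≤ (X + Q).card + 1 := by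
  by_contra! hcon
  obtain ⟨h1, h2⟩ := hcon
  have hQL : Q ⊆ subgroupFinset L := by
    intro q hq
    rw [mem_subgroupFinset, hL]
    exact AddSubgroup.subset_closure hq
  have h3 : (X + Q).card < (subgroupFinset L).card := by
    refine Finset.card_lt_card (Finset.ssubset_iff_subset_ne.2 ⟨?_, h1⟩)
    rw [← subgroupFinset_add_self]
    exact Finset.add_subset_add hX hQL
  obtain ⟨K, hK0, hKL, hKne, hK⟩ :=
    exists_subgroup_of_card_add_lt L hQL hX hX0 ⟨0, h0⟩ h3 (by omega)
  have hK2 : 2 ≤ (subgroupFinset K).card := by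
    obtain ⟨⟨x, hx⟩, hx0⟩ := AddSubgroup.ne_bot_iff_exists_ne_zero.1 hK0
    replace hx0 : x ≠ 0 := fun h5 => hx0 (Subtype.ext h5)
    refine Finset.one_lt_card.2 ⟨x, mem_subgroupFinset.2 hx, 0, mem_subgroupFinset.2 K.zero_mem, hx0⟩
  -- If |K| ≤ |Q|, then K + Q is too large by the translate property. If |K| > |Q|, an element of Q
  -- outside K would give two cosets in K + Q, so Q ⊆ K and K = L.
  by_cases h4 : (subgroupFinset K).card ≤ Q.card
  · have := card_add_card_le_of_translates hK2 h4 hQ3 hQ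
    omega
  · refine hKne (le_antisymm hKL ?_)
    rw [hL, AddSubgroup.closure_le]
    intro q hq
    by_contra hqK
    have := le_card_subgroupFinset_add K h0 hq hqK
    omega

/-- A set with doubling less than `2|B|` is nearly invariant under a translation or a subgroup. -/
theorem exists_translation_or_subgroup {B : Finset G} (hB2 : 2 ≤ B.card)
    (h1 : (B + B).card + 1 ≤ 2 * B.card) (h2 : (B + B).card + 2 ≤ Nat.card G) :
    (∃ q, q ≠ 0 ∧ (B + {0, q}).card ≤ B.card + 1) ∨
      ∃ H : AddSubgroup G, H ≠ ⊥ ∧ H ≠ ⊤ ∧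
        (subgroupFinset H + B).card + 1 ≤ (subgroupFinset H).card + B.card := by
  have htop : (subgroupFinset (⊤ : AddSubgroup G)).card = Nat.card G := by
    rw [subgroupFinset, ← Set.ncard_eq_toFinset_card]
    simp
  have hsub : ∀ X : Finset G, X ⊆ subgroupFinset ⊤ := fun X x _ =>
    mem_subgroupFinset.2 (AddSubgroup.mem_top x)
  -- Comparing the 2-atom with B itself gives |Q + B| ≤ |Q| + |B| - 1. A two-element atom is the
  -- translation, and a subgroup atom is H.
  obtain ⟨Q, hQ0, -, hQ2, hQB, hQX, hQ⟩ := exists_atom ⊤ (j := 2) (by norm_num) (hsub B) (hsub B)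
    hB2 (by rw [htop]; exact h2)
  rw [htop] at hQB
  have hB0 : B.Nonempty := Finset.card_pos.1 (by omega)
  have hbot : ∀ K : AddSubgroup G, 2 ≤ (subgroupFinset K).card → K ≠ ⊥ := by
    rintro K hK rfl
    rw [card_subgroupFinset_bot] at hK
    omega
  have hnetop : ∀ (K : AddSubgroup G) (X : Finset G), X.Nonempty →
      (subgroupFinset K + X).card + 2 ≤ Nat.card G → K ≠ ⊤ := by
    rintro K X hX hK rfl
    have := Finset.card_le_card_add_right (s := subgroupFinset (⊤ : AddSubgroup G)) hX
    omega
  by_cases hQc : Q.card = 2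
  · left
    obtain ⟨x, y, hxy, hQxy⟩ := Finset.card_eq_two.1 hQc
    rw [hQxy, Finset.mem_insert, Finset.mem_singleton] at hQ0
    rcases hQ0 with rfl | rfl
    · refine ⟨y, hxy.symm, ?_⟩
      rw [← hQxy, add_comm]
      omega
    · refine ⟨x, hxy, ?_⟩
      rw [Finset.pair_comm, ← hQxy, add_comm]
      omega
  rcases exists_subgroup_or_translates hQ0 hQ with ⟨K, rfl⟩ | hQt
  · exact Or.inr ⟨K, hbot K hQ2, hnetop K B hB0 hQB, by omega⟩
  have hsmall : ∀ K : AddSubgroup G, (subgroupFinset K + Q).card + 1 ≤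
      (subgroupFinset K).card + Q.card → Q.card < (subgroupFinset K).card →
      AddSubgroup.closure (Q : Set G) ≤ K := by
    intro K hK hKQ
    rw [AddSubgroup.closure_le]
    intro q hq
    by_contra hqK
    have := le_card_subgroupFinset_add K hQ0 hq hqK
    omega
  by_cases hL : AddSubgroup.closure (Q : Set G) = ⊤
  · exfalso
    -- If Q generates the group, take a 2-atom R for Q, so that |R + Q| ≤ |R| + |Q| - 1. The smaller
    -- of Q and R plays the part of P in `card_add_card_le_of_translates`, unless R is a subgroup
    -- larger than Q; then R contains Q and is the whole group.
    obtain ⟨R, hR0, -, hR2, hRQ, hRX, hR⟩ := exists_atom ⊤ (j := 2) (by norm_num) (hsub Q) (hsub B)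
      hB2 (by rw [htop, add_comm B]; exact hQB)
    rw [htop] at hRQ
    rw [add_comm B] at hRX
    by_cases h3 : R.card ≤ Q.card
    · have := card_add_card_le_of_translates hR2 h3 (by omega) hQt
      omega
    rcases exists_subgroup_or_translates hR0 hR with ⟨K, rfl⟩ | hRt
    · refine hnetop K Q ⟨0, hQ0⟩ hRQ (top_le_iff.1 ?_)
      rw [← hL]
      exact hsmall K (by omega) (by omega)
    · have := card_add_card_le_of_translates hQ2 (by omega) (by omega) hRt
      rw [add_comm Q] at this
      omega
  · right
    set L := AddSubgroup.closure (Q : Set G) with hLdef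
    have hQL : Q ⊆ subgroupFinset L := fun q hq =>
      mem_subgroupFinset.2 (AddSubgroup.subset_closure hq)
    have hQLc := Finset.card_le_card hQL
    refine ⟨L, hbot L (by omega), hL, ?_⟩
    by_cases hfull : ∀ b ∈ B, ∀ l ∈ L, b + l ∈ B + Q
    · have h3 : subgroupFinset L + B ⊆ Q + B := by
        intro x hx
        obtain ⟨l, hl, b, hb, rfl⟩ := Finset.mem_add.1 hx
        rw [add_comm Q, add_comm l]
        exact hfull b hb l (mem_subgroupFinset.1 hl)
      have := Finset.card_le_card h3
      omega
    -- X is the trace of B on a coset of L that B + Q does not fill. There B gains at least |Q| - 1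
    -- elements, the whole permitted growth, so the rest B' of B is invariant under Q and hence
    -- under L.
    · push Not at hfull
      obtain ⟨b₀, hb₀, l₀, hl₀, hbl⟩ := hfull
      set X := (subgroupFinset L).filter fun x => b₀ + x ∈ B with hX
      have hX0 : (0 : G) ∈ X := by
        rw [hX, Finset.mem_filter, mem_subgroupFinset, add_zero]
        exact ⟨L.zero_mem, hb₀⟩
      have hXB : {b₀} + X ⊆ B := by
        intro x hx
        rw [Finset.singleton_add, Finset.mem_vadd_finset] at hx
        obtain ⟨y, hy, rfl⟩ := hx
        exact (Finset.mem_filter.1 hy).2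
      have hXQ : X.card + Q.card ≤ (X + Q).card + 1 := by
        refine (card_add_le_or_eq_of_translates hLdef hQ0 (by omega) hQt (Finset.filter_subset _ _)
          ⟨0, hX0⟩).resolve_left fun h3 => hbl ?_
        have h4 : l₀ ∈ X + Q := h3 ▸ mem_subgroupFinset.2 hl₀
        obtain ⟨x, hx, q, hq, rfl⟩ := Finset.mem_add.1 h4
        rw [← add_assoc]
        exact Finset.add_mem_add (Finset.mem_filter.1 hx).2 hq
      set B' := B \ ({b₀} + X) with hB'
      have hcB' : B'.card + X.card = B.card := by
        rw [hB', ← Finset.card_singleton_add b₀ X]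
        exact Finset.card_sdiff_add_card_eq_card hXB
      have hcoset : ∀ b ∈ B', b - b₀ ∉ L := by
        intro b hb hbL
        obtain ⟨hb1, hb2⟩ := Finset.mem_sdiff.1 hb
        refine hb2 (Finset.mem_add.2 ⟨b₀, Finset.mem_singleton_self _, b - b₀, ?_, by abel⟩)
        rw [hX, Finset.mem_filter, mem_subgroupFinset]
        exact ⟨hbL, by simpa using hb1⟩
      have hdisj : Disjoint (B' + Q) ({b₀} + (X + Q)) := by
        rw [Finset.disjoint_left]
        intro y hy hy'
        obtain ⟨b, hb, q, hq, rfl⟩ := Finset.mem_add.1 hy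
        rw [Finset.singleton_add, Finset.mem_vadd_finset] at hy'
        obtain ⟨z, hz, hz'⟩ := hy'
        obtain ⟨x, hx, q', hq', rfl⟩ := Finset.mem_add.1 hz
        refine hcoset b hb ?_
        have h3 : b - b₀ = x + q' - q := by
          rw [vadd_eq_add] at hz'
          rw [eq_sub_iff_add_eq, sub_add_eq_add_sub, ← hz']
          abel
        rw [h3]
        exact L.sub_mem (L.add_mem (mem_subgroupFinset.1 (Finset.mem_filter.1 hx).1)
          (AddSubgroup.subset_closure hq')) (AddSubgroup.subset_closure hq)
      have hsubBQ : (B' + Q) ∪ ({b₀} + (X + Q)) ⊆ Q + B := by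
        rw [add_comm Q]
        refine Finset.union_subset (Finset.add_subset_add_right Finset.sdiff_subset) ?_
        rw [← add_assoc]
        exact Finset.add_subset_add_right hXB
      have h3 := Finset.card_le_card hsubBQ
      rw [Finset.card_union_of_disjoint hdisj, Finset.card_singleton_add] at h3
      have h4 : B' ⊆ B' + Q := fun b hb => Finset.mem_add.2 ⟨b, hb, 0, hQ0, add_zero b⟩
      have h5 : B' + Q = B' := (Finset.eq_of_subset_of_card_le h4 (by omega)).symm
      have h6 : subgroupFinset L + B ⊆ B' ∪ ({b₀} + subgroupFinset L) := by
        intro y hy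
        obtain ⟨l, hl, b, hb, rfl⟩ := Finset.mem_add.1 hy
        rw [mem_subgroupFinset] at hl
        rw [Finset.mem_union]
        by_cases h7 : b ∈ B'
        · left
          rw [add_comm]
          exact add_mem_of_mem_closure h5.subset h7 hl
        · right
          have h8 : b ∈ {b₀} + X := by
            by_contra h8
            exact h7 (Finset.mem_sdiff.2 ⟨hb, h8⟩)
          rw [Finset.singleton_add, Finset.mem_vadd_finset] at h8
          obtain ⟨x, hx, rfl⟩ := h8
          refine Finset.mem_add.2 ⟨b₀, Finset.mem_singleton_self _, l + x, ?_, ?_⟩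
          · rw [mem_subgroupFinset]
            exact L.add_mem hl (mem_subgroupFinset.1 (Finset.mem_filter.1 hx).1)
          · rw [vadd_eq_add]
            abel
      have h7 := (Finset.card_le_card h6).trans (Finset.card_union_le _ _)
      rw [Finset.card_singleton_add] at h7
      have h8 : 1 ≤ X.card := Finset.card_pos.2 ⟨0, hX0⟩
      omega

end Isoperimetric

/-! ### Reduction modulo m and near-periodicity -/

/-- The reduction of a set of integers modulo `m`. -/
def red (A : Finset ℤ) (m : ℕ) : Finset (ZMod m) := A.image fun a : ℤ => (a : ZMod m)

theorem mem_red {A : Finset ℤ} {m : ℕ} {x : ZMod m} : x ∈ red A m ↔ ∃ a ∈ A, (a : ZMod m) = x :=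
  Finset.mem_image

theorem intCast_mem_red {A : Finset ℤ} {m : ℕ} {a : ℤ} (h : a ∈ A) : (a : ZMod m) ∈ red A m :=
  mem_red.2 ⟨a, h, rfl⟩

theorem red_add (A B : Finset ℤ) (m : ℕ) : red (A + B) m = red A m + red B m := by
  ext x
  simp only [mem_red, Finset.mem_add]
  constructor
  · rintro ⟨_, ⟨a, ha, b, hb, rfl⟩, rfl⟩
    exact ⟨a, ⟨a, ha, rfl⟩, b, ⟨b, hb, rfl⟩, by push_cast; rfl⟩
  · rintro ⟨_, ⟨a, ha, rfl⟩, _, ⟨b, hb, rfl⟩, rfl⟩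
    exact ⟨a + b, ⟨a, ha, b, hb, rfl⟩, by push_cast; rfl⟩

theorem card_subgroupFinset {G : Type*} [AddCommGroup G] [Finite G] (K : AddSubgroup G) :
    (subgroupFinset K).card = Nat.card K := by
  rw [subgroupFinset, ← Set.ncard_eq_toFinset_card, ← Nat.card_coe_set_eq]
  rfl

/-- Subgroups of the cyclic group are determined by their index. This turns cosets of K into residue
classes of integers modulo `K.index`. -/
theorem intCast_mem_iff_index_dvd {m : ℕ} [NeZero m] (K : AddSubgroup (ZMod m)) (a : ℤ) :
    (a : ZMod m) ∈ K ↔ (K.index : ℤ) ∣ a := by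
  have hm : Nat.card K * K.index = m := by rw [K.card_mul_index, Nat.card_zmod]
  have hK : 0 < Nat.card K := Nat.card_pos
  constructor
  · intro h
    have h1 : (Nat.card K) • (a : ZMod m) = 0 := by
      have h2 : (Nat.card K) • (⟨(a : ZMod m), h⟩ : K) = 0 := card_nsmul_eq_zero'
      exact congrArg Subtype.val h2
    have h2 : ((Nat.card K * a : ℤ) : ZMod m) = 0 := by
      rw [nsmul_eq_mul] at h1
      push_cast
      exact h1
    rw [ZMod.intCast_zmod_eq_zero_iff_dvd] at h2
    have h3 : ((Nat.card K : ℕ) : ℤ) * K.index ∣ Nat.card K * a := by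
      convert h2 using 1
      exact_mod_cast hm
    exact (mul_dvd_mul_iff_left (by positivity)).1 h3
  · rintro ⟨b, rfl⟩
    have h1 := K.nsmul_index_mem (b : ZMod m)
    rw [nsmul_eq_mul] at h1
    push_cast
    exact h1

theorem card_subgroupFinset_mul_index {m : ℕ} [NeZero m] (K : AddSubgroup (ZMod m)) :
    (subgroupFinset K).card * K.index = m := by
  rw [card_subgroupFinset, K.card_mul_index, Nat.card_zmod]

/-- The sumset of a subgroup of `ℤ/m` and a reduction modulo `m` is a union of classes modulo the
index. -/
theorem card_subgroupFinset_add_red {m : ℕ} [NeZero m] (K : AddSubgroup (ZMod m)) (A : Finset ℤ) :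
    (subgroupFinset K + red A m).card = (subgroupFinset K).card * (red A K.index).card := by
  have hval : ∀ x : ZMod m, (((x.val : ℕ) : ℤ) : ZMod m) = x := fun x => by
    push_cast
    exact ZMod.natCast_zmod_val x
  have hiff : ∀ (x : ZMod m) (a : ℤ), ((x.val : ℤ) : ZMod K.index) = (a : ZMod K.index) ↔
      x - a ∈ K := by
    intro x a
    rw [ZMod.intCast_eq_intCast_iff_dvd_sub, ← neg_sub, dvd_neg, ← intCast_mem_iff_index_dvd]
    push_cast
    rw [ZMod.natCast_zmod_val x]
  rw [Finset.card_eq_sum_card_fiberwise (t := red A K.index)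
    (f := fun x : ZMod m => ((x.val : ℤ) : ZMod K.index))]
  · rw [Finset.sum_const_nat (m := (subgroupFinset K).card), mul_comm]
    intro c hc
    obtain ⟨a, ha, rfl⟩ := mem_red.1 hc
    rw [← Finset.card_singleton_add (a : ZMod m) (subgroupFinset K)]
    congr 1
    ext x
    rw [Finset.mem_filter, hiff, Finset.singleton_add, Finset.mem_vadd_finset]
    constructor
    · rintro ⟨-, h⟩
      exact ⟨x - a, mem_subgroupFinset.2 h, by rw [vadd_eq_add]; ring⟩
    · rintro ⟨y, hy, rfl⟩
      rw [vadd_eq_add]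
      refine ⟨?_, by rw [add_sub_cancel_left]; exact mem_subgroupFinset.1 hy⟩
      rw [add_comm (a : ZMod m)]
      exact Finset.add_mem_add hy (intCast_mem_red ha)
  · intro x hx
    obtain ⟨y, hy, z, hz, rfl⟩ := Finset.mem_add.1 hx
    obtain ⟨a, ha, rfl⟩ := mem_red.1 hz
    refine mem_red.2 ⟨a, ha, ?_⟩
    refine ((hiff _ a).2 ?_).symm
    rw [add_sub_cancel_right]
    exact mem_subgroupFinset.1 hy

/-- `A` is, up to fewer than `N / d` elements, a union of classes modulo `d` when reduced
modulo `N`. -/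
structure IsNearPeriodic (A : Finset ℤ) (N d : ℕ) : Prop where
  dvd : d ∣ N
  one_lt : 1 < d
  lt : d < N
  card_le : (red A d).card * (N / d) + 2 ≤ N / d + A.card

/-- Scaling the defect of the classes modulo d by N / d and adding the defect of A keeps the total
below the size of the larger class. The choice d = N is allowed as a starting point. -/
theorem isNearPeriodic_index {A : Finset ℤ} {N d : ℕ} (hN : 0 < N) [NeZero d] (hd : d ∣ N)
    (hc : (red A d).card * (N / d) + 2 ≤ N / d + A.card) {K : AddSubgroup (ZMod d)} (hK : K ≠ ⊥)
    (hK' : K ≠ ⊤)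
    (h : (subgroupFinset K + red A d).card + 1 ≤ (subgroupFinset K).card + (red A d).card) :
    IsNearPeriodic A N K.index ∧ K.index < d := by
  have h1 := card_subgroupFinset_mul_index K
  have h2 : 1 < K.index := by
    have := K.index_ne_zero_of_finite
    have : K.index ≠ 1 := fun h3 => hK' (AddSubgroup.index_eq_one.1 h3)
    omega
  have h3 : 1 < (subgroupFinset K).card := by
    rw [card_subgroupFinset]
    exact (AddSubgroup.one_lt_card_iff_ne_bot K).2 hK
  have h4 : K.index < d := by nlinarith
  have h5 : K.index ∣ d := ⟨_, by rw [mul_comm, h1]⟩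
  obtain ⟨g, rfl⟩ := hd
  have hd0 : 0 < d := Nat.pos_of_ne_zero (NeZero.ne d)
  have hg : 0 < g := by
    rcases Nat.eq_zero_or_pos g with rfl | h'
    · simp at hN
    · exact h'
  rw [Nat.mul_div_cancel_left _ hd0] at hc
  refine ⟨⟨h5.mul_right g, h2, by nlinarith, ?_⟩, h4⟩
  have h6 : d * g / K.index = (subgroupFinset K).card * g := by
    refine Nat.div_eq_of_eq_mul_left (by omega) ?_
    rw [mul_right_comm, h1]
  rw [h6]
  rw [card_subgroupFinset_add_red] at h
  have h7 := Nat.mul_le_mul_right g h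
  nlinarith

/-- Only one element can be gained, and b + q already is one. -/
theorem add_mem_of_card_add_pair {G : Type*} [AddCommGroup G] [DecidableEq G] {B : Finset G}
    {q b b' : G} (h : (B + {0, q}).card ≤ B.card + 1)
    (hb : b ∈ B) (hbq : b + q ∉ B) (hb' : b' ∈ B) (hne : b' ≠ b) : b' + q ∈ B := by
  by_contra hbq'
  have h1 : insert (b + q) (insert (b' + q) B) ⊆ B + {0, q} := by
    intro x hx
    rw [Finset.mem_insert, Finset.mem_insert] at hx
    rcases hx with rfl | rfl | hx
    · exact Finset.add_mem_add hb (by simp)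
    · exact Finset.add_mem_add hb' (by simp)
    · exact Finset.mem_add.2 ⟨x, hx, 0, by simp, add_zero x⟩
  have h2 := Finset.card_le_card h1
  rw [Finset.card_insert_of_notMem, Finset.card_insert_of_notMem hbq'] at h2
  · omega
  · rw [Finset.mem_insert, not_or]
    exact ⟨fun h3 => hne (add_right_cancel h3).symm, hbq⟩

/-! ### Near-invariance under a translation and progressions -/

section Progression

variable {G : Type*} [AddCommGroup G] [Finite G] [DecidableEq G]

/-- A set that gains at most one element under a translation is nearly invariant under the subgroup
generated by the translation. -/
theorem card_closure_add_le {B : Finset G} {q : G}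
    (h : (B + {0, q}).card ≤ B.card + 1) :
    (subgroupFinset (AddSubgroup.closure {q}) + B).card + 1 ≤
      (subgroupFinset (AddSubgroup.closure {q})).card + B.card := by
  set H := AddSubgroup.closure {q} with hH
  have hq : q ∈ H := AddSubgroup.subset_closure rfl
  have hH' : H = AddSubgroup.closure (({q} : Finset G) : Set G) := by simp [hH]
  have hpos := (subgroupFinset_nonempty H).card_pos
  by_cases hcl : ∀ b ∈ B, b + q ∈ B
  · have h1 : subgroupFinset H + B ⊆ B := by
      intro x hx
      obtain ⟨l, hl, b, hb, rfl⟩ := Finset.mem_add.1 hx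
      rw [add_comm]
      refine add_mem_of_mem_closure (Q := {q}) ?_ hb (by rw [← hH']; exact mem_subgroupFinset.1 hl)
      intro y hy
      obtain ⟨z, hz, w, hw, rfl⟩ := Finset.mem_add.1 hy
      rw [Finset.mem_singleton.1 hw]
      exact hcl z hz
    have := Finset.card_le_card h1
    omega
  · push Not at hcl
    obtain ⟨b₀, hb₀, hbq⟩ := hcl
    have h1 : subgroupFinset H + B ⊆ B ∪ ({b₀} + subgroupFinset H) := by
      intro x hx
      obtain ⟨l, hl, b, hb, rfl⟩ := Finset.mem_add.1 hx
      rw [mem_subgroupFinset] at hl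
      rw [Finset.mem_union]
      by_cases h2 : b - b₀ ∈ H
      · refine Or.inr (Finset.mem_add.2 ⟨b₀, Finset.mem_singleton_self _, l + (b - b₀),
          mem_subgroupFinset.2 (H.add_mem hl h2), by abel⟩)
      · left
        rw [add_comm]
        refine (Finset.mem_filter.1 (add_mem_of_mem_closure (B := B.filter fun b => b - b₀ ∉ subgroupFinset H)
          (Q := {q}) ?_ (Finset.mem_filter.2 ⟨hb, by rwa [mem_subgroupFinset]⟩)
          (by rw [← hH']; exact hl))).1
        intro y hy
        obtain ⟨z, hz, w, hw, rfl⟩ := Finset.mem_add.1 hy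
        rw [Finset.mem_singleton.1 hw]
        obtain ⟨hz1, hz2⟩ := Finset.mem_filter.1 hz
        rw [mem_subgroupFinset] at hz2
        rw [Finset.mem_filter, mem_subgroupFinset]
        refine ⟨add_mem_of_card_add_pair h hb₀ hbq hz1 ?_, fun h3 => hz2 ?_⟩
        · rintro rfl
          exact hz2 (by rw [sub_self]; exact H.zero_mem)
        · have := H.sub_mem h3 hq
          convert this using 1
          abel
    have h2 := Finset.card_union_add_card_inter B ({b₀} + subgroupFinset H)
    have h3 : 1 ≤ (B ∩ ({b₀} + subgroupFinset H)).card :=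
      Finset.card_pos.2 ⟨b₀, Finset.mem_inter.2 ⟨hb₀, Finset.mem_add.2
        ⟨b₀, Finset.mem_singleton_self _, 0, mem_subgroupFinset.2 H.zero_mem, add_zero _⟩⟩⟩
    have h4 := Finset.card_le_card h1
    rw [Finset.card_singleton_add] at h2
    omega

/-- A proper subset that gains at most one element under translation by a generator is a
progression. -/
theorem exists_progression {B : Finset G} {q x₀ : G} (h0 : 0 ∈ B) (hx₀ : x₀ ∉ B)
    (hq : AddSubgroup.closure {q} = ⊤) (h : (B + {0, q}).card ≤ B.card + 1) :
    ∃ u v : ℕ, u + v + 1 = B.card ∧ ((v : ℤ) + 1) • q ∉ B ∧ (-(u : ℤ) - 1) • q ∉ B ∧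
      (∀ i j : ℤ, -(u : ℤ) ≤ i → i ≤ v + 1 → -(u : ℤ) ≤ j → j ≤ v + 1 → i • q = j • q → i = j) ∧
      ∀ x, x ∈ B ↔ ∃ i : ℤ, -(u : ℤ) ≤ i ∧ i ≤ v ∧ i • q = x := by
  -- A non-empty set closed under adding the generator q is the whole group. A subset of B of this
  -- kind would contain x₀.
  have hall : ∀ S : Finset G, (∀ b ∈ S, b + q ∈ S) → S.Nonempty → x₀ ∈ S := by
    rintro S hS ⟨b, hb⟩
    have := add_mem_of_mem_closure (B := S) (Q := {q}) (b := b) (x := x₀ - b) (by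
      intro y hy
      obtain ⟨z, hz, w, hw, rfl⟩ := Finset.mem_add.1 hy
      rw [Finset.mem_singleton.1 hw]
      exact hS z hz) hb (by rw [Finset.coe_singleton, hq]; exact AddSubgroup.mem_top _)
    rwa [add_sub_cancel] at this
  have hex : ∃ m : ℕ, (m : ℤ) • q ∉ B := by
    by_contra! hcon
    classical
    refine hx₀ (Finset.mem_filter.1 (hall (B.filter fun x => ∃ m : ℕ, x = (m : ℤ) • q) ?_
      ⟨0, Finset.mem_filter.2 ⟨h0, 0, by simp⟩⟩)).1
    intro b hb
    obtain ⟨hb, m, rfl⟩ := Finset.mem_filter.1 hb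
    have h1 : (m : ℤ) • q + q = ((m + 1 : ℕ) : ℤ) • q := by
      push_cast
      rw [add_zsmul, one_zsmul]
    rw [h1]
    exact Finset.mem_filter.2 ⟨hcon _, _, rfl⟩
  have hex' : ∃ m : ℕ, (-(m : ℤ)) • q ∉ B := by
    obtain ⟨m, hm⟩ := hex
    -- Modulo the order of q, the coefficient -(ord q - 1) m equals m.
    refine ⟨(addOrderOf q - 1) * m, ?_⟩
    have h1 : 1 ≤ addOrderOf q := addOrderOf_pos q
    convert hm using 2
    rw [← sub_eq_zero, ← sub_smul, Nat.cast_mul, Nat.cast_sub h1,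
      show -(((addOrderOf q : ℕ) - (1 : ℕ) : ℤ) * m) - m = -((m : ℤ) * addOrderOf q) by push_cast; ring,
      neg_zsmul, mul_zsmul, natCast_zsmul, natCast_zsmul, addOrderOf_nsmul_eq_zero, nsmul_zero, neg_zero]
  obtain ⟨v, hv, hvB⟩ : ∃ v : ℕ, ((v : ℤ) + 1) • q ∉ B ∧ ∀ i : ℕ, i ≤ v → (i : ℤ) • q ∈ B := by
    classical
    have h1 : Nat.find hex ≠ 0 := fun h2 => by
      have := Nat.find_spec hex
      rw [h2] at this
      exact this (by simpa using h0)
    refine ⟨Nat.find hex - 1, ?_, fun i hi => not_not.1 (Nat.find_min hex (by omega))⟩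
    have h2 : ((Nat.find hex - 1 : ℕ) : ℤ) + 1 = Nat.find hex := by omega
    rw [h2]
    exact Nat.find_spec hex
  obtain ⟨u, hu, huB⟩ : ∃ u : ℕ, (-(u : ℤ) - 1) • q ∉ B ∧
      ∀ i : ℕ, i ≤ u → (-(i : ℤ)) • q ∈ B := by
    classical
    have h1 : Nat.find hex' ≠ 0 := fun h2 => by
      have := Nat.find_spec hex'
      rw [h2] at this
      exact this (by simpa using h0)
    refine ⟨Nat.find hex' - 1, ?_, fun i hi => not_not.1 (Nat.find_min hex' (by omega))⟩
    have h2 : -((Nat.find hex' - 1 : ℕ) : ℤ) - 1 = -Nat.find hex' := by omega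
    rw [h2]
    exact Nat.find_spec hex'
  have hmem : ∀ i : ℤ, -(u : ℤ) ≤ i → i ≤ v → i • q ∈ B := by
    intro i hi hi'
    rcases le_total 0 i with h1 | h1
    · have := hvB i.toNat (by omega)
      rwa [Int.toNat_of_nonneg h1] at this
    · have := huB (-i).toNat (by omega)
      rwa [Int.toNat_of_nonneg (by omega), neg_neg] at this
  have hinj' : ∀ i j : ℤ, -(u : ℤ) ≤ i → j ≤ v + 1 → i • q = j • q → ¬ i < j := by
    intro i j hi hj hij hlt
    have h1 : (v + 1 - (j - i) : ℤ) • q = (v + 1 : ℤ) • q := by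
      rw [sub_smul, sub_smul, hij, sub_self, sub_zero]
    refine hv ?_
    rw [← h1]
    exact hmem _ (by omega) (by omega)
  have hinj : ∀ i j : ℤ, -(u : ℤ) ≤ i → i ≤ v + 1 → -(u : ℤ) ≤ j → j ≤ v + 1 →
      i • q = j • q → i = j := by
    intro i j hi hi' hj hj' hij
    exact le_antisymm (not_lt.1 (hinj' j i hj hi' hij.symm)) (not_lt.1 (hinj' i j hi hj' hij))
  have hiff : ∀ x, x ∈ B ↔ ∃ i : ℤ, -(u : ℤ) ≤ i ∧ i ≤ v ∧ i • q = x := by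
    intro x
    refine ⟨fun hx => ?_, fun ⟨i, hi, hi', hix⟩ => hix ▸ hmem i hi hi'⟩
    -- The only exit from B under adding q is at v • q, so the elements of B off the progression
    -- form a set closed under adding q.
    by_contra hcon
    classical
    refine hx₀ (Finset.mem_filter.1 (hall (B.filter fun x => ¬ ∃ i : ℤ, -(u : ℤ) ≤ i ∧ i ≤ v ∧
      i • q = x) ?_ ⟨x, Finset.mem_filter.2 ⟨hx, hcon⟩⟩)).1
    intro b hb
    obtain ⟨hb, hbi⟩ := Finset.mem_filter.1 hb
    refine Finset.mem_filter.2 ⟨?_, ?_⟩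
    · refine add_mem_of_card_add_pair h (b := (v : ℤ) • q) (hmem v (by omega) le_rfl) ?_ hb ?_
      · rwa [add_zsmul, one_zsmul] at hv
      · rintro rfl
        exact hbi ⟨v, by omega, le_rfl, rfl⟩
    · rintro ⟨i, hi, hi', hib⟩
      have h1 : (i - 1) • q = b := by
        rw [sub_smul, one_smul, hib, add_sub_cancel_right]
      rcases hi.lt_or_eq with h2 | h2
      · exact hbi ⟨i - 1, by omega, by omega, h1⟩
      · rw [← h2] at h1
        exact hu (h1 ▸ hb)
  refine ⟨u, v, ?_, hv, hu, hinj, hiff⟩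
  have h1 : B = (Finset.Icc (-(u : ℤ)) v).image fun i => i • q := by
    ext x
    rw [hiff, Finset.mem_image]
    simp only [Finset.mem_Icc, and_assoc]
  rw [h1, Finset.card_image_of_injOn, Int.card_Icc]
  · omega
  · intro i hi j hj hij
    rw [Finset.mem_coe, Finset.mem_Icc] at hi hj
    exact hinj i j hi.1 (by omega) hj.1 (by omega) hij

end Progression

/-! ### Lifting from residues modulo n to integers -/

section Reduction

variable {A : Finset ℤ} {N : ℕ}

theorem IsNormal.intCast_mem_red_iff (h : IsNormal A N) {y : ℤ} (h0 : 0 ≤ y) (hy : y < N) :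
    (y : ZMod N) ∈ red A N ↔ y ∈ A := by
  refine ⟨fun hyr => ?_, intCast_mem_red⟩
  obtain ⟨a, ha, hay⟩ := mem_red.1 hyr
  have ha0 := h.nonneg a ha
  have haN := h.le_top a ha
  rw [ZMod.intCast_eq_intCast_iff_dvd_sub] at hay
  obtain ⟨c, hc⟩ := hay
  have hc1 : c < 1 := by nlinarith
  have hc2 : -2 < c := by nlinarith
  obtain rfl | rfl : c = 0 ∨ c = -1 := by omega
  · have : y = a := by omega
    rwa [this]
  · have : y = 0 := by omega
    rw [this]
    exact h.zero_mem

theorem IsNormal.intCast_mem_red_add_iff (h : IsNormal A N) {y : ℤ} (h0 : 0 ≤ y) (hy : y < N) :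
    (y : ZMod N) ∈ red A N + red A N ↔ y ∈ A + A ∨ y + N ∈ A + A := by
  rw [← red_add]
  constructor
  · intro hyr
    obtain ⟨a, ha, hay⟩ := mem_red.1 hyr
    have hab := h.add_mem_bounds ha
    rw [ZMod.intCast_eq_intCast_iff_dvd_sub] at hay
    obtain ⟨c, hc⟩ := hay
    have hc1 : c < 1 := by nlinarith
    have hc2 : -3 < c := by nlinarith
    obtain rfl | rfl | rfl : c = 0 ∨ c = -1 ∨ c = -2 := by omega
    · have : y = a := by omega
      rw [this]
      exact Or.inl ha
    · have : y + N = a := by omega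
      rw [this]
      exact Or.inr ha
    · have : y = 0 := by omega
      rw [this]
      exact Or.inl (h.mem_add_of_mem h.zero_mem)
  · rintro (h1 | h1)
    · exact intCast_mem_red h1
    · have := intCast_mem_red (m := N) h1
      push_cast at this
      rwa [ZMod.natCast_self, add_zero] at this

theorem intCast_injOn_Ico (N : ℕ) : Set.InjOn (fun y : ℤ => (y : ZMod N)) (Set.Ico 0 (N : ℤ)) := by
  intro x hx y hy hxy
  rw [Set.mem_Ico] at hx hy
  simp only [ZMod.intCast_eq_intCast_iff_dvd_sub] at hxy
  obtain ⟨c, hc⟩ := hxy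
  have hc1 : c < 1 := by nlinarith
  have hc2 : -1 < c := by nlinarith
  obtain rfl : c = 0 := by omega
  omega

theorem IsNormal.card_red (h : IsNormal A N) : (red A N).card + 1 = A.card := by
  have h1 : red A N = red (A.erase N) N := by
    ext x
    rw [mem_red, mem_red]
    constructor
    · rintro ⟨a, ha, rfl⟩
      by_cases haN : a = N
      · refine ⟨0, Finset.mem_erase.2 ⟨h.pos.ne, h.zero_mem⟩, ?_⟩
        rw [haN]
        simp
      · exact ⟨a, Finset.mem_erase.2 ⟨haN, ha⟩, rfl⟩
    · rintro ⟨a, ha, rfl⟩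
      exact ⟨a, (Finset.mem_erase.1 ha).2, rfl⟩
  rw [h1, red, Finset.card_image_of_injOn, Finset.card_erase_add_one h.top_mem]
  refine (intCast_injOn_Ico N).mono ?_
  intro x hx
  rw [Finset.mem_coe, Finset.mem_erase] at hx
  have := h.le_top x hx.2
  exact ⟨h.nonneg x hx.2, by omega⟩

theorem IsNormal.card_red_add (h : IsNormal A N) :
    (red A N + red A N).card + (neitherSet A N).card = N := by
  have hN := h.pos
  have : NeZero N := ⟨by omega⟩
  have h1 : (red A N + red A N)ᶜ = red (neitherSet A N) N := by
    ext x
    obtain ⟨y, hy0, hyN, rfl⟩ : ∃ y : ℤ, 0 ≤ y ∧ y < N ∧ (y : ZMod N) = x :=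
      ⟨x.val, by omega, by exact_mod_cast x.val_lt, by push_cast; exact ZMod.natCast_zmod_val x⟩
    rw [Finset.mem_compl, h.intCast_mem_red_add_iff hy0 hyN, mem_red]
    constructor
    · intro h2
      rw [not_or] at h2
      refine ⟨y, ?_, rfl⟩
      rw [neitherSet, Finset.mem_filter, Finset.mem_Ioo]
      have : y ≠ 0 := fun h3 => h2.1 (h3 ▸ h.mem_add_of_mem h.zero_mem)
      exact ⟨⟨by omega, hyN⟩, h2⟩
    · rintro ⟨z, hz, hzy⟩
      rw [neitherSet, Finset.mem_filter, Finset.mem_Ioo] at hz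
      obtain rfl := intCast_injOn_Ico N ⟨hz.1.1.le, hz.1.2⟩ ⟨hy0, hyN⟩ hzy
      exact not_or.2 hz.2
  have h2 : (red (neitherSet A N) N).card = (neitherSet A N).card := by
    refine Finset.card_image_of_injOn ((intCast_injOn_Ico N).mono ?_)
    intro x hx
    rw [Finset.mem_coe, neitherSet, Finset.mem_filter, Finset.mem_Ioo] at hx
    exact ⟨hx.1.1.le, hx.1.2⟩
  rw [← h2, ← h1, Finset.card_add_card_compl, ZMod.card]

/-- As 0 and n have the same residue, |B| = |A| - 1 for the reduction B, and this reads |B + B| +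
|`bothSet`| = 2|B| - 1. -/
theorem IsNormal.card_red_add_add_bothSet (h : IsNormal A N)
    (hs : (A + A).card = 3 * A.card - 3) (h2 : 2 ≤ A.card) :
    (red A N + red A N).card + (bothSet A N).card + 3 = 2 * A.card := by
  have h3 := h.card_add
  have h4 := h.card_red_add
  omega

theorem zsmul_eq_zsmul_of_closure_eq_top [NeZero N] {q : ZMod N}
    (hq : AddSubgroup.closure {q} = ⊤) {i j : ℤ} (h : i • q = j • q) : (N : ℤ) ∣ j - i := by
  have h1 : addOrderOf q = N := by
    rw [← Nat.card_zmultiples, AddSubgroup.zmultiples_eq_closure, hq]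
    simp
  rw [zsmul_eq_zsmul_iff_modEq, h1] at h
  exact h.dvd

theorem eq_of_zsmul_eq_zsmul [NeZero N] {q : ZMod N} (hq : AddSubgroup.closure {q} = ⊤) {i j : ℤ}
    (h : i • q = j • q) (h1 : j - i < N) (h2 : i - j < N) : i = j := by
  obtain ⟨c, hc⟩ := zsmul_eq_zsmul_of_closure_eq_top hq h
  have hc1 : c < 1 := by nlinarith
  have hc2 : -1 < c := by nlinarith
  obtain rfl : c = 0 := by omega
  omega

/-- Here b i represents i • q in [0, n). Comparing (i + 1) + (v - 1) with i + v shows that all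
increments from index 1 on are equal. Each is b 1 or b 1 - n, so the sequence wraps around n never
or always. -/
theorem progression_half {b : ℤ → ℤ} {n u v : ℤ} (hu : 0 ≤ u)
    (hkey : ∀ i j k l, -u ≤ i → i ≤ v → -u ≤ j → j ≤ v → -u ≤ k → k ≤ v → -u ≤ l → l ≤ v →
      i + j = k + l → v < i + j → b i + b j = b k + b l)
    (hstep : ∀ i, b (i + 1) = b i + b 1 ∨ b (i + 1) = b i + b 1 - n) :
    (∀ i, 1 ≤ i → i ≤ v → b i = i * b 1) ∨ ∀ i, 1 ≤ i → i ≤ v → b i = n - i * (n - b 1) := by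
  have hind : ∀ D : ℤ, (2 ≤ v → b v = b (v - 1) + D) → ∀ i, 1 ≤ i → i ≤ v →
      b i = b 1 + (i - 1) * D := by
    intro D hD i hi
    induction i, hi using Int.leInduction with
    | base => intro _; ring
    | succ i hi ih =>
      intro hiv
      have h1 := ih (by omega)
      have h2 := hD (by omega)
      have h3 := hkey (i + 1) (v - 1) i v (by omega) (by omega) (by omega) (by omega) (by omega)
        (by omega) (by omega) (by omega) (by ring) (by omega)
      have h4 : (i + 1 - 1) * D = (i - 1) * D + D := by ring
      linarith
  have h1 := hstep (v - 1)
  rw [sub_add_cancel] at h1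
  rcases h1 with h1 | h1
  · left
    intro i hi hiv
    rw [hind (b 1) (fun _ => h1) i hi hiv]
    ring
  · right
    intro i hi hiv
    rw [hind (b 1 - n) (fun _ => by linarith) i hi hiv]
    ring

/-- If the reduction of `A` modulo `n` is a progression, then `A` is a bi-arithmetic progression. -/
theorem IsNormal.isBiAP_of_progression [NeZero N] (h : IsNormal A N)
    (hs : (A + A).card = 3 * A.card - 3) (h2 : 2 ≤ A.card) (hN : 2 * A.card ≤ N + 2) {q : ZMod N}
    (hq : AddSubgroup.closure {q} = ⊤) {u v : ℕ} (huv : u + v + 1 = (red A N).card)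
    (hiff : ∀ x, x ∈ red A N ↔ ∃ i : ℤ, -(u : ℤ) ≤ i ∧ i ≤ v ∧ i • q = x) : IsBiAP A := by
  have hk := h.card_red
  have hinj : ∀ i j : ℤ, i • q = j • q → j - i < N → i - j < N → i = j := fun i j h3 =>
    eq_of_zsmul_eq_zsmul hq h3
  -- The progression B has 2|B| - 1 distinct sums, which leaves nothing for `bothSet`.
  have hboth : bothSet A N = ∅ := by
    have h3 : ((Finset.Icc (-(2 * u : ℤ)) (2 * v)).image fun i => i • q) ⊆ red A N + red A N := by
      intro x hx
      obtain ⟨i, hi, rfl⟩ := Finset.mem_image.1 hx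
      rw [Finset.mem_Icc] at hi
      obtain ⟨j, k, hj1, hj2, hk1, hk2, rfl⟩ : ∃ j k : ℤ, -(u : ℤ) ≤ j ∧ j ≤ v ∧ -(u : ℤ) ≤ k ∧
          k ≤ v ∧ j + k = i :=
        ⟨i / 2, i - i / 2, by omega, by omega, by omega, by omega, by ring⟩
      rw [add_smul]
      exact Finset.add_mem_add ((hiff _).2 ⟨j, hj1, hj2, rfl⟩) ((hiff _).2 ⟨k, hk1, hk2, rfl⟩)
    have h4 := Finset.card_le_card h3
    rw [Finset.card_image_of_injOn, Int.card_Icc] at h4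
    · have := h.card_red_add_add_bothSet hs h2
      rw [← Finset.card_eq_zero]
      omega
    · intro i hi j hj hij
      rw [Finset.mem_coe, Finset.mem_Icc] at hi hj
      exact hinj i j hij (by omega) (by omega)
  obtain ⟨b, hb⟩ : ∃ b : ℤ → ℤ, ∀ i, b i = ((i • q).val : ℤ) := ⟨_, fun _ => rfl⟩
  have hb0 : ∀ i, 0 ≤ b i := fun i => by rw [hb]; omega
  have hbN : ∀ i, b i < N := fun i => by rw [hb]; exact_mod_cast (i • q).val_lt
  have hbc : ∀ i, (b i : ZMod N) = i • q := fun i => by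
    rw [hb]
    push_cast
    exact ZMod.natCast_zmod_val _
  have hbA : ∀ i, -(u : ℤ) ≤ i → i ≤ v → b i ∈ A := fun i hi hi' => by
    rw [← h.intCast_mem_red_iff (hb0 i) (hbN i), hbc]
    exact (hiff _).2 ⟨i, hi, hi', rfl⟩
  have hAb : ∀ a ∈ A, a = N ∨ ∃ i, -(u : ℤ) ≤ i ∧ i ≤ v ∧ b i = a := by
    intro a ha
    have h3 := h.le_top a ha
    have h4 := h.nonneg a ha
    rcases h3.lt_or_eq with h5 | h5
    · obtain ⟨i, hi, hi', hia⟩ := (hiff _).1 (intCast_mem_red (m := N) ha)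
      refine Or.inr ⟨i, hi, hi', intCast_injOn_Ico N ⟨hb0 i, hbN i⟩ ⟨h4, h5⟩ ?_⟩
      simp only [hbc, hia]
    · exact Or.inl h5
  have hadd : ∀ i j, b i + b j = b (i + j) ∨ b i + b j = b (i + j) + N := by
    intro i j
    have h3 : ((b i + b j : ℤ) : ZMod N) = (b (i + j) : ZMod N) := by
      push_cast
      rw [hbc, hbc, hbc, add_smul]
    rw [ZMod.intCast_eq_intCast_iff_dvd_sub] at h3
    obtain ⟨c, hc⟩ := h3
    have := hb0 i
    have := hb0 j
    have := hb0 (i + j)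
    have := hbN i
    have := hbN j
    have := hbN (i + j)
    have hc1 : c < 1 := by nlinarith
    have hc2 : -2 < c := by nlinarith
    obtain rfl | rfl : c = 0 ∨ c = -1 := by omega
    · left; omega
    · right; omega
  -- If i + j leaves [-u, v], its representative y is a hole, and only one of y, y + N is in 2A. So
  -- all pairs with this index sum have the same integer sum.
  have hkey : ∀ i j k l : ℤ, -(u : ℤ) ≤ i → i ≤ v → -(u : ℤ) ≤ j → j ≤ v → -(u : ℤ) ≤ k → k ≤ v →
      -(u : ℤ) ≤ l → l ≤ v → i + j = k + l → (v < i + j ∨ i + j < -u) →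
      b i + b j = b k + b l := by
    intro i j k l hi hi' hj hj' hk1 hk' hl hl' hij hv
    have hyA : b (i + j) ∉ A := fun hy => by
      have h3 := intCast_mem_red (m := N) hy
      rw [hbc, hiff] at h3
      obtain ⟨m, hm, hm', hmi⟩ := h3
      have := hinj _ _ hmi (by omega) (by omega)
      omega
    have hy0 : b (i + j) ≠ 0 := fun h3 => hyA (h3 ▸ h.zero_mem)
    have hno : ¬ (b (i + j) ∈ A + A ∧ b (i + j) + N ∈ A + A) := by
      rintro ⟨h3, h4⟩
      have h5 : b (i + j) ∈ bothSet A N := by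
        rw [bothSet, Finset.mem_filter, Finset.mem_Ioo]
        have := hb0 (i + j)
        exact ⟨⟨by omega, hbN _⟩, hyA, h3, h4⟩
      rw [hboth] at h5
      exact absurd h5 (Finset.notMem_empty _)
    have h3 := Finset.add_mem_add (hbA i hi hi') (hbA j hj hj')
    have h4 := Finset.add_mem_add (hbA k hk1 hk') (hbA l hl hl')
    have h5 := hadd k l
    rw [← hij] at h5
    rcases hadd i j with h6 | h6 <;> rcases h5 with h5 | h5
    · omega
    · exact absurd ⟨h6 ▸ h3, h5 ▸ h4⟩ hno
    · exact absurd ⟨h5 ▸ h4, h6 ▸ h3⟩ hno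
    · omega
  have hb00 : b 0 = 0 := by rw [hb]; simp
  have hpos : ∀ i, -(u : ℤ) - 1 ≤ i → i ≤ v + 1 → i ≠ 0 → 0 < b i := by
    intro i hi hi' hi0
    refine lt_of_le_of_ne (hb0 i) fun h3 => hi0 ?_
    refine hinj i 0 ?_ (by omega) (by omega)
    rw [← hbc, ← h3]
    simp
  have hneg1 : b (-1) = N - b 1 := by
    have h3 := hadd 1 (-1)
    rw [add_neg_cancel, hb00] at h3
    have := hpos 1 (by omega) (by omega) one_ne_zero
    have := hb0 (-1)
    omega
  have hp := progression_half (b := b) (n := N) (u := u) (v := v) (by omega)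
    (fun i j k l h3 h4 h5 h6 h7 h8 h9 h10 h11 h12 =>
      hkey i j k l h3 h4 h5 h6 h7 h8 h9 h10 h11 (Or.inl h12))
    (fun i => by have := hadd i 1; omega)
  have hm := progression_half (b := fun i => b (-i)) (n := N) (u := v) (v := u) (by omega)
    (fun i j k l h3 h4 h5 h6 h7 h8 h9 h10 h11 h12 =>
      hkey (-i) (-j) (-k) (-l) (by omega) (by omega) (by omega) (by omega) (by omega) (by omega)
        (by omega) (by omega) (by omega) (Or.inr (by omega)))
    (fun i => by
      have := hadd (-i) (-1)
      rw [show -(i + 1) = -i + -1 by ring]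
      omega)
  simp only [hneg1, sub_sub_cancel] at hm
  -- The two halves must wrap compatibly: otherwise b 2 and b (-2) add up to 2N or to 0, both
  -- impossible. A half of length at most 1 satisfies either description.
  have hfin : ((∀ i, 1 ≤ i → i ≤ (v : ℤ) → b i = i * b 1) ∧
      ∀ i, 1 ≤ i → i ≤ (u : ℤ) → b (-i) = N - i * b 1) ∨
      ((∀ i, 1 ≤ i → i ≤ (v : ℤ) → b i = N - i * (N - b 1)) ∧
      ∀ i, 1 ≤ i → i ≤ (u : ℤ) → b (-i) = i * (N - b 1)) := by
    rcases hp with hp | hp <;> rcases hm with hm | hm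
    · by_cases hv : v ≤ 1
      · refine Or.inr ⟨fun i hi hi' => ?_, hm⟩
        obtain rfl : i = 1 := by omega
        ring
      · by_cases hu : u ≤ 1
        · refine Or.inl ⟨hp, fun i hi hi' => ?_⟩
          obtain rfl : i = 1 := by omega
          rw [hneg1]
          ring
        · have h3 := hp 2 (by norm_num) (by omega)
          have h4 := hm 2 (by norm_num) (by omega)
          have := hbN 2
          have := hbN (-2)
          omega
    · exact Or.inl ⟨hp, hm⟩
    · exact Or.inr ⟨hp, hm⟩
    · by_cases hv : v ≤ 1
      · refine Or.inl ⟨fun i hi hi' => ?_, hm⟩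
        obtain rfl : i = 1 := by omega
        ring
      · by_cases hu : u ≤ 1
        · refine Or.inr ⟨hp, fun i hi hi' => ?_⟩
          obtain rfl : i = 1 := by omega
          rw [hneg1]
          ring
        · have h3 := hp 2 (by norm_num) (by omega)
          have h4 := hm 2 (by norm_num) (by omega)
          have := hpos 2 (by omega) (by omega) (by norm_num)
          have := hpos (-2) (by omega) (by omega) (by norm_num)
          omega
  rcases hfin with ⟨hp, hm⟩ | ⟨hp, hm⟩
  · refine isBiAP_of_two_progressions A 0 (N - u * b 1) (b 1) v u (fun x => ?_) (by omega) hs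
    constructor
    · intro hx
      rcases hAb x hx with rfl | ⟨i, hi, hi', rfl⟩
      · exact Or.inr ⟨u, by omega, le_rfl, by ring⟩
      · rcases lt_trichotomy i 0 with h3 | rfl | h3
        · refine Or.inr ⟨u + i, by omega, by omega, ?_⟩
          have := hm (-i) (by omega) (by omega)
          rw [neg_neg] at this
          rw [this]
          ring
        · exact Or.inl ⟨0, le_rfl, by omega, by rw [hb00]; ring⟩
        · exact Or.inl ⟨i, by omega, hi', by rw [hp i (by omega) hi']; ring⟩
    · rintro (⟨i, hi, hi', rfl⟩ | ⟨i, hi, hi', rfl⟩)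
      · rcases hi.lt_or_eq with h3 | rfl
        · have := hbA i (by omega) hi'
          rw [hp i (by omega) hi'] at this
          convert this using 1
          ring
        · simpa using h.zero_mem
      · rcases hi'.lt_or_eq with h3 | rfl
        · have := hbA (-(u - i)) (by omega) (by omega)
          rw [hm (u - i) (by omega) (by omega)] at this
          convert this using 1
          ring
        · convert h.top_mem using 1
          ring
  · refine isBiAP_of_two_progressions A (N - v * (N - b 1)) 0 (N - b 1) v u (fun x => ?_)
      (by omega) hs
    constructor
    · intro hx
      rcases hAb x hx with rfl | ⟨i, hi, hi', rfl⟩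
      · exact Or.inl ⟨v, by omega, le_rfl, by ring⟩
      · rcases lt_trichotomy i 0 with h3 | rfl | h3
        · refine Or.inr ⟨-i, by omega, by omega, ?_⟩
          have := hm (-i) (by omega) (by omega)
          rw [neg_neg] at this
          rw [this]
          ring
        · exact Or.inr ⟨0, le_rfl, by omega, by rw [hb00]; ring⟩
        · exact Or.inl ⟨v - i, by omega, by omega, by rw [hp i (by omega) hi']; ring⟩
    · rintro (⟨i, hi, hi', rfl⟩ | ⟨i, hi, hi', rfl⟩)
      · rcases hi'.lt_or_eq with h3 | rfl
        · have := hbA (v - i) (by omega) (by omega)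
          rw [hp (v - i) (by omega) (by omega)] at this
          convert this using 1
          ring
        · convert h.top_mem using 1
          ring
      · rcases hi.lt_or_eq with h3 | rfl
        · have := hbA (-i) (by omega) (by omega)
          rw [hm i (by omega) hi'] at this
          convert this using 1
          ring
        · simpa using h.zero_mem

end Reduction

/-! ### Accounting for the losses in residue classes -/

/-- A sum over pairs of representatives, regrouped by the entries of the pairs. -/
theorem sum_representatives {G : Type*} [DecidableEq G] {F S : Finset G} {f g : G → G} (hf : ∀ u ∈ F, f u ∈ S)
    (hg : ∀ u ∈ F, g u ∈ S) (l : G → ℤ) :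
    ∑ u ∈ F, l (f u) + ∑ u ∈ F, l (g u) =
      ∑ i ∈ S, l i * ((F.filter fun u => f u = i).card + (F.filter fun u => g u = i).card : ℕ) := by
  have hone : ∀ f : G → G, (∀ u ∈ F, f u ∈ S) →
      ∑ u ∈ F, l (f u) = ∑ i ∈ S, l i * ((F.filter fun u => f u = i).card : ℕ) := by
    intro f hf
    rw [← Finset.sum_fiberwise_of_maps_to hf]
    refine Finset.sum_congr rfl fun i _ => ?_
    rw [Finset.sum_congr rfl (g := fun _ => l i) fun u hu => by rw [(Finset.mem_filter.1 hu).2],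
      Finset.sum_const, nsmul_eq_mul, mul_comm]
  rw [hone f hf, hone g hg, ← Finset.sum_add_distrib]
  refine Finset.sum_congr rfl fun i _ => ?_
  push_cast
  ring

section Loss

variable {G : Type*} [AddCommGroup G] [DecidableEq G]

/-- An element occurs in few pairs of representatives. -/
theorem card_representatives_le {F S : Finset G} {f g : G → G} (hf : ∀ u ∈ F, f u ∈ S)
    (hg : ∀ u ∈ F, g u ∈ S) (hfg : ∀ u ∈ F, f u + g u = u) (i : G) :
    (F.filter fun u => f u = i).card + (F.filter fun u => g u = i).card ≤
        (F.filter fun u => f u = i ∨ g u = i).card + 1 ∧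
      (F.filter fun u => f u = i ∨ g u = i).card ≤ S.card := by
  rw [← Finset.card_union_add_card_inter, ← Finset.filter_or]
  constructor
  · refine Nat.add_le_add_left ?_ _
    rw [Finset.card_le_one]
    have h1 : ∀ u ∈ (F.filter fun u => f u = i) ∩ F.filter fun u => g u = i, u = i + i := by
      intro u hu
      rw [Finset.mem_inter, Finset.mem_filter, Finset.mem_filter] at hu
      rw [← hfg u hu.1.1, hu.1.2, hu.2.2]
    intro u hu w hw
    rw [h1 u hu, h1 w hw]
  · rw [← Finset.card_singleton_add i S]
    apply Finset.card_le_card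
    intro u hu
    obtain ⟨hu, hu'⟩ := Finset.mem_filter.1 hu
    rcases hu' with h1 | h1
    · exact Finset.mem_add.2 ⟨i, Finset.mem_singleton_self i, g u, hg u hu, h1 ▸ hfg u hu⟩
    · exact Finset.mem_add.2 ⟨i, Finset.mem_singleton_self i, f u, hf u hu, by
        rw [add_comm, ← h1]; exact hfg u hu⟩

/-- The sizes `a c` of the classes of a set and the sizes `M c` of the classes of its sumset, for a
set that is nearly full in `h`-element classes indexed by `C`. -/
structure IsClassSizes (C : Finset G) (a M : G → ℤ) (h k : ℤ) : Prop where
  zero_mem : 0 ∈ C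
  sum : ∑ c ∈ C, a c = k
  sum_add : ∑ c ∈ C + C, M c = 3 * k - 3
  zero_le : a 0 ≤ h + 1
  le : ∀ c ∈ C, c ≠ 0 → a c ≤ h
  near : C.card * h + 2 ≤ h + k
  two_le : 2 ≤ C.card
  card_add : 2 * C.card ≤ (C + C).card + 1
  le_zero : 2 * a 0 - 1 ≤ M 0
  le_self : ∀ c ∈ C, c ≠ 0 → h + a c ≤ M c
  le_add : ∀ i ∈ C, ∀ j ∈ C, a i + a j ≤ M (i + j) + 1
  one_le : 1 ≤ h

namespace IsClassSizes

variable {C : Finset G} {a M : G → ℤ} {h k : ℤ}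

/-- All lower bounds for the class sizes M are added up, each sum outside C being bounded through a
chosen pair of summands. The total 3k - 3 leaves no slack, so every inequality is an equality. -/
theorem of_representatives (H : IsClassSizes C a M h k) {f g : G → G}
    (hf : ∀ u ∈ (C + C) \ C, f u ∈ C.erase 0) (hg : ∀ u ∈ (C + C) \ C, g u ∈ C.erase 0)
    (hfg : ∀ u ∈ (C + C) \ C, f u + g u = u) :
    a 0 = h + 1 ∧ ((C + C) \ C).card + 1 = C.card ∧
      (C.card = 2 ∨ ∑ c ∈ C.erase 0, (h - a c) = h - 1) ∧
      (∀ c ∈ C, c ≠ 0 → M c = h + a c) ∧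
      ∀ i ∈ C.erase 0, a i = h ∨ (((C + C) \ C).filter fun u => f u = i ∨ g u = i).card + 1 =
        C.card := by
  have hCC : C ⊆ C + C := fun c hc => Finset.mem_add.2 ⟨c, hc, 0, H.zero_mem, add_zero c⟩
  set S := C.erase 0 with hS
  set F := (C + C) \ C with hF
  have hSc : S.card + 1 = C.card := Finset.card_erase_add_one H.zero_mem
  have hFc : F.card + C.card = (C + C).card := Finset.card_sdiff_add_card_eq_card hCC
  have hSmem : ∀ c, c ∈ S ↔ c ≠ 0 ∧ c ∈ C := fun c => Finset.mem_erase
  set mult : G → ℕ := fun i => (F.filter fun u => f u = i).card + (F.filter fun u => g u = i).card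
    with hmult
  have hmult_le : ∀ i, mult i ≤ C.card := fun i => by
    have := card_representatives_le hf hg hfg i
    simp only [hmult]
    omega
  have e0 : a 0 + ∑ c ∈ S, a c = k := by rw [← H.sum]; exact Finset.add_sum_erase C a H.zero_mem
  have e1 : ∑ c ∈ F, M c + (M 0 + ∑ c ∈ S, M c) = 3 * k - 3 := by
    rw [← H.sum_add, ← Finset.sum_sdiff hCC, Finset.add_sum_erase C M H.zero_mem]
  have e2 : ∑ c ∈ S, (M c - (h + a c)) = ∑ c ∈ S, M c - S.card * h - ∑ c ∈ S, a c := by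
    rw [Finset.sum_sub_distrib, Finset.sum_add_distrib, Finset.sum_const, nsmul_eq_mul]
    ring
  have e3 : ∑ u ∈ F, (M u + 1 - (a (f u) + a (g u))) =
      ∑ u ∈ F, M u + F.card - (∑ u ∈ F, a (f u) + ∑ u ∈ F, a (g u)) := by
    rw [Finset.sum_sub_distrib, Finset.sum_add_distrib, Finset.sum_add_distrib, Finset.sum_const,
      nsmul_eq_mul, mul_one]
  have e4 : ∑ u ∈ F, (h - a (f u)) + ∑ u ∈ F, (h - a (g u)) =
      2 * (F.card * h) - (∑ u ∈ F, a (f u) + ∑ u ∈ F, a (g u)) := by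
    rw [Finset.sum_sub_distrib, Finset.sum_sub_distrib, Finset.sum_const, nsmul_eq_mul]
    ring
  have e5 := sum_representatives hf hg (fun c => h - a c)
  have e6 : ∑ c ∈ S, (h - a c) = S.card * h - ∑ c ∈ S, a c := by
    rw [Finset.sum_sub_distrib, Finset.sum_const, nsmul_eq_mul]
  have e7 : ∑ i ∈ S, (h - a i) * ((C.card : ℤ) - (mult i : ℕ)) =
      (∑ i ∈ S, (h - a i)) * C.card - ∑ i ∈ S, (h - a i) * (mult i : ℕ) := by
    rw [Finset.sum_mul, ← Finset.sum_sub_distrib]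
    exact Finset.sum_congr rfl fun i _ => by ring
  have hℓ : ∀ c ∈ S, 0 ≤ h - a c := fun c hc => by
    have := H.le c ((hSmem c).1 hc).2 ((hSmem c).1 hc).1
    omega
  have p1 : ∀ c ∈ S, 0 ≤ M c - (h + a c) := fun c hc => by
    have := H.le_self c ((hSmem c).1 hc).2 ((hSmem c).1 hc).1
    omega
  have p2 : ∀ u ∈ F, 0 ≤ M u + 1 - (a (f u) + a (g u)) := fun u hu => by
    have := H.le_add (f u) ((hSmem _).1 (hf u hu)).2 (g u) ((hSmem _).1 (hg u hu)).2
    rw [hfg u hu] at this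
    omega
  have p3 : ∀ i ∈ S, 0 ≤ (h - a i) * ((C.card : ℤ) - (mult i : ℕ)) := fun i hi =>
    mul_nonneg (hℓ i hi) (by have := hmult_le i; omega)
  have q1 := Finset.sum_nonneg p1
  have q2 := Finset.sum_nonneg p2
  have q3 := Finset.sum_nonneg p3
  have hzl := H.zero_le
  have hz := H.le_zero
  have hnear := H.near
  have h2 := H.two_le
  have hca := H.card_add
  have h1 := H.one_le
  set D := ∑ c ∈ S, (h - a c) with hD
  set X := ∑ c ∈ S, (M c - (h + a c)) with hX
  set Y := ∑ u ∈ F, (M u + 1 - (a (f u) + a (g u))) with hY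
  set Z := ∑ i ∈ S, (h - a i) * ((C.card : ℤ) - (mult i : ℕ)) with hZ
  have hScz : (S.card : ℤ) = C.card - 1 := by omega
  rw [hScz] at e2 e6
  -- D is the total loss of the non-zero classes. Near-fullness bounds it because class 0 has at
  -- most h + 1 elements.
  have hDle : D ≤ h - 1 := by nlinarith
  have q4 : 0 ≤ ((F.card : ℤ) - (C.card - 1)) * (2 * h - 1) := mul_nonneg (by omega) (by omega)
  have q5 : 0 ≤ ((C.card : ℤ) - 2) * (h - 1 - D) := mul_nonneg (by omega) (by omega)
  -- The slacks, all non-negative, add up to zero. Each conclusion reads off the vanishing of one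
  -- summand.
  have htot : (M 0 - (2 * a 0 - 1)) + X + Y + Z + (h + 1 - a 0) +
      ((F.card : ℤ) - (C.card - 1)) * (2 * h - 1) + ((C.card : ℤ) - 2) * (h - 1 - D) = 0 := by
    have e8 : ∑ i ∈ S, (h - a i) * (mult i : ℕ) = 2 * (F.card * h) -
        (∑ u ∈ F, a (f u) + ∑ u ∈ F, a (g u)) := by rw [← e4]; exact e5.symm
    have e9 : D * C.card - Z = ∑ i ∈ S, (h - a i) * (mult i : ℕ) := by rw [e7]; ring
    linear_combination e1 - 3 * e0 + e2 + e3 + 2 * e6 - e8 - e9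
  have r4 : ((F.card : ℤ) - (C.card - 1)) * (2 * h - 1) = 0 := by omega
  have r5 : ((C.card : ℤ) - 2) * (h - 1 - D) = 0 := by omega
  refine ⟨by omega, ?_, ?_, ?_, ?_⟩
  · rcases mul_eq_zero.1 r4 with h3 | h3 <;> omega
  · rcases mul_eq_zero.1 r5 with h3 | h3
    · left; omega
    · right; omega
  · intro c hc hc0
    have h3 := (Finset.sum_eq_zero_iff_of_nonneg p1).1 (by omega) c ((hSmem c).2 ⟨hc0, hc⟩)
    omega
  · intro i hi
    have h3 := (Finset.sum_eq_zero_iff_of_nonneg p3).1 (by omega) i hi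
    rcases mul_eq_zero.1 h3 with h4 | h4
    · left; omega
    · right
      have := card_representatives_le hf hg hfg i
      simp only [hmult] at h4
      push_cast at h4
      omega

theorem exists_representatives (C : Finset G) : ∃ f g : G → G,
    ∀ u ∈ (C + C) \ C, f u ∈ C.erase 0 ∧ g u ∈ C.erase 0 ∧ f u + g u = u := by
  have h1 : ∀ u : G, ∃ p : G × G, u ∈ (C + C) \ C → p.1 ∈ C.erase 0 ∧ p.2 ∈ C.erase 0 ∧
      p.1 + p.2 = u := by
    intro u
    by_cases hu : u ∈ (C + C) \ C
    · obtain ⟨hu, huC⟩ := Finset.mem_sdiff.1 hu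
      obtain ⟨x, hx, y, hy, rfl⟩ := Finset.mem_add.1 hu
      refine ⟨(x, y), fun _ => ⟨Finset.mem_erase.2 ⟨?_, hx⟩, Finset.mem_erase.2 ⟨?_, hy⟩, rfl⟩⟩
      · rintro rfl
        exact huC (by rwa [zero_add])
      · rintro rfl
        exact huC (by rwa [add_zero])
    · exact ⟨(0, 0), fun hu' => absurd hu' hu⟩
  choose p hp using h1
  exact ⟨fun u => (p u).1, fun u => (p u).2, hp⟩

theorem zero_eq (H : IsClassSizes C a M h k) : a 0 = h + 1 := by
  obtain ⟨f, g, hfg⟩ := exists_representatives C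
  exact (H.of_representatives (fun u hu => (hfg u hu).1) (fun u hu => (hfg u hu).2.1)
    fun u hu => (hfg u hu).2.2).1

theorem card_sdiff (H : IsClassSizes C a M h k) : ((C + C) \ C).card + 1 = C.card := by
  obtain ⟨f, g, hfg⟩ := exists_representatives C
  exact (H.of_representatives (fun u hu => (hfg u hu).1) (fun u hu => (hfg u hu).2.1)
    fun u hu => (hfg u hu).2.2).2.1

theorem sum_loss (H : IsClassSizes C a M h k) (h3 : 3 ≤ C.card) :
    ∑ c ∈ C.erase 0, (h - a c) = h - 1 := by
  obtain ⟨f, g, hfg⟩ := exists_representatives C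
  exact (H.of_representatives (fun u hu => (hfg u hu).1) (fun u hu => (hfg u hu).2.1)
    fun u hu => (hfg u hu).2.2).2.2.1.resolve_left (by omega)

theorem eq_self (H : IsClassSizes C a M h k) {c : G} (hc : c ∈ C) (hc0 : c ≠ 0) :
    M c = h + a c := by
  obtain ⟨f, g, hfg⟩ := exists_representatives C
  exact (H.of_representatives (fun u hu => (hfg u hu).1) (fun u hu => (hfg u hu).2.1)
    fun u hu => (hfg u hu).2.2).2.2.2.1 c hc hc0

/-- A class that is not full takes part in every sum outside `C`. -/
theorem eq_or_eq_of_notMem (H : IsClassSizes C a M h k) {x y i : G} (hx : x ∈ C) (hy : y ∈ C)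
    (hxy : x + y ∉ C) (hi : i ∈ C) (hi0 : i ≠ 0) (hai : a i ≠ h) : x = i ∨ y = i := by
  by_contra! hcon
  obtain ⟨f, g, hfg⟩ := exists_representatives C
  have hx0 : x ≠ 0 := by
    rintro rfl
    exact hxy (by rwa [zero_add])
  have hy0 : y ≠ 0 := by
    rintro rfl
    exact hxy (by rwa [add_zero])
  -- The chosen pairs are arbitrary, so (x, y) may serve for x + y. A class that is not full occurs
  -- in |C| - 1 pairs, that is, in all of them.
  have hfg' : ∀ u ∈ (C + C) \ C, Function.update f (x + y) x u ∈ C.erase 0 ∧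
      Function.update g (x + y) y u ∈ C.erase 0 ∧
      Function.update f (x + y) x u + Function.update g (x + y) y u = u := by
    intro u hu
    rcases eq_or_ne u (x + y) with rfl | hne
    · simp only [Function.update_self]
      exact ⟨Finset.mem_erase.2 ⟨hx0, hx⟩, Finset.mem_erase.2 ⟨hy0, hy⟩, trivial⟩
    · simp only [Function.update_of_ne hne]
      exact hfg u hu
  have h1 := ((H.of_representatives (fun u hu => (hfg' u hu).1) (fun u hu => (hfg' u hu).2.1)
    fun u hu => (hfg' u hu).2.2).2.2.2.2 i (Finset.mem_erase.2 ⟨hi0, hi⟩)).resolve_left hai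
  have h2 := H.card_sdiff
  have hmem : x + y ∈ (C + C) \ C := Finset.mem_sdiff.2 ⟨Finset.add_mem_add hx hy, hxy⟩
  have h3 : ((C + C) \ C).filter (fun u => Function.update f (x + y) x u = i ∨
      Function.update g (x + y) y u = i) = (C + C) \ C :=
    Finset.eq_of_subset_of_card_le (Finset.filter_subset _ _) (by omega)
  rw [← h3] at hmem
  have h4 := (Finset.mem_filter.1 hmem).2
  simp only [Function.update_self] at h4
  exact h4.elim hcon.1 hcon.2

/-- With at least three classes, exactly one class is not full. -/
theorem exists_unique_loss (H : IsClassSizes C a M h k) (h3 : 3 ≤ C.card) (h2 : 2 ≤ h) :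
    ∃ i ∈ C, i ≠ 0 ∧ a i = 1 ∧ (∀ c ∈ C, c ≠ 0 → c ≠ i → a c = h) ∧
      ∀ x ∈ C.erase i, ∀ y ∈ C.erase i, x + y ∈ C := by
  have hsum := H.sum_loss h3
  have hex : ∃ i ∈ C.erase 0, h - a i ≠ 0 := by
    by_contra! hcon
    rw [Finset.sum_eq_zero hcon] at hsum
    omega
  obtain ⟨i, hi, hai⟩ := hex
  have hi' := Finset.mem_erase.1 hi
  have huniq : ∀ c ∈ C, c ≠ 0 → c ≠ i → a c = h := by
    intro c hc hc0 hci
    by_contra hac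
    -- Two non-full classes i and c take part in every sum outside C, so i + c is the only one. But
    -- there are |C| - 1 ≥ 2 of them.
    have h4 : (C + C) \ C ⊆ {i + c} := by
      intro u hu
      obtain ⟨hu, huC⟩ := Finset.mem_sdiff.1 hu
      obtain ⟨x, hx, y, hy, rfl⟩ := Finset.mem_add.1 hu
      have h5 := H.eq_or_eq_of_notMem hx hy huC hi'.2 hi'.1 (by omega)
      have h6 := H.eq_or_eq_of_notMem hx hy huC hc hc0 hac
      rw [Finset.mem_singleton]
      rcases h5 with rfl | rfl <;> rcases h6 with rfl | rfl
      · exact absurd rfl hci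
      · rfl
      · exact add_comm _ _
      · exact absurd rfl hci
    have h5 := Finset.card_le_card h4
    rw [Finset.card_singleton] at h5
    have := H.card_sdiff
    omega
  refine ⟨i, hi'.2, hi'.1, ?_, huniq, ?_⟩
  · rw [Finset.sum_eq_single_of_mem i hi] at hsum
    · omega
    · intro c hc hci
      rw [huniq c (Finset.mem_erase.1 hc).2 (Finset.mem_erase.1 hc).1 hci, sub_self]
  · intro x hx y hy
    rw [Finset.mem_erase] at hx hy
    by_contra hxy
    exact (H.eq_or_eq_of_notMem hx.2 hy.2 hxy hi'.2 hi'.1 (by omega)).elim hx.1 hy.1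

end IsClassSizes

end Loss

/-! ### Sizes of the residue classes of A and 2A -/

/-- The elements of `A` in the residue class `c` modulo `d`. -/
def residueClass (A : Finset ℤ) (d : ℕ) (c : ZMod d) : Finset ℤ :=
  A.filter fun x : ℤ => (x : ZMod d) = c

section ResidueClass

variable {A : Finset ℤ} {d h N : ℕ}

theorem mem_residueClass {c : ZMod d} {x : ℤ} :
    x ∈ residueClass A d c ↔ x ∈ A ∧ (x : ZMod d) = c := by
  rw [residueClass, Finset.mem_filter]

theorem residueClass_nonempty {c : ZMod d} (hc : c ∈ red A d) : (residueClass A d c).Nonempty := by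
  obtain ⟨a, ha, hac⟩ := mem_red.1 hc
  exact ⟨a, mem_residueClass.2 ⟨ha, hac⟩⟩

theorem sum_card_residueClass (A : Finset ℤ) (d : ℕ) :
    ∑ c ∈ red A d, ((residueClass A d c).card : ℤ) = A.card := by
  rw [Finset.card_eq_sum_card_fiberwise (f := fun x : ℤ => (x : ZMod d)) (t := red A d)
    fun x hx => intCast_mem_red hx]
  push_cast
  rfl

theorem residueClass_add_subset (A : Finset ℤ) (d : ℕ) (i j : ZMod d) :
    residueClass A d i + residueClass A d j ⊆ residueClass (A + A) d (i + j) := by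
  intro x hx
  obtain ⟨a, ha, b, hb, rfl⟩ := Finset.mem_add.1 hx
  rw [mem_residueClass] at ha hb ⊢
  exact ⟨Finset.add_mem_add ha.1 hb.1, by push_cast; rw [ha.2, hb.2]⟩

theorem card_add_card_le_residueClass {i j : ZMod d} (hi : i ∈ red A d) (hj : j ∈ red A d) :
    (residueClass A d i).card + (residueClass A d j).card ≤
      (residueClass (A + A) d (i + j)).card + 1 := by
  have h1 := cauchy_davenport_add_of_linearOrder_isCancelAdd (residueClass_nonempty hi)
    (residueClass_nonempty hj)
  have h2 := Finset.card_le_card (residueClass_add_subset A d i j)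
  omega

theorem mem_residueClass_Ico [NeZero d] {u : ZMod d} {x : ℤ} :
    x ∈ residueClass (Finset.Ico 0 ((d * h : ℕ) : ℤ)) d u ↔
      ∃ i : ℤ, 0 ≤ i ∧ i < h ∧ x = u.val + d * i := by
  have hd : (0 : ℤ) < d := by exact_mod_cast Nat.pos_of_ne_zero (NeZero.ne d)
  have hu : ((u.val : ℤ) : ZMod d) = u := by
    push_cast
    exact ZMod.natCast_zmod_val u
  have huv : (u.val : ℤ) < d := by exact_mod_cast u.val_lt
  rw [mem_residueClass, Finset.mem_Ico]
  push_cast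
  constructor
  · rintro ⟨⟨h0, h1⟩, h2⟩
    rw [← hu, ZMod.intCast_eq_intCast_iff_dvd_sub] at h2
    obtain ⟨i, hi⟩ := h2
    refine ⟨-i, ?_, ?_, by linarith⟩
    · by_contra h3
      nlinarith
    · by_contra h3
      nlinarith
  · rintro ⟨i, hi0, hih, rfl⟩
    refine ⟨⟨by positivity, by nlinarith⟩, ?_⟩
    push_cast
    rw [ZMod.natCast_self, zero_mul, add_zero]
    exact ZMod.natCast_zmod_val u

theorem card_residueClass_Ico [NeZero d] (u : ZMod d) :
    (residueClass (Finset.Ico 0 ((d * h : ℕ) : ℤ)) d u).card = h := by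
  have h1 : residueClass (Finset.Ico 0 ((d * h : ℕ) : ℤ)) d u =
      (Finset.Ico (0 : ℤ) h).image fun i : ℤ => (u.val : ℤ) + d * i := by
    ext x
    rw [mem_residueClass_Ico, Finset.mem_image]
    simp only [Finset.mem_Ico, and_assoc, eq_comm]
  rw [h1, Finset.card_image_of_injective, Int.card_Ico]
  · omega
  · intro i j hij
    simpa [NeZero.ne d] using hij

theorem IsNormal.residueClass_subset (hA : IsNormal A ((d * h : ℕ) : ℤ)) {u : ZMod d} (hu : u ≠ 0) :
    residueClass A d u ⊆ residueClass (Finset.Ico 0 ((d * h : ℕ) : ℤ)) d u := by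
  intro x hx
  rw [mem_residueClass] at hx ⊢
  refine ⟨Finset.mem_Ico.2 ⟨hA.nonneg x hx.1, lt_of_le_of_ne (hA.le_top x hx.1) ?_⟩, hx.2⟩
  rintro rfl
  apply hu
  rw [← hx.2]
  push_cast
  rw [ZMod.natCast_self, zero_mul]

theorem IsNormal.residueClass_zero_subset (hA : IsNormal A ((d * h : ℕ) : ℤ)) :
    residueClass A d 0 ⊆ insert ((d * h : ℕ) : ℤ)
      (residueClass (Finset.Ico 0 ((d * h : ℕ) : ℤ)) d 0) := by
  intro x hx
  rw [Finset.mem_insert]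
  rw [mem_residueClass] at hx ⊢
  rcases (hA.le_top x hx.1).lt_or_eq with h1 | h1
  · exact Or.inr ⟨Finset.mem_Ico.2 ⟨hA.nonneg x hx.1, h1⟩, hx.2⟩
  · exact Or.inl h1

theorem card_insert_residueClass_Ico [NeZero d] :
    (insert ((d * h : ℕ) : ℤ) (residueClass (Finset.Ico 0 ((d * h : ℕ) : ℤ)) d 0)).card = h + 1 := by
  rw [Finset.card_insert_of_notMem, card_residueClass_Ico]
  rw [mem_residueClass, Finset.mem_Ico]
  omega

/-- Two classes with many elements have a sumset that is full modulo `N`. -/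
theorem IsNormal.add_card_le_residueClass [NeZero d] (hA : IsNormal A ((d * h : ℕ) : ℤ))
    {u : ZMod d} (hu : u ≠ 0)
    (hc : h + 2 ≤ (residueClass A d 0).card + (residueClass A d u).card) :
    h + (residueClass A d u).card ≤ (residueClass (A + A) d u).card := by
  set n : ℤ := ((d * h : ℕ) : ℤ) with hn
  have hn0 : ((n : ℤ) : ZMod d) = 0 := by
    rw [hn]
    push_cast
    rw [ZMod.natCast_self, zero_mul]
  set R := residueClass (Finset.Ico 0 n) d u with hR
  have hRc : R.card = h := card_residueClass_Ico u
  have hRmem : ∀ x, x ∈ R ↔ (0 ≤ x ∧ x < n) ∧ (x : ZMod d) = u := fun x => by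
    rw [hR, mem_residueClass, Finset.mem_Ico]
  have hsub : residueClass A d u ⊆ R := hA.residueClass_subset hu
  set P := R.filter fun x => x ∈ A + A with hP
  set Q := R.filter fun x => x + n ∈ A + A with hQ
  have h0n : n ∈ residueClass A d 0 := mem_residueClass.2 ⟨hA.top_mem, hn0⟩
  have hA0 : ((residueClass A d 0).erase n).card + 1 = (residueClass A d 0).card :=
    Finset.card_erase_add_one h0n
  -- Pigeonhole modulo n: the values r - a for a in class 0, with n discarded, and the elements of
  -- class u number more than h in a class of size h. So r or r + n is a sum.
  have hcover : ∀ r ∈ R, r ∈ P ∨ r ∈ Q := by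
    intro r hr
    have hr' := (hRmem r).1 hr
    obtain ⟨f, hf⟩ : ∃ f : ℤ → ℤ, ∀ a, f a = if a ≤ r then r - a else r - a + n := ⟨_, fun _ => rfl⟩
    have hA0mem : ∀ a ∈ (residueClass A d 0).erase n, a ∈ A ∧ 0 ≤ a ∧ a < n ∧ (a : ZMod d) = 0 := by
      intro a ha
      rw [Finset.mem_erase, mem_residueClass] at ha
      exact ⟨ha.2.1, hA.nonneg a ha.2.1, lt_of_le_of_ne (hA.le_top a ha.2.1) ha.1, ha.2.2⟩
    have hfc : (((residueClass A d 0).erase n).image f).card =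
        ((residueClass A d 0).erase n).card := by
      refine Finset.card_image_of_injOn ?_
      intro a ha b hb hab
      have h1 := hA0mem a ha
      have h2 := hA0mem b hb
      rw [hf, hf] at hab
      split_ifs at hab <;> omega
    have hnd : ¬ Disjoint (((residueClass A d 0).erase n).image f) (residueClass A d u) := by
      intro hd
      have h1 := Finset.card_union_of_disjoint hd
      have h2 : ((residueClass A d 0).erase n).image f ∪ residueClass A d u ⊆ R := by
        refine Finset.union_subset ?_ hsub
        intro x hx
        obtain ⟨a, ha, rfl⟩ := Finset.mem_image.1 hx
        have h3 := hA0mem a ha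
        rw [hRmem, hf]
        split_ifs with h4
        · refine ⟨by omega, ?_⟩
          push_cast
          rw [hr'.2, h3.2.2.2, sub_zero]
        · refine ⟨by omega, ?_⟩
          rw [Int.cast_add, Int.cast_sub, hr'.2, h3.2.2.2, hn0, sub_zero, add_zero]
      have h3 := Finset.card_le_card h2
      omega
    rw [Finset.not_disjoint_iff] at hnd
    obtain ⟨x, hx, hxu⟩ := hnd
    obtain ⟨a, ha, rfl⟩ := Finset.mem_image.1 hx
    have h1 := hA0mem a ha
    have h2 := Finset.add_mem_add h1.1 (mem_residueClass.1 hxu).1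
    rw [hP, hQ, Finset.mem_filter, Finset.mem_filter]
    rw [hf] at h2
    split_ifs at h2 with h4
    · left
      rw [add_sub_cancel] at h2
      exact ⟨hr, h2⟩
    · right
      rw [show a + (r - a + n) = r + n by ring] at h2
      exact ⟨hr, h2⟩
  have hPQ : P ∪ Q = R := by
    ext r
    rw [Finset.mem_union]
    exact ⟨fun h1 => h1.elim (fun h2 => (Finset.mem_filter.1 h2).1)
      fun h2 => (Finset.mem_filter.1 h2).1, hcover r⟩
  have hinter : residueClass A d u ⊆ P ∩ Q := by
    intro x hx
    have h1 := (mem_residueClass.1 hx).1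
    rw [Finset.mem_inter, hP, hQ, Finset.mem_filter, Finset.mem_filter]
    exact ⟨⟨hsub hx, hA.mem_add_of_mem h1⟩, hsub hx, hA.mem_add_top_of_mem h1⟩
  have hfin : P ∪ Q.image (· + n) ⊆ residueClass (A + A) d u := by
    intro x hx
    rw [Finset.mem_union] at hx
    rw [mem_residueClass]
    rcases hx with hx | hx
    · obtain ⟨h1, h2⟩ := Finset.mem_filter.1 hx
      exact ⟨h2, ((hRmem x).1 h1).2⟩
    · obtain ⟨y, hy, rfl⟩ := Finset.mem_image.1 hx
      obtain ⟨h1, h2⟩ := Finset.mem_filter.1 hy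
      refine ⟨h2, ?_⟩
      rw [Int.cast_add, ((hRmem y).1 h1).2, hn0, add_zero]
  have hdisj : Disjoint P (Q.image (· + n)) := by
    rw [Finset.disjoint_left]
    intro x hx hx'
    obtain ⟨y, hy, rfl⟩ := Finset.mem_image.1 hx'
    have h1 := ((hRmem _).1 (Finset.mem_filter.1 hx).1).1
    have h2 := ((hRmem _).1 (Finset.mem_filter.1 hy).1).1
    omega
  have h1 := Finset.card_le_card hfin
  rw [Finset.card_union_of_disjoint hdisj,
    Finset.card_image_of_injective _ (add_left_injective n)] at h1
  have h2 := Finset.card_union_add_card_inter P Q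
  have h3 := Finset.card_le_card hinter
  rw [hPQ] at h2
  omega

theorem IsNormal.isClassSizes [NeZero d] (hA : IsNormal A ((d * h : ℕ) : ℤ))
    (hs : (A + A).card = 3 * A.card - 3) (hnear : (red A d).card * h + 2 ≤ h + A.card)
    (h2 : 2 ≤ (red A d).card) (hcard : 2 * (red A d).card ≤ (red A d + red A d).card + 1) :
    IsClassSizes (red A d) (fun c => ((residueClass A d c).card : ℤ))
      (fun c => ((residueClass (A + A) d c).card : ℤ)) h A.card := by
  have hzero : (0 : ZMod d) ∈ red A d := by
    have := intCast_mem_red (m := d) hA.zero_mem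
    simpa using this
  have hle0 : (residueClass A d 0).card ≤ h + 1 := by
    rw [← card_insert_residueClass_Ico (d := d)]
    exact Finset.card_le_card hA.residueClass_zero_subset
  have hle : ∀ c : ZMod d, c ≠ 0 → (residueClass A d c).card ≤ h := by
    intro c hc
    rw [← card_residueClass_Ico (h := h) c]
    exact Finset.card_le_card (hA.residueClass_subset hc)
  have hsum := sum_card_residueClass A d
  have hA2 : 2 ≤ A.card := h2.trans Finset.card_image_le
  refine ⟨hzero, hsum, ?_, by exact_mod_cast hle0, fun c _ hc => by exact_mod_cast hle c hc,
    by exact_mod_cast hnear, h2, hcard, ?_, ?_, ?_, ?_⟩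
  · rw [← red_add, sum_card_residueClass, hs]
    omega
  · have := card_add_card_le_residueClass hzero hzero
    rw [add_zero] at this
    omega
  · intro c hc hc0
    -- The classes other than 0 and c hold at most h elements each, so near-fullness leaves at least
    -- h + 2 for these two.
    have h3 := hA.add_card_le_residueClass hc0 (by
      have h4 := Finset.add_sum_erase (red A d) (fun c => ((residueClass A d c).card : ℤ)) hzero
      have hc' : c ∈ (red A d).erase 0 := Finset.mem_erase.2 ⟨hc0, hc⟩
      have h5 := Finset.add_sum_erase _ (fun c => ((residueClass A d c).card : ℤ)) hc'
      have h6 : ∑ x ∈ ((red A d).erase 0).erase c, ((residueClass A d x).card : ℤ) ≤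
          (((red A d).erase 0).erase c).card • (h : ℤ) := by
        refine Finset.sum_le_card_nsmul _ _ _ fun x hx => ?_
        have := hle x (Finset.mem_erase.1 (Finset.mem_erase.1 hx).2).1
        exact_mod_cast this
      have h7 := Finset.card_erase_add_one hc'
      have h8 := Finset.card_erase_add_one hzero
      have h9 : ((((red A d).erase 0).erase c).card : ℤ) = (red A d).card - 2 := by omega
      rw [nsmul_eq_mul, h9] at h6
      have h10 : ((red A d).card : ℤ) * h + 2 ≤ h + A.card := by exact_mod_cast hnear
      have : ((h : ℤ) + 2) ≤ (residueClass A d 0).card + (residueClass A d c).card := by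
        nlinarith
      exact_mod_cast this)
    exact_mod_cast h3
  · intro i hi j hj
    have := card_add_card_le_residueClass hi hj
    exact_mod_cast this
  · have := hA.pos
    have h3 : h ≠ 0 := by
      rintro rfl
      simp at this
    omega

end ResidueClass

/-! ### Classification of nearly periodic sets -/

section NearPeriodic

variable {A : Finset ℤ} {d h : ℕ}

theorem IsNormal.mem_residueClass_zero [NeZero d] (hA : IsNormal A ((d * h : ℕ) : ℤ))
    (hfull : (residueClass A d 0).card = h + 1) {x : ℤ} :
    x ∈ residueClass A d 0 ↔ ∃ i : ℤ, 0 ≤ i ∧ i ≤ h ∧ x = d * i := by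
  have h1 : residueClass A d 0 = insert ((d * h : ℕ) : ℤ)
      (residueClass (Finset.Ico 0 ((d * h : ℕ) : ℤ)) d 0) :=
    Finset.eq_of_subset_of_card_le hA.residueClass_zero_subset
      (by rw [card_insert_residueClass_Ico, hfull])
  rw [h1, Finset.mem_insert, mem_residueClass_Ico, ZMod.val_zero]
  push_cast
  constructor
  · rintro (rfl | ⟨i, hi, hi', rfl⟩)
    · exact ⟨h, by omega, le_rfl, rfl⟩
    · exact ⟨i, hi, hi'.le, by ring⟩
  · rintro ⟨i, hi, hi', rfl⟩
    rcases hi'.lt_or_eq with h2 | rfl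
    · exact Or.inr ⟨i, hi, h2, by ring⟩
    · exact Or.inl rfl

theorem IsNormal.mem_residueClass_of_full [NeZero d] (hA : IsNormal A ((d * h : ℕ) : ℤ))
    {u : ZMod d} (hu : u ≠ 0) (hfull : (residueClass A d u).card = h) {x : ℤ} :
    x ∈ residueClass A d u ↔ ∃ i : ℤ, 0 ≤ i ∧ i < h ∧ x = u.val + d * i := by
  rw [Finset.eq_of_subset_of_card_le (hA.residueClass_subset hu)
    (by rw [card_residueClass_Ico, hfull]), mem_residueClass_Ico]

/-- Two residue classes: both are progressions. -/
theorem IsNormal.isBiAP_of_two_classes [NeZero d] (hA : IsNormal A ((d * h : ℕ) : ℤ))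
    (hs : (A + A).card = 3 * A.card - 3) (hfull : (residueClass A d 0).card = h + 1) {c : ZMod d}
    (hc0 : c ≠ 0) (hc : red A d = {0, c})
    (hM : (residueClass (A + A) d c).card = h + (residueClass A d c).card) : IsBiAP A := by
  have hd : (0 : ℤ) < d := by exact_mod_cast Nat.pos_of_ne_zero (NeZero.ne d)
  have hz := fun x => hA.mem_residueClass_zero hfull (x := x)
  have hne := residueClass_nonempty (A := A) (d := d) (c := c) (by rw [hc]; simp)
  obtain ⟨p, hp, hpmin⟩ := (residueClass A d c).exists_min_image id hne
  obtain ⟨r, hr, hrmax⟩ := (residueClass A d c).exists_max_image id hne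
  simp only [id] at hpmin hrmax
  have hstep : ∀ x ∈ residueClass A d c, ∃ i : ℤ, x = p + d * i := by
    intro x hx
    have h1 := (mem_residueClass.1 hx).2
    rw [← (mem_residueClass.1 hp).2, eq_comm, ZMod.intCast_eq_intCast_iff_dvd_sub] at h1
    obtain ⟨i, hi⟩ := h1
    exact ⟨i, by linarith⟩
  obtain ⟨t, ht⟩ := hstep r hr
  have ht0 : 0 ≤ t := by
    have := hpmin r hr
    nlinarith
  have hth : t < h := by
    have h1 := (mem_residueClass.1 (hA.residueClass_subset hc0 hr)).1
    have h2 := (mem_residueClass.1 (hA.residueClass_subset hc0 hp)).1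
    rw [Finset.mem_Ico] at h1 h2
    push_cast at h1 h2
    nlinarith
  -- Class 0 is the full progression 0, d, ..., dh. Adding the extreme elements p and p + dt of
  -- class c already gives h + t + 1 sums, so |class c| ≥ t + 1 and that class has no gaps.
  have hbig : (Finset.Icc 0 (h + t : ℤ)).image (fun i : ℤ => p + d * i) ⊆
      residueClass (A + A) d c := by
    intro x hx
    obtain ⟨i, hi, rfl⟩ := Finset.mem_image.1 hx
    rw [Finset.mem_Icc] at hi
    have h1 := residueClass_add_subset A d 0 c
    rw [zero_add] at h1
    apply h1
    by_cases hih : i ≤ h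
    · rw [add_comm p]
      exact Finset.add_mem_add ((hz _).2 ⟨i, hi.1, hih, rfl⟩) hp
    · have : p + d * i = d * (i - t) + r := by rw [ht]; ring
      rw [this]
      exact Finset.add_mem_add ((hz _).2 ⟨i - t, by omega, by omega, rfl⟩) hr
  have hsmall : residueClass A d c ⊆ (Finset.Icc 0 t).image fun i : ℤ => p + d * i := by
    intro x hx
    obtain ⟨i, rfl⟩ := hstep x hx
    have h1 := hpmin _ hx
    have h2 := hrmax _ hx
    exact Finset.mem_image.2 ⟨i, Finset.mem_Icc.2 ⟨by nlinarith, by nlinarith⟩, rfl⟩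
  have hinj : Function.Injective fun i : ℤ => p + d * i := fun i j hij => by
    simpa [NeZero.ne d] using hij
  have h1 := Finset.card_le_card hbig
  have h2 := Finset.card_le_card hsmall
  rw [Finset.card_image_of_injective _ hinj, Int.card_Icc] at h1 h2
  have h3 : residueClass A d c = (Finset.Icc 0 t).image fun i : ℤ => p + d * i :=
    Finset.eq_of_subset_of_card_le hsmall (by
      rw [Finset.card_image_of_injective _ hinj, Int.card_Icc]
      omega)
  have h4 := sum_card_residueClass A d
  rw [hc, Finset.sum_pair hc0.symm, hfull, h3, Finset.card_image_of_injective _ hinj,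
    Int.card_Icc] at h4
  refine isBiAP_of_two_progressions A 0 p d h t.toNat (fun x => ?_) (by omega) hs
  constructor
  · intro hx
    have h5 : (x : ZMod d) ∈ red A d := intCast_mem_red hx
    rw [hc, Finset.mem_insert, Finset.mem_singleton] at h5
    rcases h5 with h5 | h5
    · obtain ⟨i, hi, hi', rfl⟩ := (hz x).1 (mem_residueClass.2 ⟨hx, h5⟩)
      exact Or.inl ⟨i, hi, hi', by ring⟩
    · have h6 := mem_residueClass.2 ⟨hx, h5⟩
      rw [h3, Finset.mem_image] at h6
      obtain ⟨i, hi, rfl⟩ := h6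
      rw [Finset.mem_Icc] at hi
      exact Or.inr ⟨i, hi.1, by omega, rfl⟩
  · rintro (⟨i, hi, hi', rfl⟩ | ⟨i, hi, hi', rfl⟩)
    · have := (mem_residueClass.1 ((hz (d * i)).2 ⟨i, hi, hi', rfl⟩)).1
      rwa [zero_add]
    · have h6 : p + d * i ∈ residueClass A d c := by
        rw [h3]
        exact Finset.mem_image.2 ⟨i, Finset.mem_Icc.2 ⟨hi, by omega⟩, rfl⟩
      exact (mem_residueClass.1 h6).1

/-- Two full classes, one of them containing the end points, and a third one with a single
element. -/
theorem IsNormal.eq_of_three_classes [NeZero d] (hA : IsNormal A ((d * 2 : ℕ) : ℤ))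
    (hz : (residueClass A d 0).card = 3) {q : ZMod d} (hq0 : q ≠ 0)
    (hC : red A d = {0, q, q + q}) (hq : (residueClass A d q).card = 2)
    (hqq1 : (residueClass A d (q + q)).card = 1)
    (hM : (residueClass (A + A) d (q + q)).card = 3) :
    A = ({0, (d : ℤ), 2 * (d : ℤ), (q.val : ℤ), (q.val : ℤ) + d, 2 * (q.val : ℤ)} : Finset ℤ) := by
  have hd : (0 : ℤ) < d := by exact_mod_cast Nat.pos_of_ne_zero (NeZero.ne d)
  have hz' := fun x => hA.mem_residueClass_zero hz (x := x)
  have hq' := fun x => hA.mem_residueClass_of_full hq0 hq (x := x)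
  obtain ⟨y, hy⟩ := Finset.card_eq_one.1 hqq1
  have hyA : y ∈ residueClass A d (q + q) := hy ▸ Finset.mem_singleton_self y
  have h1 : ({y, y + d, y + 2 * d} : Finset ℤ) ⊆ residueClass (A + A) d (q + q) := by
    intro x hx
    have h2 := residueClass_add_subset A d (q + q) 0
    rw [add_zero] at h2
    apply h2
    simp only [Finset.mem_insert, Finset.mem_singleton] at hx
    rcases hx with rfl | rfl | rfl
    · exact Finset.mem_add.2 ⟨_, hyA, 0, (hz' _).2 ⟨0, by norm_num, by norm_num, by ring⟩, by ring⟩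
    · exact Finset.add_mem_add hyA ((hz' _).2 ⟨1, by norm_num, by norm_num, by ring⟩)
    · exact Finset.add_mem_add hyA ((hz' _).2 ⟨2, by norm_num, by norm_num, by ring⟩)
  have h2 : ({y, y + d, y + 2 * d} : Finset ℤ) = residueClass (A + A) d (q + q) := by
    refine Finset.eq_of_subset_of_card_le h1 ?_
    rw [hM, Finset.card_eq_three.2 ⟨y, y + d, y + 2 * d, by omega, by omega, by omega, rfl⟩]
  have hx0 : (q.val : ℤ) ∈ residueClass A d q := (hq' _).2 ⟨0, by norm_num, by norm_num, by ring⟩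
  have hx1 : (q.val : ℤ) + d ∈ residueClass A d q :=
    (hq' _).2 ⟨1, by norm_num, by norm_num, by ring⟩
  -- The three sums in class 2q are y, y + d, y + 2d. They include 2x and 2x + 2d for the least
  -- element x of class q, whence y = 2x.
  have h3 := residueClass_add_subset A d q q (Finset.add_mem_add hx0 hx0)
  have h4 := residueClass_add_subset A d q q (Finset.add_mem_add hx1 hx1)
  rw [← h2] at h3 h4
  simp only [Finset.mem_insert, Finset.mem_singleton] at h3 h4
  have h5 : y = 2 * q.val := by omega
  ext x
  simp only [Finset.mem_insert, Finset.mem_singleton]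
  constructor
  · intro hx
    have h6 : (x : ZMod d) ∈ red A d := intCast_mem_red hx
    rw [hC] at h6
    simp only [Finset.mem_insert, Finset.mem_singleton] at h6
    rcases h6 with h6 | h6 | h6
    · obtain ⟨i, hi, hi', rfl⟩ := (hz' x).1 (mem_residueClass.2 ⟨hx, h6⟩)
      obtain rfl | rfl | rfl : i = 0 ∨ i = 1 ∨ i = 2 := by push_cast at hi'; omega
      · left; ring
      · right; left; ring
      · right; right; left; ring
    · obtain ⟨i, hi, hi', rfl⟩ := (hq' x).1 (mem_residueClass.2 ⟨hx, h6⟩)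
      obtain rfl | rfl : i = 0 ∨ i = 1 := by push_cast at hi'; omega
      · right; right; right; left; ring
      · right; right; right; right; left; ring
    · have h7 : x ∈ residueClass A d (q + q) := mem_residueClass.2 ⟨hx, h6⟩
      rw [hy, Finset.mem_singleton] at h7
      omega
  · rintro (rfl | rfl | rfl | rfl | rfl | rfl)
    · exact hA.zero_mem
    · exact (mem_residueClass.1 ((hz' _).2 ⟨1, by norm_num, by norm_num, by ring⟩)).1
    · exact (mem_residueClass.1 ((hz' _).2 ⟨2, by norm_num, by norm_num, by ring⟩)).1
    · exact (mem_residueClass.1 hx0).1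
    · exact (mem_residueClass.1 hx1).1
    · rw [← h5]
      exact (mem_residueClass.1 hyA).1

/-- A set of residues that would be closed under addition without one of its elements, and that is
far from being a union of cosets, consists of `0`, `q` and `2q`. -/
theorem eq_triple_of_erase [NeZero d] {C : Finset (ZMod d)} {i : ZMod d} (h0 : 0 ∈ C) (hi : i ∈ C)
    (hi0 : i ≠ 0) (h3 : 3 ≤ C.card) (hd : C.card < d)
    (hcl : ∀ x ∈ C.erase i, ∀ y ∈ C.erase i, x + y ∈ C)
    (hmin : ∀ K : AddSubgroup (ZMod d), K ≠ ⊥ → K ≠ ⊤ →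
      (subgroupFinset K).card + C.card ≤ (subgroupFinset K + C).card) :
    ∃ q, q ≠ 0 ∧ i = q + q ∧ C = {0, q, q + q} := by
  set C' := C.erase i with hC'
  have hC'c : C'.card + 1 = C.card := Finset.card_erase_add_one hi
  have h0' : 0 ∈ C' := Finset.mem_erase.2 ⟨hi0.symm, h0⟩
  have hCmem : ∀ x, x ∈ C ↔ x = i ∨ x ∈ C' := fun x => by
    rw [← Finset.insert_erase hi, Finset.mem_insert]
  have hiC' : i ∉ C' := Finset.notMem_erase i C
  -- If i = q + y with summands in C', then C' gains at most the element i under translation by q.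
  -- By `hmin` q generates, so C' is a progression. If i is no such sum, C' is a subgroup K, and K +
  -- C consists of at most two cosets, fewer than `hmin` demands.
  by_cases hex : ∃ x ∈ C', ∃ y ∈ C', x + y = i
  · obtain ⟨q, hq, y, hy, hqy⟩ := hex
    have hq0 : q ≠ 0 := by
      rintro rfl
      rw [zero_add] at hqy
      exact hiC' (hqy ▸ hy)
    have hpair : (C' + {0, q}).card ≤ C'.card + 1 := by
      rw [hC'c]
      apply Finset.card_le_card
      intro x hx
      obtain ⟨z, hz, w, hw, rfl⟩ := Finset.mem_add.1 hx
      rw [Finset.mem_insert, Finset.mem_singleton] at hw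
      rcases hw with rfl | rfl
      · rw [add_zero]
        exact Finset.mem_of_mem_erase hz
      · exact hcl z hz w hq
    have hqcl : q ∈ AddSubgroup.closure {q} := AddSubgroup.subset_closure rfl
    have htop : AddSubgroup.closure {q} = ⊤ := by
      by_contra hne
      have h4 := hmin (AddSubgroup.closure {q}) (fun h5 => hq0 (by
        rw [h5] at hqcl
        exact (AddSubgroup.mem_bot).1 hqcl)) hne
      have h5 := card_closure_add_le hpair
      have h6 : subgroupFinset (AddSubgroup.closure {q}) + C ⊆
          subgroupFinset (AddSubgroup.closure {q}) + C' := by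
        intro x hx
        obtain ⟨l, hl, c, hc, rfl⟩ := Finset.mem_add.1 hx
        rcases (hCmem c).1 hc with rfl | hc
        · rw [← hqy, ← add_assoc]
          refine Finset.add_mem_add ?_ hy
          rw [mem_subgroupFinset] at hl ⊢
          exact AddSubgroup.add_mem _ hl hqcl
        · exact Finset.add_mem_add hl hc
      have h7 := Finset.card_le_card h6
      omega
    obtain ⟨u, v, huv, hv, hu, hinj, hiff⟩ := exists_progression h0' hiC' htop hpair
    have hqv : 1 ≤ v := by
      obtain ⟨j, hj, hj', hjq⟩ := (hiff q).1 hq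
      have := hinj j 1 hj (by omega) (by omega) (by omega) (by rw [hjq, one_smul])
      omega
    have hmem : ∀ j : ℤ, -(u : ℤ) ≤ j → j ≤ v → j • q ∈ C' := fun j hj hj' =>
      (hiff _).2 ⟨j, hj, hj', rfl⟩
    have hlast : ((v : ℤ) + 1) • q = i := by
      have h4 := hcl _ (hmem v (by omega) le_rfl) q hq
      have h5 : (v : ℤ) • q + q = ((v : ℤ) + 1) • q := by rw [add_smul, one_smul]
      rw [h5] at h4
      exact ((hCmem _).1 h4).resolve_right hv
    have hrange : ∀ j, j • q ∈ C → ∃ j' : ℤ, -(u : ℤ) ≤ j' ∧ j' ≤ v + 1 ∧ (d : ℤ) ∣ j' - j := by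
      intro j hj
      rcases (hCmem _).1 hj with h4 | h4
      · exact ⟨v + 1, by omega, le_rfl,
          zsmul_eq_zsmul_of_closure_eq_top htop (by rw [h4, hlast])⟩
      · obtain ⟨j', h5, h6, h7⟩ := (hiff _).1 h4
        exact ⟨j', h5, by omega, zsmul_eq_zsmul_of_closure_eq_top htop h7.symm⟩
    -- For v ≥ 2 the index v + 2 would occur in C, and the mirror statement for u gives -u - 1.
    -- Since |C| = u + v + 2 < d, neither is congruent to an index in [-u, v + 1].
    have hv1 : v = 1 := by
      by_contra hv1
      have h4 := hcl _ (hmem v (by omega) le_rfl) _ (hmem 2 (by omega) (by omega))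
      rw [← add_smul] at h4
      obtain ⟨j', h5, h6, h7⟩ := hrange _ h4
      have := Int.le_of_dvd (by omega) ((dvd_neg).2 h7)
      omega
    have hu0 : u = 0 := by
      by_contra hu0
      have h4 := hcl _ (hmem (-u) le_rfl (by omega)) _ (hmem (-1) (by omega) (by omega))
      rw [← add_smul] at h4
      obtain ⟨j', h5, h6, h7⟩ := hrange _ h4
      have := Int.le_of_dvd (by omega) h7
      omega
    subst hv1 hu0
    have hi2 : i = q + q := by
      rw [← hlast, add_smul]
      simp
    refine ⟨q, hq0, hi2, ?_⟩
    ext x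
    rw [hCmem, hiff, Finset.mem_insert, Finset.mem_insert, Finset.mem_singleton, hi2]
    constructor
    · rintro (h4 | ⟨j, hj, hj', rfl⟩)
      · exact Or.inr (Or.inr h4)
      · obtain rfl | rfl : j = 0 ∨ j = 1 := by push_cast at hj hj'; omega
        · left; simp
        · right; left; simp
    · rintro (rfl | rfl | h4)
      · exact Or.inr ⟨0, by simp, by simp, by simp⟩
      · exact Or.inr ⟨1, by simp, by simp, by simp⟩
      · exact Or.inl h4
  · push Not at hex
    exfalso
    have hclosed : C' + C' ⊆ C' := by
      intro x hx
      obtain ⟨y, hy, z, hz, rfl⟩ := Finset.mem_add.1 hx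
      exact ((hCmem _).1 (hcl y hy z hz)).resolve_left (hex y hy z hz)
    obtain ⟨K, hK⟩ := exists_subgroup_of_translates h0' fun g hg =>
      Finset.eq_of_subset_of_card_le ((Finset.add_subset_add_right
        (Finset.singleton_subset_iff.2 hg)).trans hclosed) (Finset.card_singleton_add _ _).ge
    have h4 := hmin K (by
      rintro rfl
      have := card_subgroupFinset_bot (G := ZMod d)
      rw [hK] at this
      omega) (by
      rintro rfl
      refine hiC' ?_
      rw [← hK, mem_subgroupFinset]
      exact AddSubgroup.mem_top i)
    rw [hK] at h4
    have h5 : C' + C ⊆ C' ∪ ({i} + C') := by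
      intro x hx
      obtain ⟨y, hy, z, hz, rfl⟩ := Finset.mem_add.1 hx
      rw [Finset.mem_union]
      rcases (hCmem z).1 hz with rfl | hz
      · right
        rw [add_comm y]
        exact Finset.add_mem_add (Finset.mem_singleton_self _) hy
      · exact Or.inl (hclosed (Finset.add_mem_add hy hz))
    have h6 := (Finset.card_le_card h5).trans (Finset.card_union_le _ _)
    rw [Finset.card_singleton_add] at h6
    omega

/-- The classification when `A` is nearly full in classes modulo `d`, for the least `d`. -/
theorem IsNormal.isBiAP_or_K6 [NeZero d] (hA : IsNormal A ((d * h : ℕ) : ℤ)) (h2 : 2 ≤ h)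
    (hs : (A + A).card = 3 * A.card - 3) (hnear : (red A d).card * h + 2 ≤ h + A.card)
    (hC2 : 2 ≤ (red A d).card) (hcard : 2 * (red A d).card ≤ (red A d + red A d).card + 1)
    (hmin : ∀ K : AddSubgroup (ZMod d), K ≠ ⊥ → K ≠ ⊤ →
      (subgroupFinset K).card + (red A d).card ≤ (subgroupFinset K + red A d).card) :
    IsBiAP A ∨ A.card = 6 ∧ ∃ φ : ℤ × ℤ → ℤ, IsAddFreimanIso 2 K6 (A : Set ℤ) φ := by
  have H := hA.isClassSizes hs hnear hC2 hcard
  have hzero := H.zero_eq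
  have hfull : (residueClass A d 0).card = h + 1 := by exact_mod_cast hzero
  rcases hC2.lt_or_eq with h3 | h3
  · right
    obtain ⟨i, hi, hi0, hi1, hother, hcl⟩ := H.exists_unique_loss h3 (by exact_mod_cast h2)
    have hsd := H.card_sdiff
    have hcd : (red A d).card < d := by
      have h4 := Finset.card_sdiff_add_card_eq_card (s := red A d) (t := red A d + red A d)
        fun c hc => Finset.mem_add.2 ⟨c, hc, 0, H.zero_mem, add_zero c⟩
      have h5 := Finset.card_le_univ (red A d + red A d)
      rw [ZMod.card] at h5
      omega
    obtain ⟨q, hq0, rfl, hC⟩ := eq_triple_of_erase H.zero_mem hi hi0 h3 hcd hcl hmin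
    have hqC : q ∈ red A d := by rw [hC]; simp
    have hqne : q ≠ q + q := fun h4 => hq0 (by simpa using h4)
    have hqh := hother q hqC hq0 hqne
    have hM := H.eq_self hi hi0
    -- Two full classes q add up to at least 2h - 1 sums in class i, which has h + 1 of them; so h =
    -- 2.
    have h4 := H.le_add q hqC q hqC
    rw [hqh, hM, hi1] at h4
    obtain rfl : h = 2 := by omega
    have hq2 : (residueClass A d q).card = 2 := by exact_mod_cast hqh
    have hqq1 : (residueClass A d (q + q)).card = 1 := by exact_mod_cast hi1
    have hqqM : (residueClass (A + A) d (q + q)).card = 3 := by omega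
    have h5 := hA.eq_of_three_classes hfull hq0 hC hq2 hqq1 hqqM
    have h6 : A.card = 6 := by
      have h7 := sum_card_residueClass A d
      rw [hC, Finset.sum_insert (by simp [hq0.symm, hi0.symm]), Finset.sum_pair hqne, hfull, hq2,
        hqq1] at h7
      omega
    exact ⟨h6, isAddFreimanIso_K6_of_eq A _ _ h5 h6 hs⟩
  · left
    have h4 := Finset.card_erase_add_one H.zero_mem
    obtain ⟨c, hc⟩ := Finset.card_eq_one.1 (show ((red A d).erase 0).card = 1 by omega)
    have hcmem : c ∈ (red A d).erase 0 := hc ▸ Finset.mem_singleton_self c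
    rw [Finset.mem_erase] at hcmem
    have hC : red A d = {0, c} := by
      rw [← Finset.insert_erase H.zero_mem, hc]
    have hM := H.eq_self hcmem.2 hcmem.1
    exact hA.isBiAP_of_two_classes hs hfull hcmem.1 hC (by exact_mod_cast hM)

end NearPeriodic

/-- For the least d no proper non-trivial subgroup modulo d nearly preserves the set C of classes,
since it would give a smaller d. Mann's theorem then yields |C + C| ≥ 2|C| - 1, and gcd 1 yields at
least two classes. -/
theorem IsNormal.isBiAP_or_K6_of_isNearPeriodic {A : Finset ℤ} {N : ℕ} (hA : IsNormal A N)
    (hgcd : A.gcd id = 1) (hs : (A + A).card = 3 * A.card - 3) (hN : 2 * A.card ≤ N + 2)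
    (hex : ∃ d, IsNearPeriodic A N d) :
    IsBiAP A ∨ A.card = 6 ∧ ∃ φ : ℤ × ℤ → ℤ, IsAddFreimanIso 2 K6 (A : Set ℤ) φ := by
  obtain ⟨d, hd, hleast⟩ :
      ∃ d, IsNearPeriodic A N d ∧ ∀ d', d' < d → ¬ IsNearPeriodic A N d' := by
    classical exact ⟨Nat.find hex, Nat.find_spec hex, fun d' => Nat.find_min hex⟩
  obtain ⟨⟨h, rfl⟩, h1d, hdN, hnear⟩ := hd
  have : NeZero d := ⟨by omega⟩
  rw [Nat.mul_div_cancel_left _ (by omega : 0 < d)] at hnear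
  have h2 : 2 ≤ h := by
    by_contra h3
    obtain rfl | rfl : h = 0 ∨ h = 1 := by omega
    · simp at hdN
    · simp at hdN
  have hmin : ∀ K : AddSubgroup (ZMod d), K ≠ ⊥ → K ≠ ⊤ →
      (subgroupFinset K).card + (red A d).card ≤ (subgroupFinset K + red A d).card := by
    intro K hK hK'
    by_contra hlt
    have h3 := isNearPeriodic_index (A := A) (N := d * h) (d := d) (by omega) ⟨h, rfl⟩
      (by rwa [Nat.mul_div_cancel_left _ (by omega : 0 < d)]) hK hK' (by omega)
    exact hleast _ h3.2 h3.1
  have hzero : (0 : ZMod d) ∈ red A d := by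
    have := intCast_mem_red (m := d) hA.zero_mem
    simpa using this
  have hC2 : 2 ≤ (red A d).card := by
    by_contra hC
    have h3 : ∀ a ∈ A, (d : ℤ) ∣ a := by
      intro a ha
      rw [← ZMod.intCast_zmod_eq_zero_iff_dvd]
      exact Finset.card_le_one.1 (by omega) _ (intCast_mem_red ha) _ hzero
    have h4 : (d : ℤ) ∣ A.gcd id := Finset.dvd_gcd h3
    rw [hgcd] at h4
    have := Int.le_of_dvd one_pos h4
    omega
  refine hA.isBiAP_or_K6 h2 hs hnear hC2 ?_ hmin
  by_contra hcard
  -- With more classes, near-fullness would give A more than (N + 2) / 2 elements. The bound ensures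
  -- that C + C is not everything, as Mann's theorem needs.
  have h3 : 2 * (red A d).card < d + 2 := by
    by_contra h4
    have h5 : (d + 2) * h ≤ 2 * (red A d).card * h := Nat.mul_le_mul_right h (by omega)
    have h6 : (d + 2) * h = d * h + 2 * h := by ring
    have h7 : 2 * (red A d).card * h = 2 * ((red A d).card * h) := by ring
    omega
  have htop : (subgroupFinset (⊤ : AddSubgroup (ZMod d))).card = d := by
    rw [card_subgroupFinset, AddSubgroup.card_top, Nat.card_zmod]
  have hsub : red A d ⊆ subgroupFinset (⊤ : AddSubgroup (ZMod d)) := fun x _ =>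
    mem_subgroupFinset.2 (AddSubgroup.mem_top x)
  obtain ⟨K, hK, -, hK', hKc⟩ := exists_subgroup_of_card_add_lt ⊤ hsub hsub ⟨0, hzero⟩ ⟨0, hzero⟩
    (by omega) (by omega)
  have := hmin K hK hK'
  omega

theorem IsNormal.exists_isNearPeriodic_of_subgroup {A : Finset ℤ} {N : ℕ} [NeZero N]
    (hA : IsNormal A N) {H : AddSubgroup (ZMod N)} (hH : H ≠ ⊥) (hH' : H ≠ ⊤)
    (h : (subgroupFinset H + red A N).card + 1 ≤ (subgroupFinset H).card + (red A N).card) :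
    ∃ d, IsNearPeriodic A N d := by
  have h1 : 0 < N := Nat.pos_of_ne_zero (NeZero.ne N)
  have h2 := hA.card_red
  exact ⟨_, (isNearPeriodic_index h1 dvd_rfl (by rw [Nat.div_self h1]; omega) hH hH' h).1⟩

/-- A set of half density modulo `N` whose sumset misses two elements is periodic. -/
theorem IsNormal.exists_isNearPeriodic_of_two_le {A : Finset ℤ} {N : ℕ} (hA : IsNormal A N)
    (hN : 2 * A.card = N + 2) (hw : 1 < (neitherSet A N).card) : ∃ d, IsNearPeriodic A N d := by
  have hpos := hA.pos
  have : NeZero N := ⟨by omega⟩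
  have hk := hA.card_red
  obtain ⟨r, hr, r', hr', hne⟩ := Finset.one_lt_card.1 hw
  -- B has exactly N / 2 elements and r - B avoids it, so r - B is the complement of B. Two such
  -- centres r, r' make r' - r a period.
  have hcompl : ∀ r ∈ neitherSet A N, ∀ x : ZMod N, x ∈ red A N ↔ (r : ZMod N) - x ∉ red A N := by
    intro r hr x
    rw [neitherSet, Finset.mem_filter, Finset.mem_Ioo] at hr
    have h1 : (r : ZMod N) ∉ red A N + red A N := by
      rw [hA.intCast_mem_red_add_iff hr.1.1.le hr.1.2, not_or]
      exact hr.2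
    have h2 : (red A N).image (fun b => (r : ZMod N) - b) = (red A N)ᶜ := by
      refine Finset.eq_of_subset_of_card_le ?_ ?_
      · intro y hy
        obtain ⟨b, hb, rfl⟩ := Finset.mem_image.1 hy
        rw [Finset.mem_compl]
        intro h3
        refine h1 (Finset.mem_add.2 ⟨_, h3, b, hb, sub_add_cancel _ _⟩)
      · rw [Finset.card_image_of_injective _ (fun a b hab => by simpa using hab),
          Finset.card_compl, ZMod.card]
        omega
    have h3 := Finset.ext_iff.1 h2 ((r : ZMod N) - x)
    rw [Finset.mem_compl] at h3
    rw [← h3, Finset.mem_image]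
    constructor
    · intro hx
      exact ⟨x, hx, rfl⟩
    · rintro ⟨b, hb, hbx⟩
      rwa [← sub_right_injective hbx]
  set t : ZMod N := r' - r with ht
  have ht0 : t ≠ 0 := by
    intro h1
    rw [neitherSet, Finset.mem_filter, Finset.mem_Ioo] at hr hr'
    exact hne (intCast_injOn_Ico N ⟨hr.1.1.le, hr.1.2⟩ ⟨hr'.1.1.le, hr'.1.2⟩
      (sub_eq_zero.1 h1).symm)
  have hcl : red A N + {t} ⊆ red A N := by
    intro x hx
    obtain ⟨b, hb, s, hs, rfl⟩ := Finset.mem_add.1 hx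
    rw [Finset.mem_singleton.1 hs]
    by_contra h1
    have h2 := mt (hcompl r' hr' _).2 h1
    rw [not_not, show (r' : ZMod N) - (b + t) = r - b by rw [ht]; ring] at h2
    exact (hcompl r hr b).1 hb h2
  have hmem : t ∈ AddSubgroup.closure {t} := AddSubgroup.subset_closure rfl
  refine hA.exists_isNearPeriodic_of_subgroup (H := AddSubgroup.closure {t}) ?_ ?_
    (card_closure_add_le ?_)
  · intro h1
    rw [h1] at hmem
    exact ht0 (AddSubgroup.mem_bot.1 hmem)
  · intro h1
    have h2 : ∀ x : ZMod N, x ∈ red A N := by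
      intro x
      have h3 := add_mem_of_mem_closure hcl (intCast_mem_red (m := N) hA.zero_mem) (x := x)
        (by rw [Finset.coe_singleton, h1]; exact AddSubgroup.mem_top x)
      simpa using h3
    have h3 := Finset.card_le_card (fun x _ => h2 x : (Finset.univ : Finset (ZMod N)) ⊆ red A N)
    rw [Finset.card_univ, ZMod.card] at h3
    omega
  · refine (Finset.card_le_card ?_).trans (Nat.le_succ _)
    intro x hx
    obtain ⟨b, hb, s, hs, rfl⟩ := Finset.mem_add.1 hx
    rw [Finset.mem_insert, Finset.mem_singleton] at hs
    rcases hs with rfl | rfl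
    · rwa [add_zero]
    · exact hcl (Finset.add_mem_add hb (Finset.mem_singleton_self _))

/-- The sparse case: `2|A| ≤ n + 1`. -/
theorem IsNormal.isBiAP_or_K6_of_sparse {A : Finset ℤ} {N : ℕ} (hA : IsNormal A N)
    (hgcd : A.gcd id = 1) (hs : (A + A).card = 3 * A.card - 3) (h3 : 3 ≤ A.card)
    (hN : 2 * A.card ≤ N + 1) :
    IsBiAP A ∨ A.card = 6 ∧ ∃ φ : ℤ × ℤ → ℤ, IsAddFreimanIso 2 K6 (A : Set ℤ) φ := by
  have : NeZero N := ⟨by omega⟩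
  have hk := hA.card_red
  have hBB := hA.card_red_add_add_bothSet hs (by omega)
  have hnear := hA.isBiAP_or_K6_of_isNearPeriodic hgcd hs (by omega)
  rcases exists_translation_or_subgroup (B := red A N) (by omega) (by omega)
    (by rw [Nat.card_zmod]; omega) with ⟨q, hq0, hq⟩ | ⟨H, hH, hH', hHB⟩
  · by_cases htop : AddSubgroup.closure {q} = ⊤
    · left
      obtain ⟨x₀, hx₀⟩ : ∃ x₀, x₀ ∉ red A N := by
        by_contra! hall
        have h4 := Finset.card_le_card
          (fun x _ => hall x : (Finset.univ : Finset (ZMod N)) ⊆ red A N)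
        rw [Finset.card_univ, ZMod.card] at h4
        omega
      have hzero : (0 : ZMod N) ∈ red A N := by
        have := intCast_mem_red (m := N) hA.zero_mem
        simpa using this
      obtain ⟨u, v, huv, -, -, -, hiff⟩ := exists_progression hzero hx₀ htop hq
      exact hA.isBiAP_of_progression hs (by omega) (by omega) htop huv hiff
    · refine hnear (hA.exists_isNearPeriodic_of_subgroup ?_ htop (card_closure_add_le hq))
      intro h4
      have hmem : q ∈ AddSubgroup.closure {q} := AddSubgroup.subset_closure rfl
      rw [h4] at hmem
      exact hq0 (AddSubgroup.mem_bot.1 hmem)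
  · exact hnear (hA.exists_isNearPeriodic_of_subgroup hH hH' hHB)

/-! ### Assembling the cases -/

theorem mainTheorem1 (A : Finset ℤ) (n : ℤ)
    (hmin : IsLeast (A : Set ℤ) 0) (hmax : IsGreatest (A : Set ℤ) n) (hgcd : A.gcd id = 1)
    (hcard : 2 ≤ A.card) (hsum : (A + A).card = 3 * A.card - 3) :
    IsBiAP A ∨
    (∃ x : ℤ, Finset.Icc x (x + (2 * (A.card : ℤ) - 1) - 1) ⊆ A + A) ∨
    (A.card = 6 ∧ ∃ φ : ℤ × ℤ → ℤ, IsAddFreimanIso 2 K6 (A : Set ℤ) φ) ∨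
    (2 * (A.card : ℤ) = n + 2 ∧
      (HasFormT n A ∨ (∃ T : Finset ℤ, HasFormT n T ∧ A = T.image (fun t => n - t)) ∨
        HasFormS n A)) := by
  have hn0 : 0 ≤ n := hmin.2 hmax.1
  have hn : 0 < n := by
    by_contra hn
    have h1 : A ⊆ {0} := fun x hx => by
      have := hmin.2 (Finset.mem_coe.2 hx)
      have := hmax.2 (Finset.mem_coe.2 hx)
      rw [Finset.mem_singleton]
      omega
    have h2 := Finset.card_le_card h1
    rw [Finset.card_singleton] at h2
    omega
  have hA : IsNormal A n := ⟨hn, hmin.1, hmax.1, fun x hx => hmin.2 hx, fun x hx => hmax.2 hx⟩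
  lift n to ℕ using hn0
  by_cases h1 : (n : ℤ) + 3 ≤ 2 * A.card
  · rcases hA.isBiAP_or_exists_Icc (e := 2 * A.card - 2 - n) (by ring) (by omega) hsum with h2 | h2
    · exact Or.inl h2
    · exact Or.inr (Or.inl h2)
  have h3 : 3 ≤ A.card := by
    by_contra h3
    have h4 : A = {0, (n : ℤ)} := by
      refine (Finset.eq_of_subset_of_card_le ?_ ?_).symm
      · intro x hx
        rw [Finset.mem_insert, Finset.mem_singleton] at hx
        rcases hx with rfl | rfl
        · exact hmin.1
        · exact hmax.1
      · rw [Finset.card_pair hn.ne]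
        omega
    rw [h4] at hgcd
    have h5 : ((n : ℕ) : ℤ) ∣ ({0, (n : ℤ)} : Finset ℤ).gcd id := by
      refine Finset.dvd_gcd fun x hx => ?_
      rw [Finset.mem_insert, Finset.mem_singleton] at hx
      rcases hx with rfl | rfl
      · exact dvd_zero _
      · exact dvd_rfl
    rw [hgcd] at h5
    have := Int.le_of_dvd one_pos h5
    omega
  have hlift : ∀ {P Q R S : Prop}, P ∨ R → P ∨ Q ∨ R ∨ S :=
    fun h => h.elim Or.inl fun h => Or.inr (Or.inr (Or.inl h))
  by_cases h2 : 2 * (A.card : ℤ) = n + 2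
  · have hc := hA.card_add
    by_cases hw : 1 < (neitherSet A n).card
    · exact hlift (hA.isBiAP_or_K6_of_isNearPeriodic hgcd hsum (by omega)
        (hA.exists_isNearPeriodic_of_two_le (by omega) hw))
    -- For 2|A| = n + 2 the count gives |`neitherSet`| = |`bothSet`| + 1, so at most one element in
    -- the former means exactly one, and none in the latter.
    · have hboth : bothSet A n = ∅ := by
        rw [← Finset.card_eq_zero]
        omega
      obtain ⟨r, hr⟩ := Finset.card_eq_one.1 (show (neitherSet A n).card = 1 by omega)
      have hr1 : r ∈ neitherSet A n := hr ▸ Finset.mem_singleton_self r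
      rw [neitherSet, Finset.mem_filter, Finset.mem_Ioo] at hr1
      have hcrit : IsCritical A n r := by
        refine ⟨hA, h2, hr1.1.1, hr1.1.2, fun h4 => hr1.2.1 (hA.mem_add_of_mem h4), hr1.2.1,
          hr1.2.2, ?_⟩
        intro y hy0 hyn hyA hyr
        constructor
        · intro h4 h5
          have h6 : y ∈ bothSet A n := by
            rw [bothSet, Finset.mem_filter, Finset.mem_Ioo]
            exact ⟨⟨hy0, hyn⟩, hyA, h4, h5⟩
          rw [hboth] at h6
          exact absurd h6 (Finset.notMem_empty y)
        · intro h4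
          by_contra h5
          have h6 : y ∈ neitherSet A n := by
            rw [neitherSet, Finset.mem_filter, Finset.mem_Ioo]
            exact ⟨⟨hy0, hyn⟩, h5, h4⟩
          rw [hr, Finset.mem_singleton] at h6
          exact hyr h6
      have hodd : ∃ o ∈ A, o % 2 = 1 := by
        by_contra! hodd
        have h4 : (2 : ℤ) ∣ A.gcd id := Finset.dvd_gcd fun x hx => by
          have := hodd x hx
          rw [id]
          omega
        rw [hgcd] at h4
        omega
      rcases hcrit.classification hodd hsum with h4 | h4
      · exact Or.inl h4
      · exact Or.inr (Or.inr (Or.inr ⟨h2, h4⟩))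
  · exact hlift (hA.isBiAP_or_K6_of_sparse hgcd hsum h3 (by omega))
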